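/- **Setting.** Let $\mathbb{T}^3=(\mathbb{R}/\mathbb{Z})^3$ with Lebesgue measure $dx$; repeated Latin indices run over $1,2,3$ and are summed. Fix a Kasner background: constants $q_1,q_2,q_3>0$ and $A\ge 0$ with $\sum_i q_i=1$ and $\sum_i q_i^2=1-A^2$, the metric $g_{ij}(t)=\mathrm{diag}(t^{2q_1},t^{2q_2},t^{2q_3})$ with inverse $g^{ij}$, $K^i_{\ j}=\mathrm{diag}(-q_1,-q_2,-q_3)$, $\hat K^i_{\ j}=K^i_{\ j}+\frac13\delta^i_j$, and $\sigma\ge 0$, $\sigma^2=\sum_i q_i^2-\frac13$. The unknowns on $(0,1]\times\mathbb{T}^3$ are a symmetric $h_{ij}$, a mixed tensor $\kappa^i_{\ j}$, and functions $\Phi$, $n$ (the perturbations of the spatial metric, of $t$ times the second fundamental form, of the scalar field and of the lapse). Set $$\Gamma_{a\ b}^{\ i}=\tfrac12 g^{ic}(\partial_a h_{cb}+\partial_b h_{ac}-\partial_c h_{ab}),\qquad R=-\tfrac12 g^{ab}g^{ef}\partial_e\partial_f h_{ab}+g^{ef}\partial_a\Gamma_{e\ f}^{\ a},$$ $$\mathrm{Ric}^i_{\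 j}=-\tfrac12 g^{ia}g^{ef}\partial_e\partial_f h_{ja}+\tfrac12 g^{ef}\partial_j\Gamma_{e\ f}^{\ i}+\tfrac12 g^{ia}g_{jb}g^{ef}\partial_a\Gamma_{e\ f}^{\ b}.$$ The linearized Einstein–scalar field equations in CMC-transported spatial coordinates are $$\kappa^a_{\ a}=0,\qquad t^2R-2\hat K^a_{\ b}\kappa^b_{\ a}-2At\partial_t\Phi+2A^2n=0,$$ $$\partial_a\kappa^a_{\ i}=-A\partial_i\Phi-\Gamma_{a\ b}^{\ a}\hat K^b_{\ i}+\Gamma_{a\ i}^{\ b}\hat K^a_{\ b},$$ $$g^{ab}\partial_a\kappa^i_{\ b}=-Ag^{ia}\partial_a\Phi-g^{ab}\Gamma_{a\ c}^{\ i}\hat K^c_{\ b}+g^{ab}\Gamma_{a\ b}^{\ c}\hat K^i_{\ c},$$ $$2At\partial_t\Phi+2\hat K^a_{\ b}\kappa^b_{\ a}=t^2g^{ab}\partial_a\partial_bn+(2A^2-1)n,\qquad t^2g^{ab}\partial_a\partial_bn-n=t^2R,$$ $$\partial_th_{ij}=-2t^{-1}K^a_{\ j}h_{ia}-2t^{-1}g_{ia}\kappa^a_{\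 j}-2t^{-1}g_{ia}K^a_{\ j}n,$$ $$\partial_t\kappa^i_{\ j}=-tg^{ia}\partial_a\partial_jn-t^{-1}K^i_{\ j}n+t\,\mathrm{Ric}^i_{\ j},$$ $$-\partial_t(t\partial_t\Phi)+tg^{ab}\partial_a\partial_b\Phi=-A\partial_tn+At^{-1}n.$$ A *solution* consists of $h,\kappa,\Phi,\partial_t\Phi,n$ that are in $L^2(\mathbb{T}^3)$ at each $t\in(0,1]$ and satisfy these equations in the sense of distributions in $x$, for every $t\in(0,1]$ (pairings with smooth test functions on $\mathbb{T}^3$ are differentiated in $t$ classically; in the wave equation the derivative is that of $t\partial_t\Phi-An$). **Norms and energies** (with values in $[0,\infty]$, spatial derivatives being weak ones). For a tensor field $T$, $|T|_{Frame}^2$ is the sum of the squares of its components and $|T|_g^2$ is formed with $g$ and $g^{-1}$; $\|T\|_{H^M}=\sum_{|I|\le M}\|\,|\partial_IT|_{Frame}\|_{L^2}$; $\partial$ without index is the spatial gradient. Put $$\mathcal H_M(t)=\|\kappa\|_{H^M}+\|\partial h\|_{H^M}+\|t\partial_t\Phi\|_{H^M}+t^{2/3}\|\partial\Phi\|_{H^M}+\sum_{p=0}^2t^{2p/3}\|n\|_{H^{M+p}},$$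 $$\mathcal E_\eta^2(t)=\int_{\mathbb{T}^3}\eta\Big(|\kappa|_g^2+\tfrac14|t\partial h|_g^2\Big)+(t\partial_t\Phi)^2+|t\partial\Phi|_g^2+|t\partial n|_g^2+n^2\,dx,$$ and let $\mathcal E_{\eta;M}^2(t)$ be the sum over $|I|\le M$ of the same expression with all variables replaced by their $\partial_I$-derivatives. **Theorem.** There are constants $\eta_*,C,c,\sigma_0>0$ such that for every Kasner background as above with $\sigma\le\sigma_0$ and every solution of the linearized equations the following holds. 1. If $\mathcal H_0(1)<\infty$, then for all $t\in(0,1]$ all terms below are finite and $$\mathcal E_{\eta_*}^2(t)\le C\mathcal E_{\eta_*}^2(1)-\tfrac16\eta_*\int_t^1s^{-1}\int_{\mathbb{T}^3}|s\partial h|_g^2\,dx\,ds-\tfrac16\int_t^1s^{-1}\int_{\mathbb{T}^3}|s\partial\Phi|_g^2\,dx\,ds$$ $$\qquad-\tfrac16\int_t^1s^{-1}\int_{\mathbb{T}^3}|s\partial n|_g^2\,dx\,ds-\tfrac12\int_t^1s^{-1}\int_{\mathbb{T}^3}n^2\,dx\,ds+c\sigma\int_t^1s^{-1}\mathcal E_{\eta_*}^2(s)\,ds.$$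 2. For every integer $N\ge0$ with $\mathcal H_N(1)<\infty$ and all $t\in(0,1]$: $\ \mathcal E_{\eta_*;N}(t)\le C\,\mathcal E_{\eta_*;N}(1)\,t^{-c\sigma}$. 3. For every integer $N\ge0$ with $\mathcal H_N(1)<\infty$ and all $t\in(0,1]$: $\ \mathcal H_N(t)\le C\,\mathcal H_N(1)\,t^{-c\sigma}$. -/

import Mathlib

open MeasureTheory Set
open scoped ENNReal ContDiff

noncomputable section

namespace LinKasner

/-! ### The torus, test functions, distributions -/

/-- The flat torus `𝕋³ = (ℝ/ℤ)³`; its `volume` is the standard Euclidean measure `dx`. -/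
abbrev T3 : Type := UnitAddTorus (Fin 3)

/-- The classical coordinate derivative `∂ᵢ f` on `𝕋³`. -/
def pd (i : Fin 3) (f : T3 → ℝ) (x : T3) : ℝ :=
  deriv (fun s : ℝ => f (x + Pi.single i (s : UnitAddCircle))) 0

/-- Spatial multi-indices `I = (n₁, n₂, n₃)`. -/
abbrev MIdx : Type := Fin 3 → ℕ

/-- The order `|I| = n₁ + n₂ + n₃`. -/
def order (I : MIdx) : ℕ := ∑ i, I i

/-- All multi-indices of order at most `M`. -/
def multiIdx (M : ℕ) : Finset MIdx :=
  (Fintype.piFinset fun _ : Fin 3 => Finset.range (M + 1)).filter fun I => order I ≤ M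

/-- `∂_I = ∂₁^{n₁} ∂₂^{n₂} ∂₃^{n₃}` (classical). -/
def pdI (I : MIdx) (f : T3 → ℝ) : T3 → ℝ :=
  (pd 0)^[I 0] ((pd 1)^[I 1] ((pd 2)^[I 2] f))

/-- Test functions: smooth functions on `𝕋³` (their periodic lifts to `ℝ³` are `C^∞`). -/
def IsTest (ψ : T3 → ℝ) : Prop :=
  ContDiff ℝ ∞ fun x : Fin 3 → ℝ => ψ fun i => (x i : UnitAddCircle)

/-- Functionals on test functions. -/
abbrev Distr : Type := (T3 → ℝ) → ℝ

/-- The distribution `ψ ↦ ∫ f ψ dx` of a function `f`. -/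
def toD (f : T3 → ℝ) : Distr := fun ψ => ∫ x, f x * ψ x

/-- The distributional derivative `∂ᵢ T`. -/
def dd (i : Fin 3) (T : Distr) : Distr := fun ψ => -T (pd i ψ)

/-- Equality of distributions: equal values on all test functions. -/
def DEq (S T : Distr) : Prop := ∀ ψ, IsTest ψ → S ψ = T ψ

/-- `D ∈ L²(𝕋³)` is the weak derivative `∂_I f`. -/
def IsWeakDeriv (I : MIdx) (f D : T3 → ℝ) : Prop :=
  MemLp D 2 volume ∧
    ∀ ψ, IsTest ψ → ∫ x, f x * pdI I ψ x = (-1 : ℝ) ^ order I * ∫ x, D x * ψ x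

/-- `∫_{𝕋³} Q((∂_{J c} T_c)_c) dx` for a tensor field with components `T_c` and a nonnegative
function `Q` of the values of the components, the derivatives being weak `L²` derivatives. These
are unique almost everywhere, so the infimum is over a single value if they all exist; it is `∞`
if one of them does not exist. -/
def weakInt {ι : Type} (Q : (ι → ℝ) → ℝ) (J : ι → MIdx) (T : ι → T3 → ℝ) : ℝ≥0∞ :=
  ⨅ (D : ι → T3 → ℝ) (_ : ∀ c, IsWeakDeriv (J c) (T c) (D c)),
    ∫⁻ x, ENNReal.ofReal (Q fun c => D c x)

/-! ### The Kasner background -/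

/-- Parameters of a Kasner solution `-dt² + ∑ t^{2qᵢ}(dxⁱ)²`, `φ = A ln t`, with `qᵢ > 0`. -/
structure Kasner where
  q : Fin 3 → ℝ
  A : ℝ
  q_pos : ∀ i, 0 < q i
  A_nonneg : 0 ≤ A
  sum_q : ∑ i, q i = 1
  sum_q_sq : ∑ i, q i ^ 2 = 1 - A ^ 2

namespace Kasner

variable (K : Kasner)

/-- The trace-free parameter `σ ≥ 0`, `σ² = ∑ qᵢ² - 1/3`. -/
def sigma : ℝ := Real.sqrt (∑ i, K.q i ^ 2 - 1 / 3)

/-- The Kasner 3-metric `g_{ij} = diag(t^{2q₁}, t^{2q₂}, t^{2q₃})`. -/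
def g (t : ℝ) (i j : Fin 3) : ℝ := if i = j then t ^ (2 * K.q i) else 0

/-- The inverse Kasner 3-metric `g^{ij}`. -/
def gi (t : ℝ) (i j : Fin 3) : ℝ := if i = j then t ^ (-(2 * K.q i)) else 0

/-- The time-rescaled mixed second fundamental form `t kⁱⱼ = diag(-q₁, -q₂, -q₃)`,
see `bigK_eq`. -/
def bigK (i j : Fin 3) : ℝ := if i = j then -K.q i else 0

/-- Its trace-free part `t kⁱⱼ + (1/3) δⁱⱼ`. -/
def bigKhat (i j : Fin 3) : ℝ := K.bigK i j + if i = j then 1 / 3 else 0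

/-- `bigK = t k` with `kⁱⱼ = -(1/2) g^{ia} ∂ₜ g_{aj}`. -/
theorem bigK_eq (t : ℝ) (ht : 0 < t) (i j : Fin 3) :
    K.bigK i j = t * (-(1 / 2) * ∑ a, K.gi t i a * deriv (fun s => K.g s a j) t) := by
  have hne : t ≠ 0 := ht.ne'
  have h1 : ∀ a, K.gi t i a * deriv (fun s => K.g s a j) t =
      if i = a then t ^ (-(2 * K.q i)) * deriv (fun s => K.g s i j) t else 0 := by
    intro a
    by_cases h : i = a
    · subst h; simp [gi]
    · simp [gi, h]
  simp only [h1, Finset.sum_ite_eq, Finset.mem_univ, if_true]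
  by_cases h : i = j
  · subst h
    have h2 : deriv (fun s => K.g s i i) t = 2 * K.q i * t ^ (2 * K.q i - 1) := by
      simp only [g, if_true]
      exact (Real.hasDerivAt_rpow_const (Or.inl hne)).deriv
    have h3 : t ^ (-(2 * K.q i)) * t ^ (2 * K.q i - 1) * t = 1 := by
      rw [← Real.rpow_add ht, ← Real.rpow_add_one hne]
      have : -(2 * K.q i) + (2 * K.q i - 1) + 1 = 0 := by ring
      rw [this, Real.rpow_zero]
    rw [h2]
    simp only [bigK, if_true]
    linear_combination K.q i * h3
  · simp [bigK, g, h]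

/-! Squares of the pointwise Kasner norms of tensors of the types that occur. -/

/-- `|ξ|²_g = g^{ab} ξ_a ξ_b`. -/
def normSq01 (t : ℝ) (ξ : Fin 3 → ℝ) : ℝ := ∑ a, ∑ b, K.gi t a b * ξ a * ξ b

/-- `|T|²_g = g_{ab} g^{ij} T^a_i T^b_j`. -/
def normSq11 (t : ℝ) (T : Fin 3 × Fin 3 → ℝ) : ℝ :=
  ∑ a, ∑ b, ∑ i, ∑ j, K.g t a b * K.gi t i j * T (a, i) * T (b, j)

/-- `|S|²_g = g^{ef} g^{ab} g^{ij} S_{eai} S_{fbj}`. -/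
def normSq03 (t : ℝ) (S : Fin 3 × Fin 3 × Fin 3 → ℝ) : ℝ :=
  ∑ e, ∑ f, ∑ a, ∑ b, ∑ i, ∑ j,
    K.gi t e f * K.gi t a b * K.gi t i j * S (e, a, i) * S (f, b, j)

end Kasner

/-- `|T|²_{Frame}`: the sum of the squares of the components. -/
def frameSq {ι : Type} [Fintype ι] (v : ι → ℝ) : ℝ := ∑ c, v c ^ 2

/-! ### The linearized variables and the linearized equations -/

/-- The linearized variables as functions of `t` and `x`: the metric perturbation
`h t i j = h_{ij}`, the rescaled second fundamental form perturbation `κ t i j = κⁱⱼ`, the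
scalar field perturbation `Φ` and its time derivative `Φt = ∂ₜΦ`, and the lapse perturbation
`n` (physical lapse minus one). -/
structure LinVars where
  h : ℝ → Fin 3 → Fin 3 → T3 → ℝ
  κ : ℝ → Fin 3 → Fin 3 → T3 → ℝ
  Φ : ℝ → T3 → ℝ
  Φt : ℝ → T3 → ℝ
  n : ℝ → T3 → ℝ

section Equations

variable (K : Kasner) (u : LinVars) (t : ℝ)

/-- Linearized Christoffel symbols
`Γ_a^i_b = (1/2) g^{ic} (∂_a h_{cb} + ∂_b h_{ac} - ∂_c h_{ab})`. -/
def chr (a i b : Fin 3) : Distr :=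
  ∑ c, (1 / 2 * K.gi t i c) •
    (dd a (toD (u.h t c b)) + dd b (toD (u.h t a c)) - dd c (toD (u.h t a b)))

/-- Linearized scalar curvature
`R = -(1/2) g^{ab} g^{ef} ∂_e ∂_f h_{ab} + g^{ef} ∂_a Γ_e^a_f`. -/
def scal : Distr :=
  -(∑ a, ∑ b, ∑ e, ∑ f,
      (1 / 2 * K.gi t a b * K.gi t e f) • dd e (dd f (toD (u.h t a b))))
    + ∑ a, ∑ e, ∑ f, K.gi t e f • dd a (chr K u t e a f)

/-- Linearized mixed Ricci curvature `Ricⁱⱼ = -(1/2) g^{ia} g^{ef} ∂_e ∂_f h_{ja}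
+ (1/2) g^{ef} ∂_j Γ_e^i_f + (1/2) g^{ia} g_{jb} g^{ef} ∂_a Γ_e^b_f`. -/
def ric (i j : Fin 3) : Distr :=
  -(∑ a, ∑ e, ∑ f,
      (1 / 2 * K.gi t i a * K.gi t e f) • dd e (dd f (toD (u.h t j a))))
    + ∑ e, ∑ f, (1 / 2 * K.gi t e f) • dd j (chr K u t e i f)
    + ∑ a, ∑ b, ∑ e, ∑ f,
      (1 / 2 * K.gi t i a * K.g t j b * K.gi t e f) • dd a (chr K u t e b f)

/-- `g^{ab} ∂_a ∂_b f`. -/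
def lap (f : T3 → ℝ) : Distr := ∑ a, ∑ b, K.gi t a b • dd a (dd b (toD f))

end Equations

/-- `∂ₜ F = R` at time `t ∈ (0,1]` (one-sidedly at `t = 1`) for a time-dependent distribution `F`:
paired with any test function, `F` is differentiable in time at `t`, with derivative `R`. -/
def HasTimeDeriv (F : ℝ → Distr) (R : Distr) (t : ℝ) : Prop :=
  ∀ ψ, IsTest ψ → HasDerivWithinAt (fun s => F s ψ) (R ψ) (Ioc 0 1) t

/-- `u` is a (weak) solution on `(0,1] × 𝕋³` of the Einstein-scalar field equations in
CMC-transported spatial coordinates, linearized around the Kasner solution `K`: at each time the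
variables are in `L²(𝕋³)`, and the equations hold in the sense of distributions in `x` and for
every `t ∈ (0,1]`. -/
structure IsSolution (K : Kasner) (u : LinVars) : Prop where
  h_memLp : ∀ t ∈ Ioc (0 : ℝ) 1, ∀ i j, MemLp (u.h t i j) 2 volume
  κ_memLp : ∀ t ∈ Ioc (0 : ℝ) 1, ∀ i j, MemLp (u.κ t i j) 2 volume
  Φ_memLp : ∀ t ∈ Ioc (0 : ℝ) 1, MemLp (u.Φ t) 2 volume
  Φt_memLp : ∀ t ∈ Ioc (0 : ℝ) 1, MemLp (u.Φt t) 2 volume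
  n_memLp : ∀ t ∈ Ioc (0 : ℝ) 1, MemLp (u.n t) 2 volume
  /-- `h` is a perturbation of a metric, hence symmetric. -/
  h_symm : ∀ t ∈ Ioc (0 : ℝ) 1, ∀ i j, u.h t i j =ᵐ[volume] u.h t j i
  /-- `Φt` is the time derivative of `Φ`. -/
  dt_Φ : ∀ t ∈ Ioc (0 : ℝ) 1, HasTimeDeriv (fun s => toD (u.Φ s)) (toD (u.Φt t)) t
  /-- CMC condition: `κ^a_a = 0`. -/
  cmc : ∀ t ∈ Ioc (0 : ℝ) 1, DEq (∑ a, toD (u.κ t a a)) 0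
  /-- Hamiltonian constraint. -/
  hamiltonian : ∀ t ∈ Ioc (0 : ℝ) 1,
    DEq (t ^ 2 • scal K u t - ∑ a, ∑ b, (2 * K.bigKhat a b) • toD (u.κ t b a)
      - (2 * K.A * t) • toD (u.Φt t) + (2 * K.A ^ 2) • toD (u.n t)) 0
  /-- Momentum constraint. -/
  momentum : ∀ t ∈ Ioc (0 : ℝ) 1, ∀ i,
    DEq (∑ a, dd a (toD (u.κ t a i)))
      (-(K.A • dd i (toD (u.Φ t)))
        - ∑ a, ∑ b, K.bigKhat b i • chr K u t a a b
        + ∑ a, ∑ b, K.bigKhat a b • chr K u t a b i)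
  /-- Momentum constraint, second form. -/
  momentum' : ∀ t ∈ Ioc (0 : ℝ) 1, ∀ i,
    DEq (∑ a, ∑ b, K.gi t a b • dd a (toD (u.κ t i b)))
      (-(∑ a, (K.A * K.gi t i a) • dd a (toD (u.Φ t)))
        - ∑ a, ∑ b, ∑ c, (K.gi t a b * K.bigKhat c b) • chr K u t a i c
        + ∑ a, ∑ b, ∑ c, (K.gi t a b * K.bigKhat i c) • chr K u t a c b)
  /-- Lapse equation. -/
  lapse : ∀ t ∈ Ioc (0 : ℝ) 1,
    DEq ((2 * K.A * t) • toD (u.Φt t) + ∑ a, ∑ b, (2 * K.bigKhat a b) • toD (u.κ t b a))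
      (t ^ 2 • lap K t (u.n t) + (2 * K.A ^ 2 - 1) • toD (u.n t))
  /-- Lapse equation, second form. -/
  lapse' : ∀ t ∈ Ioc (0 : ℝ) 1,
    DEq (t ^ 2 • lap K t (u.n t) - toD (u.n t)) (t ^ 2 • scal K u t)
  /-- Evolution of `h`. -/
  dt_h : ∀ t ∈ Ioc (0 : ℝ) 1, ∀ i j, HasTimeDeriv (fun s => toD (u.h s i j))
    (-(∑ a, (2 * t⁻¹ * K.bigK a j) • toD (u.h t i a))
      - ∑ a, (2 * t⁻¹ * K.g t i a) • toD (u.κ t a j)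
      - ∑ a, (2 * t⁻¹ * K.g t i a * K.bigK a j) • toD (u.n t)) t
  /-- Evolution of `κ`. -/
  dt_κ : ∀ t ∈ Ioc (0 : ℝ) 1, ∀ i j, HasTimeDeriv (fun s => toD (u.κ s i j))
    (-(∑ a, (t * K.gi t i a) • dd a (dd j (toD (u.n t))))
      - (t⁻¹ * K.bigK i j) • toD (u.n t) + t • ric K u t i j) t
  /-- Wave equation `-∂ₜ(t ∂ₜΦ) + t g^{ab} ∂_a ∂_b Φ = -A ∂ₜ n + A t⁻¹ n`, written as
  `∂ₜ(t ∂ₜΦ - A n) = t g^{ab} ∂_a ∂_b Φ - A t⁻¹ n`. -/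
  wave : ∀ t ∈ Ioc (0 : ℝ) 1,
    HasTimeDeriv (fun s => s • toD (u.Φt s) - K.A • toD (u.n s))
      (t • lap K t (u.Φ t) - (K.A * t⁻¹) • toD (u.n t)) t

/-! ### Norms and energies -/

/-- The multi-index of `∂_e ∂_I`, that is, `I` plus the unit multi-index in the direction `e`. -/
def gradIdx (I : MIdx) (e : Fin 3) : MIdx := I + Pi.single e 1

/-- The Sobolev norm `‖T‖_{H^M_Frame} = ∑_{|I| ≤ M} ‖ |∂_I T|_Frame ‖_{L²}`. -/
def sobNorm {ι : Type} [Fintype ι] (M : ℕ) (T : ι → T3 → ℝ) : ℝ≥0∞ :=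
  ∑ I ∈ multiIdx M, weakInt frameSq (fun _ => I) T ^ (1 / 2 : ℝ)

/-- The Sobolev norm `‖∂T‖_{H^M_Frame}` of the spatial gradient of `T`, which has the components
`∂_e T_c`. -/
def sobNormGrad {ι : Type} [Fintype ι] (M : ℕ) (T : ι → T3 → ℝ) : ℝ≥0∞ :=
  ∑ I ∈ multiIdx M,
    weakInt frameSq (fun c : Fin 3 × ι => gradIdx I c.1) (fun c => T c.2) ^ (1 / 2 : ℝ)

/-- The solution norm `‖κ‖_{H^M} + ‖∂h‖_{H^M} + ‖t ∂ₜΦ‖_{H^M} + t^{2/3} ‖∂Φ‖_{H^M}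
+ ∑_{p ≤ 2} t^{(2/3)p} ‖n‖_{H^{M+p}}`. -/
def highNorm (u : LinVars) (M : ℕ) (t : ℝ) : ℝ≥0∞ :=
  sobNorm M (fun c : Fin 3 × Fin 3 => u.κ t c.1 c.2)
    + sobNormGrad M (fun c : Fin 3 × Fin 3 => u.h t c.1 c.2)
    + sobNorm M (fun _ : Unit => fun x => t * u.Φt t x)
    + ENNReal.ofReal (t ^ (2 / 3 : ℝ)) * sobNormGrad M (fun _ : Unit => u.Φ t)
    + ∑ p ∈ Finset.range 3,
        ENNReal.ofReal (t ^ (2 / 3 * p : ℝ)) * sobNorm (M + p) (fun _ : Unit => u.n t)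

section Energies

variable (K : Kasner) (u : LinVars) (I : MIdx) (t : ℝ)

/-- `∫ |t ∂∂_I h|²_g dx`. -/
def intGradH : ℝ≥0∞ :=
  weakInt (fun S : Fin 3 × Fin 3 × Fin 3 → ℝ => K.normSq03 t fun c => t * S c)
    (fun c => gradIdx I c.1) (fun c => u.h t c.2.1 c.2.2)

/-- `∫ |t ∂∂_I f|²_g dx` for a scalar function `f`. -/
def intGradScalar (f : T3 → ℝ) : ℝ≥0∞ :=
  weakInt (fun ξ : Fin 3 → ℝ => K.normSq01 t fun e => t * ξ e) (gradIdx I) (fun _ => f)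

/-- `∫ (∂_I f)² dx` for a scalar function `f`. -/
def intScalar (f : T3 → ℝ) : ℝ≥0∞ :=
  weakInt (fun v : Unit → ℝ => v () ^ 2) (fun _ => I) (fun _ => f)

/-- The squared metric energy of `(∂_I κ, ∂∂_I h)`: `∫ |∂_I κ|²_g + (1/4) |t ∂∂_I h|²_g dx`. -/
def energyMetricSq : ℝ≥0∞ :=
  weakInt (K.normSq11 t) (fun _ => I) (fun c : Fin 3 × Fin 3 => u.κ t c.1 c.2)
    + ENNReal.ofReal (1 / 4) * intGradH K u I t

/-- The squared scalar field energy of `∂_I Φ`: `∫ (t ∂ₜ∂_I Φ)² + |t ∂∂_I Φ|²_g dx`. -/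
def energyScalarSq : ℝ≥0∞ :=
  intScalar I (fun x => t * u.Φt t x) + intGradScalar K I t (u.Φ t)

/-- The squared total energy with parameter `η` of the `∂_I`-differentiated variables,
`η E²_Metric + E²_Scalar + ∫ |t ∂∂_I n|²_g dx + ∫ (∂_I n)² dx`;
the variables themselves correspond to `I = 0`. -/
def energySq (η : ℝ) : ℝ≥0∞ :=
  ENNReal.ofReal η * energyMetricSq K u I t + energyScalarSq K u I t
    + intGradScalar K I t (u.n t) + intScalar I (u.n t)

/-- The total energy up to order `M`:
`(∑_{|I| ≤ M} energySq of the ∂_I-differentiated variables)^{1/2}`. -/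
def energyUpTo (η : ℝ) (M : ℕ) (t : ℝ) : ℝ≥0∞ :=
  (∑ I ∈ multiIdx M, energySq K u I t η) ^ (1 / 2 : ℝ)

/-- The spacetime integral `∫_t^1 s⁻¹ F(s) ds`. -/
def logInt (F : ℝ → ℝ≥0∞) (t : ℝ) : ℝ≥0∞ :=
  ∫⁻ s in Ioc t 1, ENNReal.ofReal s⁻¹ * F s

end Energies

end LinKasner

end

open MeasureTheory Set
open scoped ENNReal ContDiff

noncomputable section
-- The background depends only on time, so the linear system decouples in Fourier space. Pairing the
-- equations with the real trigonometric functions `cw k z` gives a closed system of ordinary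
-- differential equations for each frequency and phase (`IsSolution.frameMode`). In a time-rescaled
-- orthonormal frame its coefficients involve only the exponents, `K.A` and the rescaled frequency
-- `ξ`, whose components grow like `t ^ (1 - q i)`. This growth is the source of decay towards `t =
-- 0`: differentiating `|ξ|²` in `log t` gives a positive term close to `4/3 |ξ|²`.
--
-- For the metric part, the terms pairing `k` with `|ξ|² H` cancel, and all divergences of `k` are
-- replaced by means of the two momentum constraints. What remains is `1/6 |ξ|² |H|²`, cross terms
-- with `Φ` and `n`, and errors linear in the shear (`halfDtMetric_eq`). The cross terms are not
-- small, but they are bounded by a small part of `|ξ|² |H|²` plus a large multiple of `|ξ|² (Φ² +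
-- n²)`. For the scalar part, the variable that is differentiated is `ψ - A n`, and the lapse
-- equation turns the product of `n` with its equation into `1/2 (|ξ|² + 1) n²` (`halfDtScalar_eq`).
-- The bound `A² ≤ 2/3` makes the remaining `Φ`-`n` cross term absorbable. A large multiple of the
-- scalar energy therefore pays for the metric cross terms; this is `modEnergy`, and
-- `dtModEnergy_ge` is the resulting monotonicity up to errors of size `σ`.
--
-- The lapse has no evolution equation of its own. It is recovered from the elliptic relation `(|ξ|²
-- + 1) n = 2 (q - 1/3)·k - 2 A (ψ - A n)`, which bounds two derivatives of `n` and makes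
-- `modEnergy` comparable to the full energy (`energy_le`, `modEnergy_le_energy`). Integrating the
-- monotonicity gives the first estimate, and Grönwall's inequality gives growth at most `t ^
-- (-cσ)`.
--
-- Parseval's identity (`weakInt_eq`) writes every energy and norm as a sum over modes, so the mode
-- inequalities can simply be added. A derivative `∂_I` only inserts the time-independent weight
-- `symb I k`, hence the constants do not depend on the order. For the Sobolev norms, coordinate and
-- frame components differ by powers of `t`; once the isotropic powers are accounted for, the
-- exponents are combinations of `q i - 1/3` and cost only another factor `t ^ (-cσ)`.
namespace LinKasner

/-! ### Algebra of a single Fourier mode: constraints and derivative identities -/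

section

/-- The values at one time of one real Fourier mode, in components with respect to the rescaled
orthonormal frame: frequency `ξ`, metric `H`, second fundamental form `k`, scalar field `Φ`, its
logarithmic time derivative `ψ` and the lapse `n`. -/
structure FrameVal where
  ξ : Fin 3 → ℝ
  H : Fin 3 → Fin 3 → ℝ
  k : Fin 3 → Fin 3 → ℝ
  Φ : ℝ
  ψ : ℝ
  n : ℝ

namespace FrameVal

variable (v : FrameVal)

/-- `|ξ|²` -/
def X : ℝ := ∑ i, v.ξ i ^ 2
/-- `|H|²` -/
def HH : ℝ := ∑ i, ∑ j, v.H i j ^ 2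
/-- `|k|²` -/
def kk : ℝ := ∑ i, ∑ j, v.k i j ^ 2
/-- `tr H` -/
def trH : ℝ := ∑ i, v.H i i
/-- The vector `H ξ`. -/
def Hξ (i : Fin 3) : ℝ := ∑ j, v.H i j * v.ξ j

/-- The energy of a mode. -/
def energy : ℝ :=
  v.kk + 1 / 4 * (v.X * v.HH) + v.ψ ^ 2 + v.X * v.Φ ^ 2 + v.X * v.n ^ 2 + v.n ^ 2

/-- The quantities controlled by the spacetime integrals. -/
def diss : ℝ := v.X * v.HH + v.X * v.Φ ^ 2 + v.X * v.n ^ 2 + v.n ^ 2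

/-- A quadratic form equivalent to the energy, on which the dissipation is manifest. -/
def modEnergy (A : ℝ) : ℝ :=
  6000 * ((v.ψ - A * v.n) ^ 2 + v.X * v.Φ ^ 2) + (v.kk + 1 / 4 * (v.X * v.HH))

/-- The right-hand side of the evolution equation of `H`. -/
def rhsH (q : Fin 3 → ℝ) (i j : Fin 3) : ℝ :=
  (q j - q i) * v.H i j - 2 * v.k i j + if i = j then 2 * q j * v.n else 0

/-- The right-hand side of the evolution equation of `k`. -/
def rhsk (q : Fin 3 → ℝ) (i j : Fin 3) : ℝ :=
  (q i - q j) * v.k i j + v.ξ i * v.ξ j * v.n + (if i = j then q i * v.n else 0)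
    + 1 / 2 * (v.X * v.H i j - v.ξ j * v.Hξ i - v.ξ i * v.Hξ j + v.ξ i * v.ξ j * v.trH)

/-- The constraint equations for a mode. -/
structure Constraints (K : Kasner) : Prop where
  symm : ∀ i j, v.H i j = v.H j i
  cmc : ∑ i, v.k i i = 0
  mom : ∀ j, ∑ a, v.ξ a * v.k a j = -(K.A * v.ξ j * v.Φ)
    + 1 / 2 * ((K.q j - 1 / 3) * v.ξ j * v.trH) - 1 / 2 * v.ξ j * ∑ a, (K.q a - 1 / 3) * v.H a a
  mom' : ∀ i, ∑ b, v.ξ b * v.k i b = -(K.A * v.ξ i * v.Φ)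
    + ∑ a, (K.q a - 1 / 3) * (1 / 2 * (2 * v.ξ a * v.H i a - v.ξ i * v.H a a))
    - (K.q i - 1 / 3) * (v.Hξ i - 1 / 2 * v.ξ i * v.trH)
  lapse : 2 * K.A * v.ψ - 2 * ∑ a, (K.q a - 1 / 3) * v.k a a = -(v.X + 1 - 2 * K.A ^ 2) * v.n

/-- Half the logarithmic time derivative of `|k|² + |ξ|² |H|² / 4`. -/
def halfDtMetric (q : Fin 3 → ℝ) : ℝ :=
  ∑ i, ∑ j, v.k i j * v.rhsk q i j + 1 / 4 * ((∑ i, (1 - q i) * v.ξ i ^ 2) * v.HH)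
    + 1 / 4 * (v.X * ∑ i, ∑ j, v.H i j * v.rhsH q i j)

/-- Half the logarithmic time derivative of `(ψ - A n)² + |ξ|² Φ²`. -/
def halfDtScalar (q : Fin 3 → ℝ) (A : ℝ) : ℝ :=
  (v.ψ - A * v.n) * (-(v.X * v.Φ) - A * v.n) + (∑ i, (1 - q i) * v.ξ i ^ 2) * v.Φ ^ 2
    + v.X * v.Φ * v.ψ

end FrameVal

/-- Because the exponents sum to one, `K.sigma` is the Euclidean length of the shear vector `q -
1/3`. Every error term below is linear in this vector, which is how `σ` enters the estimates. -/
theorem Kasner.sq_sum_shear (K : Kasner) : ∑ i, (K.q i - 1 / 3) ^ 2 = ∑ i, K.q i ^ 2 - 1 / 3 := by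
  have := K.sum_q
  simp only [Fin.sum_univ_three] at *
  linear_combination (-2 / 3) * this

theorem Kasner.abs_shear_le (K : Kasner) (i : Fin 3) : |K.q i - 1 / 3| ≤ K.sigma := by
  rw [Kasner.sigma, ← K.sq_sum_shear]
  apply Real.abs_le_sqrt
  exact Finset.single_le_sum (f := fun i => (K.q i - 1 / 3) ^ 2) (fun _ _ => sq_nonneg _)
    (Finset.mem_univ i)

theorem Kasner.sigma_nonneg (K : Kasner) : 0 ≤ K.sigma := Real.sqrt_nonneg _

/-- The squared length of the shear is nonnegative and equals `2/3 - A²`. The value `2/3` is what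
makes the `Φ`-`n` cross term in `halfDtScalar_ge` absorbable. -/
theorem Kasner.A_sq_le (K : Kasner) : K.A ^ 2 ≤ 2 / 3 := by
  have h1 : 0 ≤ ∑ i, (K.q i - 1 / 3) ^ 2 := Finset.sum_nonneg fun _ _ => sq_nonneg _
  have := K.sq_sum_shear
  have := K.sum_q_sq
  linarith

theorem Kasner.A_le_one (K : Kasner) : K.A ≤ 1 := by
  nlinarith [K.A_sq_le, K.A_nonneg]

theorem Kasner.q_le_one (K : Kasner) (i : Fin 3) : K.q i ≤ 1 := by
  rw [← K.sum_q]
  exact Finset.single_le_sum (f := K.q) (fun i _ => (K.q_pos i).le) (Finset.mem_univ i)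

namespace FrameVal

variable {v : FrameVal} {K : Kasner}

theorem X_nonneg (v : FrameVal) : 0 ≤ v.X := Finset.sum_nonneg fun _ _ => sq_nonneg _
theorem HH_nonneg (v : FrameVal) : 0 ≤ v.HH :=
  Finset.sum_nonneg fun _ _ => Finset.sum_nonneg fun _ _ => sq_nonneg _
theorem kk_nonneg (v : FrameVal) : 0 ≤ v.kk :=
  Finset.sum_nonneg fun _ _ => Finset.sum_nonneg fun _ _ => sq_nonneg _

theorem abs_ξ_le (v : FrameVal) (i : Fin 3) : |v.ξ i| ≤ √v.X :=
  Real.abs_le_sqrt <| Finset.single_le_sum (f := fun i => v.ξ i ^ 2) (fun _ _ => sq_nonneg _)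
    (Finset.mem_univ i)

theorem sq_le_sum_sum (M : Fin 3 → Fin 3 → ℝ) (i j : Fin 3) :
    M i j ^ 2 ≤ ∑ i, ∑ j, M i j ^ 2 :=
  (Finset.single_le_sum (f := fun j => M i j ^ 2) (fun _ _ => sq_nonneg _)
    (Finset.mem_univ j)).trans
  (Finset.single_le_sum (f := fun i => ∑ j, M i j ^ 2)
    (fun _ _ => Finset.sum_nonneg fun _ _ => sq_nonneg _) (Finset.mem_univ i))

theorem abs_H_le (v : FrameVal) (i j : Fin 3) : |v.H i j| ≤ √v.HH :=
  Real.abs_le_sqrt (sq_le_sum_sum v.H i j)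

theorem abs_k_le (v : FrameVal) (i j : Fin 3) : |v.k i j| ≤ √v.kk :=
  Real.abs_le_sqrt (sq_le_sum_sum v.k i j)

/-- The shear part of the momentum constraint. -/
def bvec (v : FrameVal) (s : Fin 3 → ℝ) (j : Fin 3) : ℝ :=
  1 / 2 * (s j * v.ξ j * v.trH) - 1 / 2 * v.ξ j * ∑ a, s a * v.H a a

/-- The shear part of the second form of the momentum constraint. -/
def avec (v : FrameVal) (s : Fin 3 → ℝ) (i : Fin 3) : ℝ :=
  ∑ a, s a * (1 / 2 * (2 * v.ξ a * v.H i a - v.ξ i * v.H a a))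
    - s i * (v.Hξ i - 1 / 2 * v.ξ i * v.trH)

theorem abs_sum_fin_three_le {f : Fin 3 → ℝ} {c : ℝ} (h : ∀ i, |f i| ≤ c) : |∑ i, f i| ≤ 3 * c := by
  refine (Finset.abs_sum_le_sum_abs _ _).trans ((Finset.sum_le_sum fun i _ => h i).trans ?_)
  simp

theorem abs_mul_le_mul {a b c d : ℝ} (h1 : |a| ≤ c) (h2 : |b| ≤ d) : |a * b| ≤ c * d := by
  rw [abs_mul]
  exact mul_le_mul h1 h2 (abs_nonneg _) ((abs_nonneg _).trans h1)

theorem abs_trH_le (v : FrameVal) : |v.trH| ≤ 3 * √v.HH := abs_sum_fin_three_le fun i => v.abs_H_le i i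

theorem abs_Hξ_le (v : FrameVal) (i : Fin 3) : |v.Hξ i| ≤ 3 * (√v.HH * √v.X) :=
  abs_sum_fin_three_le fun j => abs_mul_le_mul (v.abs_H_le i j) (v.abs_ξ_le j)

theorem abs_bvec_le (v : FrameVal) {s : Fin 3 → ℝ} {σ : ℝ} (hs : ∀ i, |s i| ≤ σ) (j : Fin 3) :
    |v.bvec s j| ≤ 3 * (σ * √v.X * √v.HH) := by
  have h1 : |s j * v.ξ j * v.trH| ≤ σ * √v.X * (3 * √v.HH) :=
    abs_mul_le_mul (abs_mul_le_mul (hs j) (v.abs_ξ_le j)) v.abs_trH_le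
  have h2 : |v.ξ j * ∑ a, s a * v.H a a| ≤ √v.X * (3 * (σ * √v.HH)) :=
    abs_mul_le_mul (v.abs_ξ_le j)
      (abs_sum_fin_three_le fun a => abs_mul_le_mul (hs a) (v.abs_H_le a a))
  rw [bvec]
  rw [abs_le] at *
  constructor <;> linarith

theorem abs_avec_le (v : FrameVal) {s : Fin 3 → ℝ} {σ : ℝ} (hs : ∀ i, |s i| ≤ σ) (i : Fin 3) :
    |v.avec s i| ≤ 10 * (σ * √v.X * √v.HH) := by
  have h1 : |∑ a, s a * (1 / 2 * (2 * v.ξ a * v.H i a - v.ξ i * v.H a a))|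
      ≤ 3 * (σ * (3 / 2 * (√v.X * √v.HH))) := by
    refine abs_sum_fin_three_le fun a => abs_mul_le_mul (hs a) ?_
    have h1 := abs_mul_le_mul (v.abs_ξ_le a) (v.abs_H_le i a)
    have h2 := abs_mul_le_mul (v.abs_ξ_le i) (v.abs_H_le a a)
    rw [abs_le] at *
    constructor <;> linarith
  have h2 : |s i * (v.Hξ i - 1 / 2 * v.ξ i * v.trH)| ≤ σ * (9 / 2 * (√v.X * √v.HH)) := by
    refine abs_mul_le_mul (hs i) ?_
    have h1 := v.abs_Hξ_le i
    have h2 := abs_mul_le_mul (v.abs_ξ_le i) v.abs_trH_le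
    rw [abs_le] at *
    constructor <;> linarith
  have h0 : 0 ≤ σ * √v.X * √v.HH :=
    mul_nonneg (mul_nonneg ((abs_nonneg _).trans (hs 0)) (Real.sqrt_nonneg _)) (Real.sqrt_nonneg _)
  rw [avec]
  rw [abs_le] at *
  constructor <;> linarith

/-- The products of `k` with `|ξ|² H` coming from the two evolution equations cancel, and each
remaining contraction of `k` with `ξ` is a divergence given by a momentum constraint. The leading
coefficient is `1/6 = 1/4 · 2/3`, with `2/3` the isotropic value of `1 - q i`. The second group
contains the cross terms with `Φ` and `n`; every term of the last group is linear in the shear. -/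
theorem halfDtMetric_eq (hc : v.Constraints K) :
    v.halfDtMetric K.q = 1 / 6 * (v.X * v.HH)
      + (K.A * v.Φ * ∑ i, v.ξ i * v.Hξ i - 1 / 2 * (K.A * v.Φ * v.X * v.trH)
        - K.A * v.X * v.Φ * v.n + 1 / 2 * (v.X * v.n * ∑ i, K.q i * v.H i i))
      + (∑ i, ∑ j, (K.q i - K.q j) * v.k i j ^ 2 + v.n * ∑ i, (K.q i - 1 / 3) * v.k i i
        + v.n * ∑ i, v.ξ i * v.bvec (fun i => K.q i - 1 / 3) i
        - 1 / 2 * ∑ i, v.avec (fun i => K.q i - 1 / 3) i * v.Hξ i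
        - 1 / 2 * ∑ i, v.bvec (fun i => K.q i - 1 / 3) i * v.Hξ i
        + 1 / 2 * ((∑ i, v.ξ i * v.bvec (fun i => K.q i - 1 / 3) i) * v.trH)
        - 1 / 4 * ((∑ i, (K.q i - 1 / 3) * v.ξ i ^ 2) * v.HH)) := by
  have hm : ∀ j, ∑ a, v.ξ a * v.k a j
      = -(K.A * v.ξ j * v.Φ) + v.bvec (fun i => K.q i - 1 / 3) j := by
    intro j; rw [hc.mom j, bvec]; ring
  have hm' : ∀ i, ∑ b, v.ξ b * v.k i b
      = -(K.A * v.ξ i * v.Φ) + v.avec (fun i => K.q i - 1 / 3) i := by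
    intro j; rw [hc.mom' j, avec]; ring
  have hcm := hc.cmc
  have h01 := hc.symm 0 1
  have h02 := hc.symm 0 2
  have h12 := hc.symm 1 2
  generalize v.bvec (fun i => K.q i - 1 / 3) = b at *
  generalize v.avec (fun i => K.q i - 1 / 3) = a at *
  have m0 := hm 0
  have m1 := hm 1
  have m2 := hm 2
  have m0' := hm' 0
  have m1' := hm' 1
  have m2' := hm' 2
  clear hm hm'
  -- This identity uses only the symmetry of `H` and `tr k = 0`, the latter to replace `q i` by `q i
  -- - 1/3` in front of `k i i`. The divergences of `k` are kept whole so that the momentum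
  -- constraints can be substituted afterwards.
  have e1 : v.halfDtMetric K.q = 1 / 6 * (v.X * v.HH)
      + 1 / 2 * (v.X * v.n * ∑ i, K.q i * v.H i i)
      + (∑ i, ∑ j, (K.q i - K.q j) * v.k i j ^ 2 + v.n * ∑ i, (K.q i - 1 / 3) * v.k i i
        + v.n * ∑ i, (∑ a, v.ξ a * v.k a i) * v.ξ i
        - 1 / 2 * ∑ i, (∑ b, v.ξ b * v.k i b) * v.Hξ i
        - 1 / 2 * ∑ i, (∑ a, v.ξ a * v.k a i) * v.Hξ i
        + 1 / 2 * ((∑ i, (∑ a, v.ξ a * v.k a i) * v.ξ i) * v.trH)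
        - 1 / 4 * ((∑ i, (K.q i - 1 / 3) * v.ξ i ^ 2) * v.HH)) := by
    simp only [halfDtMetric, rhsk, rhsH]
    generalize v.trH = tr
    generalize v.Hξ = hx
    simp only [Fin.sum_univ_three, X, HH, Fin.reduceEq, if_false, if_true,
      Fin.isValue] at hcm ⊢
    rw [h01, h02, h12]
    linear_combination 1 / 3 * v.n * hcm
  rw [e1]
  simp only [Fin.sum_univ_three, X] at *
  rw [m0, m1, m2, m0', m1', m2']
  ring

/-- The product `-A n ψ` is eliminated with `n / 2` times the lapse equation. This creates the
positive terms in `n`, and the contributions `A² n²` cancel, so their coefficient `1/2` does not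
depend on `A`. -/
theorem halfDtScalar_eq (hc : v.Constraints K) :
    v.halfDtScalar K.q K.A = 2 / 3 * (v.X * v.Φ ^ 2) + K.A * v.X * v.Φ * v.n
      + 1 / 2 * (v.X * v.n ^ 2) + 1 / 2 * v.n ^ 2
      - (v.n * ∑ a, (K.q a - 1 / 3) * v.k a a + (∑ i, (K.q i - 1 / 3) * v.ξ i ^ 2) * v.Φ ^ 2) := by
  have h := hc.lapse
  simp only [halfDtScalar]
  have e : ∑ i, (1 - K.q i) * v.ξ i ^ 2 = 2 / 3 * v.X - ∑ i, (K.q i - 1 / 3) * v.ξ i ^ 2 := by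
    simp only [X, Fin.sum_univ_three]; ring
  rw [e]
  linear_combination (-1 / 2 * v.n) * h

end FrameVal

end

/-! ### Coercivity and comparison of energies for a single mode -/

section

namespace FrameVal

variable {v : FrameVal} {K : Kasner}

/-- Half of the good term `1/6 |ξ|² |H|²` is spent on the cross terms with `Φ` and `n`. The large
price `740` is harmless, since the scalar energy can be given as much weight as needed. -/
theorem halfDtMetric_ge (hc : v.Constraints K) :
    1 / 12 * (v.X * v.HH) - 740 * (v.X * v.Φ ^ 2 + v.X * v.n ^ 2) - 320 * K.sigma * v.energy
      ≤ v.halfDtMetric K.q := by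
  rw [halfDtMetric_eq hc, energy]
  have hs := K.abs_shear_le
  have hσ := K.sigma_nonneg
  set s : Fin 3 → ℝ := fun i => K.q i - 1 / 3
  have hs' : ∀ i, |s i| ≤ K.sigma := hs
  have hA : |K.A| ≤ 1 := by rw [abs_of_nonneg K.A_nonneg]; exact K.A_le_one
  have hq : ∀ i, |K.q i| ≤ 1 := fun i => by rw [abs_of_pos (K.q_pos i)]; exact K.q_le_one i
  have hxx : √v.X ^ 2 = v.X := Real.sq_sqrt v.X_nonneg
  have hyy : √v.HH ^ 2 = v.HH := Real.sq_sqrt v.HH_nonneg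
  have hww : √v.kk ^ 2 = v.kk := Real.sq_sqrt v.kk_nonneg
  have hxX : |v.X| ≤ √v.X ^ 2 := by rw [hxx, abs_of_nonneg v.X_nonneg]
  have hyY : |v.HH| ≤ √v.HH ^ 2 := by rw [hyy, abs_of_nonneg v.HH_nonneg]
  have hΦ : |v.Φ| ≤ |v.Φ| := le_rfl
  have hn : |v.n| ≤ |v.n| := le_rfl
  have b1 := abs_mul_le_mul (abs_mul_le_mul hA hΦ)
    (abs_sum_fin_three_le fun i => abs_mul_le_mul (v.abs_ξ_le i) (v.abs_Hξ_le i))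
  have b2 := abs_mul_le_mul (abs_mul_le_mul (abs_mul_le_mul hA hΦ) hxX) v.abs_trH_le
  have b3 := abs_mul_le_mul (abs_mul_le_mul (abs_mul_le_mul hA hxX) hΦ) hn
  have b4 := abs_mul_le_mul (abs_mul_le_mul hxX hn)
    (abs_sum_fin_three_le fun i => abs_mul_le_mul (hq i) (v.abs_H_le i i))
  have b5 : |∑ i, ∑ j, (K.q i - K.q j) * v.k i j ^ 2| ≤ 3 * (3 * (2 * K.sigma * √v.kk ^ 2)) := by
    refine abs_sum_fin_three_le fun i => abs_sum_fin_three_le fun j => abs_mul_le_mul ?_ ?_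
    · have h1 := hs i
      have h2 := hs j
      rw [abs_le] at *
      constructor <;> linarith
    · rw [abs_pow]
      exact pow_le_pow_left₀ (abs_nonneg _) (v.abs_k_le i j) 2
  have b6 := abs_mul_le_mul hn (abs_sum_fin_three_le fun i => abs_mul_le_mul (hs i) (v.abs_k_le i i))
  have b7' := abs_sum_fin_three_le fun i => abs_mul_le_mul (v.abs_ξ_le i) (v.abs_bvec_le hs' i)
  have b7 := abs_mul_le_mul hn b7'
  have b8 := abs_sum_fin_three_le fun i => abs_mul_le_mul (v.abs_avec_le hs' i) (v.abs_Hξ_le i)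
  have b9 := abs_sum_fin_three_le fun i => abs_mul_le_mul (v.abs_bvec_le hs' i) (v.abs_Hξ_le i)
  have b10 := abs_mul_le_mul b7' v.abs_trH_le
  have b11 : |(∑ i, (K.q i - 1 / 3) * v.ξ i ^ 2) * v.HH| ≤ 3 * (K.sigma * √v.X ^ 2) * √v.HH ^ 2 := by
    refine abs_mul_le_mul (abs_sum_fin_three_le fun i => abs_mul_le_mul (hs i) ?_) hyY
    rw [abs_pow]
    exact pow_le_pow_left₀ (abs_nonneg _) (v.abs_ξ_le i) 2
  have hx0 := Real.sqrt_nonneg v.X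
  have hy0 := Real.sqrt_nonneg v.HH
  have hw0 := Real.sqrt_nonneg v.kk
  have hΦ2 : v.Φ ^ 2 = |v.Φ| ^ 2 := (sq_abs _).symm
  have hn2 : v.n ^ 2 = |v.n| ^ 2 := (sq_abs _).symm
  rw [hΦ2, hn2]
  replace b1 := (abs_le.1 b1).1
  replace b2 := (abs_le.1 b2).2
  replace b3 := (abs_le.1 b3).2
  replace b4 := (abs_le.1 b4).1
  replace b5 := (abs_le.1 b5).1
  replace b6 := (abs_le.1 b6).1
  replace b7 := (abs_le.1 b7).1
  replace b8 := (abs_le.1 b8).2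
  replace b9 := (abs_le.1 b9).2
  replace b10 := (abs_le.1 b10).1
  replace b11 := (abs_le.1 b11).2
  generalize √v.X = x at *
  generalize √v.HH = y at *
  generalize √v.kk = w at *
  rw [← hxx] at b2 b3 b4 ⊢
  rw [← hyy] at b11 ⊢
  rw [← hww]
  -- The `Φ`-`H` cross terms add up to at most `21/2 (xy)(x|Φ|)` and the `n`-`H` term to at most
  -- `3/2 (xy)(x|n|)`. With `126` and `18` the two completed squares, each taken with factor `1/24`,
  -- cost `(xy)²/12` together.
  have e1 := sq_nonneg (x * y - 126 * (x * |v.Φ|))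
  have e2 := sq_nonneg (x * y - 18 * (x * |v.n|))
  have e3 := sq_nonneg (x * |v.Φ| - x * |v.n|)
  have e4 := mul_nonneg hσ (sq_nonneg (|v.n| - w))
  have e5 := mul_nonneg hσ (sq_nonneg (x * |v.n| - x * y))
  have f1 := mul_nonneg hσ (sq_nonneg (x * y))
  have f2 := mul_nonneg hσ (sq_nonneg (x * |v.n|))
  have f3 := mul_nonneg hσ (sq_nonneg (x * |v.Φ|))
  have f4 := mul_nonneg hσ (sq_nonneg w)
  have f5 := mul_nonneg hσ (sq_nonneg |v.n|)
  have f6 := mul_nonneg hσ (sq_nonneg v.ψ)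
  have g1 := sq_nonneg (x * |v.n|)
  have g2 := sq_nonneg (x * |v.Φ|)
  have g3 := sq_nonneg (x * y)
  linarith

theorem halfDtScalar_ge (hc : v.Constraints K) :
    1 / 6 * (v.X * v.Φ ^ 2 + v.X * v.n ^ 2) + 1 / 2 * v.n ^ 2 - 3 * K.sigma * v.energy
      ≤ v.halfDtScalar K.q K.A := by
  rw [halfDtScalar_eq hc, energy]
  have hs := K.abs_shear_le
  have hσ := K.sigma_nonneg
  have hww : √v.kk ^ 2 = v.kk := Real.sq_sqrt v.kk_nonneg
  have b1 := (abs_le.1 (abs_mul_le_mul (le_refl |v.n|)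
    (abs_sum_fin_three_le fun i => abs_mul_le_mul (hs i) (v.abs_k_le i i)))).2
  have b2 : ∑ i, (K.q i - 1 / 3) * v.ξ i ^ 2 ≤ K.sigma * v.X := by
    rw [X, Finset.mul_sum]
    exact Finset.sum_le_sum fun i _ =>
      mul_le_mul_of_nonneg_right ((le_abs_self _).trans (hs i)) (sq_nonneg _)
  have b2' := mul_le_mul_of_nonneg_right b2 (sq_nonneg v.Φ)
  -- Young's inequality is balanced using `A² ≤ 2/3`: of the coefficients `2/3` and `1/2` of `XΦ²`
  -- and `Xn²` there remain `2/3 - 1/2` and `1/2 - 1/3`, both equal to `1/6`.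
  have b3 : K.A * v.X * |v.Φ| * |v.n| ≤ v.X * (1 / 2 * v.Φ ^ 2 + 1 / 3 * v.n ^ 2) := by
    have : K.A * |v.Φ| * |v.n| ≤ 1 / 2 * v.Φ ^ 2 + 1 / 3 * v.n ^ 2 := by
      rw [← sq_abs v.Φ, ← sq_abs v.n]
      have h1 := sq_nonneg (K.A * |v.n| - |v.Φ|)
      have h2 := mul_le_mul_of_nonneg_right K.A_sq_le (sq_nonneg |v.n|)
      nlinarith
    calc K.A * v.X * |v.Φ| * |v.n| = v.X * (K.A * |v.Φ| * |v.n|) := by ring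
      _ ≤ _ := mul_le_mul_of_nonneg_left this v.X_nonneg
  have b4 : -(K.A * v.X * |v.Φ| * |v.n|) ≤ K.A * v.X * v.Φ * v.n := by
    have h := neg_abs_le (K.A * v.X * v.Φ * v.n)
    rwa [abs_mul, abs_mul, abs_mul, abs_of_nonneg K.A_nonneg, abs_of_nonneg v.X_nonneg] at h
  have e4 := mul_nonneg hσ (sq_nonneg (|v.n| - √v.kk))
  have f1 := mul_nonneg hσ (mul_nonneg v.X_nonneg v.HH_nonneg)
  have f2 := mul_nonneg hσ (mul_nonneg v.X_nonneg (sq_nonneg v.n))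
  have f3 := mul_nonneg hσ (mul_nonneg v.X_nonneg (sq_nonneg v.Φ))
  have f4 := mul_nonneg hσ (sq_nonneg √v.kk)
  have f5 := mul_nonneg hσ (sq_nonneg |v.n|)
  have f6 := mul_nonneg hσ (sq_nonneg v.ψ)
  rw [← hww]
  rw [← sq_abs v.n] at b3 f2 ⊢
  linarith

/-- In terms of `ψ - A n` instead of `ψ`, the zeroth-order coefficient `1 - 2A²`, which may be
negative, becomes `1`. The factor `X + 1` is thus always positive and `n` is determined by
quantities that have evolution equations. -/
theorem lapse_P (hc : v.Constraints K) :
    (v.X + 1) * v.n = 2 * ∑ a, (K.q a - 1 / 3) * v.k a a - 2 * K.A * (v.ψ - K.A * v.n) := by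
  linear_combination hc.lapse

theorem lapse_sq_le (hc : v.Constraints K) (hσ1 : K.sigma ≤ 1) :
    ((v.X + 1) * v.n) ^ 2 ≤ 72 * v.modEnergy K.A := by
  have hs : ∀ i, |K.q i - 1 / 3| ≤ 1 := fun i => (K.abs_shear_le i).trans hσ1
  have b := abs_sum_fin_three_le fun i => abs_mul_le_mul (hs i) (v.abs_k_le i i)
  have hww : √v.kk ^ 2 = v.kk := Real.sq_sqrt v.kk_nonneg
  have b' : (∑ a, (K.q a - 1 / 3) * v.k a a) ^ 2 ≤ 9 * v.kk := by
    rw [← hww, ← sq_abs]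
    nlinarith [abs_nonneg (∑ a, (K.q a - 1 / 3) * v.k a a), Real.sqrt_nonneg v.kk]
  rw [lapse_P hc, modEnergy]
  have h1 := sq_nonneg (2 * ∑ a, (K.q a - 1 / 3) * v.k a a + 2 * K.A * (v.ψ - K.A * v.n))
  have h2 := mul_le_mul_of_nonneg_right K.A_sq_le (sq_nonneg (v.ψ - K.A * v.n))
  have h3 := mul_nonneg v.X_nonneg v.HH_nonneg
  have h4 := mul_nonneg v.X_nonneg (sq_nonneg v.Φ)
  have h5 := sq_nonneg (v.ψ - K.A * v.n)
  linarith

/-- The modified energy sees the lapse only through `ψ - A n`. The elliptic bound `lapse_sq_le`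
recovers `n²` and `X n²`, and then `ψ` is obtained by adding `A n` back. -/
theorem energy_le (hc : v.Constraints K) (hσ1 : K.sigma ≤ 1) :
    v.energy ≤ 300 * v.modEnergy K.A := by
  have h1 := lapse_sq_le hc hσ1
  have hX := v.X_nonneg
  have h2 : v.X * v.n ^ 2 + v.n ^ 2 ≤ ((v.X + 1) * v.n) ^ 2 := by
    have : 0 ≤ v.X * (v.X + 1) * v.n ^ 2 := by positivity
    nlinarith
  have h3 : v.ψ ^ 2 ≤ 2 * (v.ψ - K.A * v.n) ^ 2 + 2 * v.n ^ 2 := by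
    have h1 := sq_nonneg (v.ψ - K.A * v.n - K.A * v.n)
    have h2 := mul_le_mul_of_nonneg_right K.A_sq_le (sq_nonneg v.n)
    have h3 := sq_nonneg v.n
    nlinarith
  have h4 := mul_nonneg v.X_nonneg (sq_nonneg v.Φ)
  have h5 := mul_nonneg v.X_nonneg v.HH_nonneg
  have h6 := mul_nonneg v.X_nonneg (sq_nonneg v.n)
  have h7 := v.kk_nonneg
  have h8 := sq_nonneg (v.ψ - K.A * v.n)
  rw [modEnergy, energy] at *
  linarith

/-- The right side has no term `X n²`, so for initial data no derivative of the lapse beyond the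
given order is needed. -/
theorem modEnergy_le (v : FrameVal) (K : Kasner) :
    v.modEnergy K.A ≤ 12000 * (v.kk + 1 / 4 * (v.X * v.HH) + v.ψ ^ 2 + v.X * v.Φ ^ 2 + v.n ^ 2) := by
  rw [modEnergy]
  have h1 := sq_nonneg (v.ψ + K.A * v.n)
  have h2 := mul_le_mul_of_nonneg_right K.A_sq_le (sq_nonneg v.n)
  have h4 := mul_nonneg v.X_nonneg (sq_nonneg v.Φ)
  have h5 := mul_nonneg v.X_nonneg v.HH_nonneg
  have h7 := v.kk_nonneg
  have h8 := sq_nonneg v.n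
  linarith

theorem energy_nonneg (v : FrameVal) : 0 ≤ v.energy := by
  have := v.X_nonneg
  have := v.HH_nonneg
  have := v.kk_nonneg
  rw [energy]
  positivity

theorem modEnergy_nonneg (v : FrameVal) (A : ℝ) : 0 ≤ v.modEnergy A := by
  have := v.X_nonneg
  have := v.HH_nonneg
  have := v.kk_nonneg
  rw [modEnergy]
  positivity

theorem modEnergy_le_energy (v : FrameVal) (K : Kasner) :
    v.modEnergy K.A ≤ 12000 * v.energy := by
  refine (v.modEnergy_le K).trans ?_
  have := mul_nonneg v.X_nonneg (sq_nonneg v.n)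
  rw [energy]
  linarith

/-- This inequality dictates the weight `6000`: the scalar gain `2 · 6000 / 6 = 2000` covers the
metric loss `2 · 740` and still leaves the dissipation. The shear errors add up to `(36000 + 640)
σ`. -/
theorem dtModEnergy_ge (hc : v.Constraints K) :
    1 / 6 * v.diss - 40000 * K.sigma * v.energy
      ≤ 6000 * (2 * v.halfDtScalar K.q K.A) + 2 * v.halfDtMetric K.q := by
  have h1 := halfDtScalar_ge hc
  have h2 := halfDtMetric_ge hc
  have h3 := mul_nonneg K.sigma_nonneg v.energy_nonneg
  have h4 := mul_nonneg v.X_nonneg (sq_nonneg v.Φ)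
  have h6 := mul_nonneg v.X_nonneg (sq_nonneg v.n)
  have h7 := sq_nonneg v.n
  rw [diss]
  linarith

end FrameVal

/-! ### Time evolution of a single mode: integrated monotonicity and Grönwall -/

/-- The evolution and constraint equations for one real Fourier mode in frame components. -/
structure FrameMode (K : Kasner) (v : ℝ → FrameVal) : Prop where
  constr : ∀ t ∈ Ioc (0 : ℝ) 1, (v t).Constraints K
  dt_ξ : ∀ t ∈ Ioc (0 : ℝ) 1, ∀ i, HasDerivWithinAt (fun s => (v s).ξ i)
    (t⁻¹ * ((1 - K.q i) * (v t).ξ i)) (Ioc 0 1) t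
  dt_H : ∀ t ∈ Ioc (0 : ℝ) 1, ∀ i j, HasDerivWithinAt (fun s => (v s).H i j)
    (t⁻¹ * (v t).rhsH K.q i j) (Ioc 0 1) t
  dt_k : ∀ t ∈ Ioc (0 : ℝ) 1, ∀ i j, HasDerivWithinAt (fun s => (v s).k i j)
    (t⁻¹ * (v t).rhsk K.q i j) (Ioc 0 1) t
  dt_Φ : ∀ t ∈ Ioc (0 : ℝ) 1, HasDerivWithinAt (fun s => (v s).Φ) (t⁻¹ * (v t).ψ) (Ioc 0 1) t
  dt_P : ∀ t ∈ Ioc (0 : ℝ) 1, HasDerivWithinAt (fun s => (v s).ψ - K.A * (v s).n)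
    (t⁻¹ * (-((v t).X * (v t).Φ) - K.A * (v t).n)) (Ioc 0 1) t

namespace FrameMode

variable {K : Kasner} {v : ℝ → FrameVal}

theorem hasDeriv_modEnergy (hv : FrameMode K v) {t : ℝ} (ht : t ∈ Ioc (0 : ℝ) 1) :
    HasDerivWithinAt (fun s => (v s).modEnergy K.A)
      (t⁻¹ * (6000 * (2 * (v t).halfDtScalar K.q K.A) + 2 * (v t).halfDtMetric K.q))
      (Ioc 0 1) t := by
  have hX : HasDerivWithinAt (fun s => (v s).X) (t⁻¹ * (2 * ∑ i, (1 - K.q i) * (v t).ξ i ^ 2))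
      (Ioc 0 1) t := by
    refine (HasDerivWithinAt.fun_sum fun i _ => (hv.dt_ξ t ht i).pow 2).congr_deriv ?_
    simp only [Finset.mul_sum]
    exact Finset.sum_congr rfl fun i _ => by push_cast; ring
  have hH : HasDerivWithinAt (fun s => (v s).HH)
      (t⁻¹ * (2 * ∑ i, ∑ j, (v t).H i j * (v t).rhsH K.q i j)) (Ioc 0 1) t := by
    refine (HasDerivWithinAt.fun_sum fun i _ => HasDerivWithinAt.fun_sum fun j _ =>
      (hv.dt_H t ht i j).pow 2).congr_deriv ?_
    simp only [Finset.mul_sum]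
    exact Finset.sum_congr rfl fun i _ => Finset.sum_congr rfl fun j _ => by push_cast; ring
  have hk : HasDerivWithinAt (fun s => (v s).kk)
      (t⁻¹ * (2 * ∑ i, ∑ j, (v t).k i j * (v t).rhsk K.q i j)) (Ioc 0 1) t := by
    refine (HasDerivWithinAt.fun_sum fun i _ => HasDerivWithinAt.fun_sum fun j _ =>
      (hv.dt_k t ht i j).pow 2).congr_deriv ?_
    simp only [Finset.mul_sum]
    exact Finset.sum_congr rfl fun i _ => Finset.sum_congr rfl fun j _ => by push_cast; ring
  refine (((((hv.dt_P t ht).pow 2).add (hX.mul ((hv.dt_Φ t ht).pow 2))).const_mul 6000).add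
    (hk.add ((hX.mul hH).const_mul (1 / 4)))).congr_deriv ?_
  simp only [FrameVal.halfDtScalar, FrameVal.halfDtMetric, Pi.pow_apply]
  push_cast
  ring

/-- The system gives no time derivative of `n`. Its continuity comes from solving the lapse
equation, whose coefficient `X + 1` never vanishes, for `n` in terms of the differentiable
quantities `ξ`, `k` and `ψ - A n`. -/
theorem continuousOn_n (hv : FrameMode K v) : ContinuousOn (fun s => (v s).n) (Ioc 0 1) := by
  have hX : ContinuousOn (fun s => (v s).X) (Ioc 0 1) :=
    continuousOn_finsetSum _ fun i _ => ContinuousOn.pow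
      (fun t ht => (hv.dt_ξ t ht i).continuousWithinAt) 2
  have hk : ContinuousOn (fun s => ∑ a, (K.q a - 1 / 3) * (v s).k a a) (Ioc 0 1) :=
    continuousOn_finsetSum _ fun i _ => continuousOn_const.mul
      fun t ht => (hv.dt_k t ht i i).continuousWithinAt
  have hP : ContinuousOn (fun s => (v s).ψ - K.A * (v s).n) (Ioc 0 1) :=
    fun t ht => (hv.dt_P t ht).continuousWithinAt
  have h1 : ∀ s, (v s).X + 1 ≠ 0 := fun s => by have := (v s).X_nonneg; positivity
  refine ContinuousOn.congr ((((continuousOn_const (c := (2 : ℝ))).mul hk).sub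
    ((continuousOn_const (c := 2 * K.A)).mul hP)).div (hX.add continuousOn_const) fun s _ => h1 s) ?_
  intro s hs
  have := FrameVal.lapse_P (hv.constr s hs)
  simp only [Pi.div_apply, Pi.sub_apply, Pi.mul_apply, Pi.add_apply]
  rw [eq_div_iff (h1 s), ← this]
  ring

theorem continuousOn_parts (hv : FrameMode K v) :
    ContinuousOn (fun s => (v s).X) (Ioc 0 1) ∧ ContinuousOn (fun s => (v s).HH) (Ioc 0 1) ∧
    ContinuousOn (fun s => (v s).kk) (Ioc 0 1) ∧ ContinuousOn (fun s => (v s).Φ) (Ioc 0 1) ∧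
    ContinuousOn (fun s => (v s).ψ) (Ioc 0 1) := by
  refine ⟨?_, ?_, ?_, ?_, ?_⟩
  · exact continuousOn_finsetSum _ fun i _ => ContinuousOn.pow
      (fun t ht => (hv.dt_ξ t ht i).continuousWithinAt) 2
  · exact continuousOn_finsetSum _ fun i _ => continuousOn_finsetSum _ fun j _ => ContinuousOn.pow
      (fun t ht => (hv.dt_H t ht i j).continuousWithinAt) 2
  · exact continuousOn_finsetSum _ fun i _ => continuousOn_finsetSum _ fun j _ => ContinuousOn.pow
      (fun t ht => (hv.dt_k t ht i j).continuousWithinAt) 2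
  · exact fun t ht => (hv.dt_Φ t ht).continuousWithinAt
  · have hP : ContinuousOn (fun s => (v s).ψ - K.A * (v s).n) (Ioc 0 1) :=
      fun t ht => (hv.dt_P t ht).continuousWithinAt
    refine (hP.add ((continuousOn_const (c := K.A)).mul hv.continuousOn_n)).congr fun s _ => ?_
    simp

theorem continuousOn_energy (hv : FrameMode K v) :
    ContinuousOn (fun s => (v s).energy) (Ioc 0 1) := by
  obtain ⟨hX, hH, hk, hΦ, hψ⟩ := hv.continuousOn_parts
  have hn := hv.continuousOn_n
  unfold FrameVal.energy
  fun_prop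

theorem continuousOn_diss (hv : FrameMode K v) :
    ContinuousOn (fun s => (v s).diss) (Ioc 0 1) := by
  obtain ⟨hX, hH, hk, hΦ, hψ⟩ := hv.continuousOn_parts
  have hn := hv.continuousOn_n
  unfold FrameVal.diss
  fun_prop

theorem integral_diss_le (hv : FrameMode K v) {t : ℝ} (ht : t ∈ Ioc (0 : ℝ) 1) :
    ∫ s in t..1, s⁻¹ * (1 / 6 * (v s).diss - 40000 * K.sigma * (v s).energy)
      ≤ (v 1).modEnergy K.A - (v t).modEnergy K.A := by
  have hsub : Icc t 1 ⊆ Ioc 0 1 := fun s hs => ⟨ht.1.trans_le hs.1, hs.2⟩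
  refine intervalIntegral.integral_le_sub_of_hasDeriv_right_of_le ht.2
    (g := fun s => (v s).modEnergy K.A)
    (g' := fun s => s⁻¹ * (6000 * (2 * (v s).halfDtScalar K.q K.A) + 2 * (v s).halfDtMetric K.q))
    (fun s hs => ((hv.hasDeriv_modEnergy (hsub hs)).continuousWithinAt).mono hsub) ?_ ?_ ?_
  · intro s hs
    have h := hv.hasDeriv_modEnergy (hsub (Ioo_subset_Icc_self hs))
    have hmem : Ioc (0 : ℝ) 1 ∈ nhds s :=
      Filter.mem_of_superset (Ioo_mem_nhds (ht.1.trans hs.1) hs.2) Ioo_subset_Ioc_self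
    exact (h.hasDerivAt hmem).hasDerivWithinAt
  · apply ContinuousOn.integrableOn_Icc
    have h1 := hv.continuousOn_diss.mono hsub
    have h2 := hv.continuousOn_energy.mono hsub
    have h3 : ContinuousOn (fun s : ℝ => s⁻¹) (Icc t 1) :=
      continuousOn_inv₀.mono fun s hs => (hsub hs).1.ne'
    fun_prop
  · intro s hs
    have h := hsub (Ioo_subset_Icc_self hs)
    exact mul_le_mul_of_nonneg_left (FrameVal.dtModEnergy_ge (hv.constr s h))
      (inv_nonneg.2 h.1.le)

/-- Grönwall backwards from `t = 1`: with `a = 300 · 40000 σ`, the comparison of energies and the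
loss in the monotonicity combine to make `t ^ a` times the modified energy nondecreasing in `t`. -/
theorem modEnergy_le_rpow (hv : FrameMode K v) (hσ1 : K.sigma ≤ 1) {t : ℝ}
    (ht : t ∈ Ioc (0 : ℝ) 1) :
    (v t).modEnergy K.A ≤ (v 1).modEnergy K.A * t ^ (-(12000000 * K.sigma)) := by
  set a := 12000000 * K.sigma with ha
  have hder : ∀ s ∈ Ioc (0 : ℝ) 1, HasDerivWithinAt (fun s => s ^ a * (v s).modEnergy K.A)
      (a * s ^ (a - 1) * (v s).modEnergy K.A + s ^ a * (s⁻¹ *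
        (6000 * (2 * (v s).halfDtScalar K.q K.A) + 2 * (v s).halfDtMetric K.q))) (Ioc 0 1) s :=
    fun s hs => (Real.hasDerivAt_rpow_const (Or.inl hs.1.ne')).hasDerivWithinAt.mul
      (hv.hasDeriv_modEnergy hs)
  have hmono : MonotoneOn (fun s => s ^ a * (v s).modEnergy K.A) (Ioc 0 1) := by
    refine monotoneOn_of_hasDerivWithinAt_nonneg (convex_Ioc 0 1)
      (fun s hs => (hder s hs).continuousWithinAt)
      (fun s hs => (hder s (interior_subset hs)).mono interior_subset) ?_
    intro s hs
    have hs' : s ∈ Ioc (0 : ℝ) 1 := interior_subset hs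
    have hp : 0 < s ^ (a - 1) := Real.rpow_pos_of_pos hs'.1 _
    have e : s ^ a * s⁻¹ = s ^ (a - 1) := by
      rw [Real.rpow_sub_one hs'.1.ne', div_eq_mul_inv]
    have h1 := FrameVal.dtModEnergy_ge (hv.constr s hs')
    have h2 := mul_le_mul_of_nonneg_left (FrameVal.energy_le (hv.constr s hs') hσ1)
      K.sigma_nonneg
    have h3 : 0 ≤ (v s).diss := by
      have := (v s).X_nonneg
      have := (v s).HH_nonneg
      rw [FrameVal.diss]; positivity
    rw [← mul_assoc, e]
    have h4 : 0 ≤ a * (v s).modEnergy K.A + (6000 * (2 * (v s).halfDtScalar K.q K.A)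
        + 2 * (v s).halfDtMetric K.q) := by rw [ha]; linarith
    have := mul_nonneg hp.le h4
    linarith
  have h := hmono ht (right_mem_Ioc.2 one_pos) ht.2
  simp only [Real.one_rpow, one_mul] at h
  rw [Real.rpow_neg ht.1.le, ← div_eq_mul_inv, le_div_iff₀ (Real.rpow_pos_of_pos ht.1 _), mul_comm]
  exact h

end FrameMode

end

section

/-! ### Calculus on the torus -/

/-- The covering map `ℝ³ → 𝕋³`. -/
def proj (x : Fin 3 → ℝ) : T3 := fun i => (x i : UnitAddCircle)

/-- Through this map continuity of a test function descends from its periodic lift, and every point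
of the torus can be lifted to compute derivatives on `ℝ³`. -/
theorem isOpenQuotientMap_proj : IsOpenQuotientMap proj :=
  IsOpenQuotientMap.piMap (f := fun (_ : Fin 3) (x : ℝ) => (x : UnitAddCircle))
    fun _ => QuotientAddGroup.isOpenQuotientMap_mk

theorem proj_add_single (x : Fin 3 → ℝ) (i : Fin 3) (s : ℝ) :
    proj (x + Pi.single i s) = proj x + Pi.single i (s : UnitAddCircle) := by
  ext j
  by_cases h : j = i
  · subst h; simp [proj]
  · simp [proj, h]

theorem IsTest.continuous {ψ : T3 → ℝ} (h : IsTest ψ) : Continuous ψ := by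
  rw [isOpenQuotientMap_proj.isQuotientMap.continuous_iff]
  exact ContDiff.continuous h

theorem IsTest.hasDerivAt_zero {ψ : T3 → ℝ} (h : IsTest ψ) (i : Fin 3) (x : Fin 3 → ℝ) :
    HasDerivAt (fun s : ℝ => ψ (proj x + Pi.single i (s : UnitAddCircle)))
      (fderiv ℝ (ψ ∘ proj) x (Pi.single i 1)) 0 := by
  have hd : HasFDerivAt (ψ ∘ proj) (fderiv ℝ (ψ ∘ proj) x) x :=
    (ContDiff.differentiable h (by simp) x).hasFDerivAt
  have hl : HasDerivAt (fun s : ℝ => x + Pi.single i s) (Pi.single i (1 : ℝ)) 0 := by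
    have h1 : HasDerivAt (fun s : ℝ => (Pi.single i s : Fin 3 → ℝ)) (Pi.single i (1 : ℝ)) 0 := by
      rw [hasDerivAt_pi]
      intro j
      by_cases hj : j = i
      · subst hj; simpa using hasDerivAt_id' (0 : ℝ)
      · simpa [hj] using hasDerivAt_const (0 : ℝ) (0 : ℝ)
    simpa using h1.const_add x
  have hx : x + Pi.single i (0 : ℝ) = x := by simp
  have hc := HasFDerivAt.comp_hasDerivAt (x := (0 : ℝ)) (f := fun s : ℝ => x + Pi.single i s)
    (l := ψ ∘ proj) (l' := fderiv ℝ (ψ ∘ proj) x) (by rw [hx]; exact hd) hl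
  simpa only [Function.comp_def, proj_add_single] using hc

theorem IsTest.pd_proj {ψ : T3 → ℝ} (h : IsTest ψ) (i : Fin 3) (x : Fin 3 → ℝ) :
    pd i ψ (proj x) = fderiv ℝ (ψ ∘ proj) x (Pi.single i 1) :=
  (h.hasDerivAt_zero i x).deriv

theorem IsTest.hasDerivAt {ψ : T3 → ℝ} (h : IsTest ψ) (i : Fin 3) (x : T3) (s : ℝ) :
    HasDerivAt (fun s : ℝ => ψ (x + Pi.single i (s : UnitAddCircle)))
      (pd i ψ (x + Pi.single i (s : UnitAddCircle))) s := by
  obtain ⟨y, hy⟩ := isOpenQuotientMap_proj.surjective (x + Pi.single i (s : UnitAddCircle))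
  have h0 := h.hasDerivAt_zero i y
  rw [← h.pd_proj, hy] at h0
  rw [← sub_self s] at h0
  have h1 := HasDerivAt.comp_sub_const s s h0
  refine h1.congr_of_eventuallyEq (Filter.Eventually.of_forall fun r => ?_)
  simp only
  rw [add_assoc, ← Pi.single_add]
  congr 3
  rw [← AddCircle.coe_add]
  congr 1
  ring

theorem IsTest.pd {ψ : T3 → ℝ} (h : IsTest ψ) (i : Fin 3) : IsTest (pd i ψ) := by
  have h1 : ContDiff ℝ ∞ (fun x => fderiv ℝ (ψ ∘ proj) x (Pi.single i 1)) :=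
    (ContDiff.fderiv_right (m := ∞) h (by simp)).clm_apply contDiff_const
  have h2 : (fun x => LinKasner.pd i ψ (proj x)) = _ := funext fun x => h.pd_proj i x
  rw [← h2] at h1
  exact h1

theorem IsTest.mul {ψ φ : T3 → ℝ} (h : IsTest ψ) (h' : IsTest φ) :
    IsTest (fun x => ψ x * φ x) := ContDiff.mul (𝕜 := ℝ) h h'

theorem IsTest.iterate_pd {ψ : T3 → ℝ} (h : IsTest ψ) (i : Fin 3) (m : ℕ) :
    IsTest ((LinKasner.pd i)^[m] ψ) := by
  induction m with
  | zero => exact h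
  | succ m ih => rw [Function.iterate_succ_apply']; exact ih.pd i

theorem IsTest.pdI {ψ : T3 → ℝ} (h : IsTest ψ) (I : MIdx) : IsTest (pdI I ψ) :=
  ((h.iterate_pd _ _).iterate_pd _ _).iterate_pd _ _

theorem pd_mul {ψ φ : T3 → ℝ} (h : IsTest ψ) (h' : IsTest φ) (i : Fin 3) (x : T3) :
    pd i (fun x => ψ x * φ x) x = pd i ψ x * φ x + ψ x * pd i φ x := by
  have h1 := h.hasDerivAt i x 0
  have h2 := h'.hasDerivAt i x 0
  have h3 := (h1.fun_mul h2).deriv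
  simp only [AddCircle.coe_zero, Pi.single_zero, add_zero] at h3
  exact h3

theorem IsTest.integrable {ψ : T3 → ℝ} (h : IsTest ψ) : Integrable ψ :=
  h.continuous.integrable_of_hasCompactSupport (HasCompactSupport.of_compactSpace ψ)

theorem IsTest.memLp {ψ : T3 → ℝ} (h : IsTest ψ) : MemLp ψ 2 volume :=
  h.continuous.memLp_of_hasCompactSupport (HasCompactSupport.of_compactSpace ψ)

/-- The translation vector `s eᵢ` on the torus. -/
def shift (i : Fin 3) (s : ℝ) : T3 := Pi.single i (s : UnitAddCircle)

theorem shift_zero (i : Fin 3) : shift i 0 = 0 := by simp [shift]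

theorem hasDerivAt_integral_of_deriv_le {α : Type*} [MeasurableSpace α] {μ : Measure α}
    [IsFiniteMeasure μ] {F F' : ℝ → α → ℝ} {C : ℝ}
    (h1 : ∀ s, AEStronglyMeasurable (F s) μ) (h2 : AEStronglyMeasurable (F' 0) μ)
    (h3 : Integrable (F 0) μ) (h4 : ∀ s x, ‖F' s x‖ ≤ C)
    (h5 : ∀ x s, HasDerivAt (fun s => F s x) (F' s x) s) :
    HasDerivAt (fun s => ∫ x, F s x ∂μ) (∫ x, F' 0 x ∂μ) 0 :=
  (hasDerivAt_integral_of_dominated_loc_of_deriv_le (s := univ) (bound := fun _ => C)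
    Filter.univ_mem (Filter.Eventually.of_forall h1) h3 h2
    (Filter.Eventually.of_forall fun x s _ => h4 s x) (integrable_const C)
    (Filter.Eventually.of_forall fun x s _ => h5 x s)).2

theorem hasDerivAt_integral_shift {ψ : T3 → ℝ} (h : IsTest ψ) (i : Fin 3) :
    HasDerivAt (fun s : ℝ => ∫ x : T3, ψ (x + shift i s)) (∫ x : T3, pd i ψ x) 0 := by
  obtain ⟨C, hC⟩ := isCompact_univ.exists_bound_of_continuousOn (h.pd i).continuous.continuousOn
  have hm : ∀ (φ : T3 → ℝ) (_ : Continuous φ) (s : ℝ), AEStronglyMeasurable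
      (fun x : T3 => φ (x + shift i s)) (volume : Measure T3) :=
    fun φ hφ s => Continuous.aestronglyMeasurable (hφ.comp (continuous_add_const _))
  have hi : Integrable (fun x : T3 => ψ (x + shift i 0)) := by
    simpa [shift_zero] using h.integrable
  have key := hasDerivAt_integral_of_deriv_le (α := T3) (μ := volume)
    (F := fun s x => ψ (x + shift i s)) (F' := fun s x => pd i ψ (x + shift i s))
    (hm ψ h.continuous) (hm _ (h.pd i).continuous 0) hi (fun s x => hC _ (mem_univ _))
    (h.hasDerivAt i)
  simpa only [shift_zero, add_zero] using key

/-- Translation invariance of the measure: the integral of a translate is constant in the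
translation parameter, so its derivative vanishes. -/
theorem integral_pd {ψ : T3 → ℝ} (h : IsTest ψ) (i : Fin 3) : ∫ x, pd i ψ x = 0 := by
  have key := hasDerivAt_integral_shift h i
  simp only [integral_add_right_eq_self (μ := (volume : Measure T3))] at key
  exact key.unique (hasDerivAt_const _ _)

theorem integral_pd_mul {ψ φ : T3 → ℝ} (h : IsTest ψ) (h' : IsTest φ) (i : Fin 3) :
    ∫ x, pd i ψ x * φ x = -∫ x, ψ x * pd i φ x := by
  have h0 := integral_pd (h.mul h') i
  simp only [pd_mul h h'] at h0
  rw [integral_add ((h.pd i).mul h').integrable (h.mul (h'.pd i)).integrable] at h0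
  linarith

/-! ### Trigonometric test functions -/

open UnitAddTorus in
/-- The real trigonometric function `Re (z e^{2πi k·x})`. -/
def cw (k : Fin 3 → ℤ) (z : ℂ) (x : T3) : ℝ := (z * mFourier k x).re

/-- The frequency `2π kᵢ`. -/
def freq (k : Fin 3 → ℤ) (i : Fin 3) : ℝ := 2 * Real.pi * k i

open UnitAddTorus in
theorem mFourier_proj (k : Fin 3 → ℤ) (x : Fin 3 → ℝ) :
    mFourier k (proj x) = Complex.exp (∑ i, freq k i * x i * Complex.I) := by
  simp only [mFourier, ContinuousMap.coe_mk, proj, fourier_coe_apply, ← Complex.exp_sum]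
  congr 1
  refine Finset.sum_congr rfl fun i _ => ?_
  simp only [freq]
  push_cast
  ring

theorem isTest_cw (k : Fin 3 → ℤ) (z : ℂ) : IsTest (cw k z) := by
  have : (fun x : Fin 3 → ℝ => cw k z fun i => (x i : UnitAddCircle))
      = fun x => Complex.reCLM (z * Complex.exp (∑ i, freq k i * x i * Complex.I)) := by
    ext x
    exact congrArg (fun w => (z * w).re) (mFourier_proj k x)
  unfold IsTest
  rw [this]
  apply Complex.reCLM.contDiff.comp
  apply contDiff_const.mul
  apply ContDiff.cexp
  refine ContDiff.sum fun i _ => ?_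
  refine ContDiff.mul (ContDiff.mul contDiff_const ?_) contDiff_const
  exact Complex.ofRealCLM.contDiff.comp (contDiff_apply ℝ ℝ i)

theorem pd_cw (i : Fin 3) (k : Fin 3 → ℤ) (z : ℂ) :
    pd i (cw k z) = cw k (freq k i * Complex.I * z) := by
  funext x
  obtain ⟨y, rfl⟩ := isOpenQuotientMap_proj.surjective x
  have h1 : ∀ s : ℝ, cw k z (proj y + Pi.single i (s : UnitAddCircle))
      = (z * UnitAddTorus.mFourier k (proj y) * Complex.exp (freq k i * Complex.I * s)).re := by
    intro s
    rw [← proj_add_single, cw, mFourier_proj, mFourier_proj, mul_assoc, ← Complex.exp_add]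
    congr 3
    rw [← sub_eq_iff_eq_add', ← Finset.sum_sub_distrib,
      Finset.sum_eq_single i]
    · simp; ring
    · intro j _ hj
      simp [hj]
    · simp
  have h2 : HasDerivAt (fun s : ℝ => z * UnitAddTorus.mFourier k (proj y) *
      Complex.exp (freq k i * Complex.I * s))
      (z * UnitAddTorus.mFourier k (proj y) * (freq k i * Complex.I)) 0 := by
    have h3 : HasDerivAt (fun s : ℝ => (freq k i * Complex.I * s : ℂ)) (freq k i * Complex.I) 0 := by
      simpa using (Complex.ofRealCLM.hasDerivAt (x := (0 : ℝ))).const_mul (freq k i * Complex.I)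
    simpa using (h3.cexp).const_mul (z * UnitAddTorus.mFourier k (proj y))
  have h4 := (Complex.reCLM.hasFDerivAt.comp_hasDerivAt (0 : ℝ) h2).deriv
  rw [pd]
  simp only [h1]
  simp only [Function.comp_def, Complex.reCLM_apply] at h4
  rw [h4, cw]
  congr 1
  ring

/-- The symbol `(2πi k)^I` of `∂_I`. -/
def csymb (I : MIdx) (k : Fin 3 → ℤ) : ℂ := ∏ i, (freq k i * Complex.I) ^ I i

theorem iterate_pd_cw (i : Fin 3) (k : Fin 3 → ℤ) (m : ℕ) (z : ℂ) :
    (pd i)^[m] (cw k z) = cw k ((freq k i * Complex.I) ^ m * z) := by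
  induction m with
  | zero => simp
  | succ m ih => rw [Function.iterate_succ_apply', ih, pd_cw, pow_succ']; ring_nf

theorem pdI_cw (I : MIdx) (k : Fin 3 → ℤ) (z : ℂ) : pdI I (cw k z) = cw k (csymb I k * z) := by
  rw [pdI, iterate_pd_cw, iterate_pd_cw, iterate_pd_cw, csymb, Fin.prod_univ_three]
  ring_nf

end

section

/-! ### Fourier coefficients -/

open UnitAddTorus ComplexConjugate

/-- Each circle has length one, so its Lebesgue measure is the Haar probability measure for which
Parseval's identity is available. -/
theorem volume_T3_eq :
    (volume : Measure T3) = Measure.pi fun _ : Fin 3 => (AddCircle.haarAddCircle (T := 1)) := by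
  rw [volume_pi]
  congr 1
  funext i
  rw [AddCircle.volume_eq_smul_haarAddCircle]
  simp

theorem hasSum_inner_pi_haar
    (F G : Lp ℂ 2 (Measure.pi fun _ : Fin 3 => (AddCircle.haarAddCircle (T := 1)))) :
    HasSum (fun k : Fin 3 → ℤ =>
      conj (∫ t, mFourier (-k) t * F t ∂(Measure.pi fun _ => AddCircle.haarAddCircle)) *
        ∫ t, mFourier (-k) t * G t ∂(Measure.pi fun _ => AddCircle.haarAddCircle))
      (∫ t, conj (F t) * G t ∂(Measure.pi fun _ => AddCircle.haarAddCircle)) :=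
  hasSum_prod_mFourierCoeff F G

theorem exists_fourier_pi_haar (c : lp (fun _ : Fin 3 → ℤ => ℂ) 2) :
    ∃ F : Lp ℂ 2 (Measure.pi fun _ : Fin 3 => (AddCircle.haarAddCircle (T := 1))),
      ∀ k, ∫ t, mFourier (-k) t * F t ∂(Measure.pi fun _ => AddCircle.haarAddCircle) = c k := by
  refine ⟨mFourierBasis.repr.symm c, fun k => ?_⟩
  have h := mFourierBasis_repr (mFourierBasis.repr.symm c) k
  rw [LinearIsometryEquiv.apply_symm_apply] at h
  exact h.symm

theorem hasSum_inner_T3 (F G : Lp ℂ 2 (volume : Measure T3)) :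
    HasSum (fun k : Fin 3 → ℤ => conj (∫ t, mFourier (-k) t * F t) * ∫ t, mFourier (-k) t * G t)
      (∫ t, conj (F t) * G t) := by
  -- The types of `F` and `G` depend on the measure that is rewritten.
  revert F G
  rw [volume_T3_eq]
  exact hasSum_inner_pi_haar

theorem exists_fourier_T3 (c : lp (fun _ : Fin 3 → ℤ => ℂ) 2) :
    ∃ F : Lp ℂ 2 (volume : Measure T3), ∀ k, ∫ t, mFourier (-k) t * F t = c k := by
  rw [volume_T3_eq]
  exact exists_fourier_pi_haar c

/-- The Fourier coefficient `∫ f e^{2πi k·x} dx`. -/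
def fc (f : T3 → ℝ) (k : Fin 3 → ℤ) : ℂ := ∫ x, mFourier k x * (f x : ℂ)

theorem integral_mFourier_toLp {f : T3 → ℝ} (hf : MemLp f 2 volume) (k : Fin 3 → ℤ) :
    ∫ t, mFourier (-k) t * (MemLp.toLp _ (hf.ofReal (K := ℂ))) t = fc f (-k) := by
  refine integral_congr_ae ?_
  filter_upwards [(hf.ofReal (K := ℂ)).coeFn_toLp] with x hx
  rw [hx]
  rfl

theorem hasSum_fc_mul {f g : T3 → ℝ} (hf : MemLp f 2 volume) (hg : MemLp g 2 volume) :
    HasSum (fun k => conj (fc f k) * fc g k) ((∫ x, f x * g x : ℝ) : ℂ) := by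
  have h := hasSum_inner_T3 (MemLp.toLp _ (hf.ofReal (K := ℂ)))
    (MemLp.toLp _ (hg.ofReal (K := ℂ)))
  have e2 : ∫ t, conj ((MemLp.toLp _ (hf.ofReal (K := ℂ))) t) * (MemLp.toLp _ (hg.ofReal (K := ℂ))) t
      = ((∫ x, f x * g x : ℝ) : ℂ) := by
    rw [← integral_complex_ofReal]
    refine integral_congr_ae ?_
    filter_upwards [(hf.ofReal (K := ℂ)).coeFn_toLp, (hg.ofReal (K := ℂ)).coeFn_toLp] with x hx hy
    rw [hx, hy]
    simp
  rw [e2] at h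
  have e := fun (k : Fin 3 → ℤ) => integral_mFourier_toLp hf k
  have e' := fun (k : Fin 3 → ℤ) => integral_mFourier_toLp hg k
  simp_rw [e, e'] at h
  -- The coefficient `fc` carries the exponential with the positive sign, so the Parseval series is
  -- reindexed by `k ↦ -k`.
  exact (Equiv.neg (Fin 3 → ℤ)).hasSum_iff.1 h

theorem integrable_mFourier_mul {f : T3 → ℂ} (hf : Integrable f) (k : Fin 3 → ℤ) :
    Integrable (fun x => mFourier k x * f x) := by
  refine hf.bdd_mul (c := 1) (mFourier k).continuous.aestronglyMeasurable
    (Filter.Eventually.of_forall fun x => ?_)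
  exact ((mFourier k).norm_coe_le_norm x).trans mFourier_norm.le

theorem toD_cw {f : T3 → ℝ} (hf : Integrable f) (k : Fin 3 → ℤ) (z : ℂ) :
    toD f (cw k z) = (z * fc f k).re := by
  have h : Integrable (fun x => mFourier k x * (f x : ℂ)) :=
    integrable_mFourier_mul hf.ofReal k
  rw [fc, ← integral_const_mul, toD, ← RCLike.re_eq_complex_re, ← integral_re (h.const_mul z)]
  refine integral_congr_ae (Filter.Eventually.of_forall fun x => ?_)
  simp only [cw, RCLike.re_eq_complex_re]
  rw [← mul_assoc, Complex.re_mul_ofReal, mul_comm]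

theorem fc_neg (f : T3 → ℝ) (k : Fin 3 → ℤ) : fc f (-k) = conj (fc f k) := by
  rw [fc, fc, ← integral_conj]
  simp only [mFourier_neg, map_mul, Complex.conj_ofReal]

/-- Riesz–Fischer gives a complex function with these coefficients. By the conjugation symmetry its
complex conjugate has the same ones, and therefore so does its real part. -/
theorem exists_fc_eq {c : (Fin 3 → ℤ) → ℂ} (hc : Summable fun k => ‖c k‖ ^ 2)
    (hneg : ∀ k, c (-k) = conj (c k)) :
    ∃ D : T3 → ℝ, MemLp D 2 volume ∧ ∀ k, fc D k = c k := by
  have hmem : Memℓp (fun k => c (-k)) 2 := by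
    rw [memℓp_gen_iff (by simp)]
    have := (Equiv.neg (Fin 3 → ℤ)).summable_iff.2 hc
    simpa [Function.comp_def] using this
  obtain ⟨F, hF⟩ := exists_fourier_T3 ⟨_, hmem⟩
  have hF' : ∀ k, ∫ t, mFourier k t * F t = c k := fun k => by
    have := hF (-k)
    simpa using this
  have hi : Integrable F := (Lp.memLp F).integrable (by norm_num)
  have hconj : ∀ k, ∫ t, mFourier k t * conj (F t) = c k := by
    intro k
    have h1 := congrArg conj (hF' (-k))
    rw [← integral_conj, hneg, Complex.conj_conj] at h1
    rw [← h1]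
    refine integral_congr_ae (Filter.Eventually.of_forall fun t => ?_)
    simp [mFourier_neg]
  have hic : Integrable (fun t => conj (F t)) :=
    (Complex.conjLIE.toContinuousLinearEquiv.toContinuousLinearMap).integrable_comp hi
  refine ⟨fun x => (F x).re, (Lp.memLp F).re, fun k => ?_⟩
  have : ∀ x, mFourier k x * (((F x).re : ℝ) : ℂ)
      = 1 / 2 * (mFourier k x * F x + mFourier k x * conj (F x)) := by
    intro x
    rw [Complex.re_eq_add_conj]
    ring
  rw [fc]
  simp only [this]
  rw [integral_const_mul, integral_add (integrable_mFourier_mul hi k)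
    (integrable_mFourier_mul hic k), hF', hconj]
  ring

/-! ### Weak derivatives in Fourier space -/

/-- The squared modulus `|(2πk)^I|²` of the symbol of `∂_I`. -/
def symb (I : MIdx) (k : Fin 3 → ℤ) : ℝ := ∏ i, (freq k i ^ 2) ^ I i

theorem symb_nonneg (I : MIdx) (k : Fin 3 → ℤ) : 0 ≤ symb I k :=
  Finset.prod_nonneg fun _ _ => pow_nonneg (sq_nonneg _) _

theorem norm_csymb_sq (I : MIdx) (k : Fin 3 → ℤ) : ‖csymb I k‖ ^ 2 = symb I k := by
  rw [csymb, symb, norm_prod, ← Finset.prod_pow]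
  refine Finset.prod_congr rfl fun i _ => ?_
  rw [norm_pow, norm_mul, Complex.norm_I, mul_one, Complex.norm_real, Real.norm_eq_abs,
    ← pow_mul, mul_comm, pow_mul, sq_abs]

theorem conj_csymb (I : MIdx) (k : Fin 3 → ℤ) :
    conj (csymb I k) = (-1) ^ order I * csymb I k := by
  rw [csymb, map_prod, order, ← Finset.prod_pow_eq_pow_sum, ← Finset.prod_mul_distrib]
  refine Finset.prod_congr rfl fun i _ => ?_
  rw [← mul_pow, map_pow]
  simp

theorem csymb_neg (I : MIdx) (k : Fin 3 → ℤ) : csymb I (-k) = conj (csymb I k) := by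
  rw [csymb, csymb, map_prod]
  refine Finset.prod_congr rfl fun i _ => ?_
  simp [freq, map_ofNat]

theorem eq_of_re_mul_eq {a b : ℂ} (h : ∀ z : ℂ, (z * a).re = (z * b).re) : a = b := by
  apply Complex.ext
  · simpa using h 1
  · simpa using h Complex.I

theorem fc_pd {ψ : T3 → ℝ} (h : IsTest ψ) (i : Fin 3) (k : Fin 3 → ℤ) :
    fc (pd i ψ) k = -(freq k i * Complex.I) * fc ψ k := by
  refine eq_of_re_mul_eq fun z => ?_
  rw [← toD_cw (h.pd i).integrable, toD, integral_pd_mul h (isTest_cw k z), pd_cw]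
  have := toD_cw h.integrable k (freq k i * Complex.I * z)
  rw [toD] at this
  rw [this, ← Complex.neg_re]
  congr 1
  ring

theorem fc_iterate_pd {ψ : T3 → ℝ} (h : IsTest ψ) (i : Fin 3) (k : Fin 3 → ℤ) (m : ℕ) :
    fc ((pd i)^[m] ψ) k = (-(freq k i * Complex.I)) ^ m * fc ψ k := by
  induction m with
  | zero => simp
  | succ m ih =>
    rw [Function.iterate_succ_apply', fc_pd (h.iterate_pd i m), ih, pow_succ']
    ring

theorem fc_pdI {ψ : T3 → ℝ} (h : IsTest ψ) (I : MIdx) (k : Fin 3 → ℤ) :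
    fc (pdI I ψ) k = (-1) ^ order I * csymb I k * fc ψ k := by
  rw [pdI, fc_iterate_pd ((h.iterate_pd _ _).iterate_pd _ _), fc_iterate_pd (h.iterate_pd _ _),
    fc_iterate_pd h, csymb, order, ← Finset.prod_pow_eq_pow_sum, ← Finset.prod_mul_distrib,
    Fin.prod_univ_three]
  simp only [← mul_pow, neg_one_mul]
  ring

/-- Trigonometric test functions are eigenfunctions of `∂_I`, so testing with them alone determines
all coefficients of a weak derivative. -/
theorem IsWeakDeriv.fc_eq {I : MIdx} {f D : T3 → ℝ} (hf : MemLp f 2 volume)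
    (h : IsWeakDeriv I f D) (k : Fin 3 → ℤ) :
    fc D k = (-1) ^ order I * csymb I k * fc f k := by
  refine eq_of_re_mul_eq fun z => ?_
  have h1 := h.2 (cw k z) (isTest_cw k z)
  rw [pdI_cw] at h1
  have h2 := toD_cw (hf.integrable (by norm_num)) k (csymb I k * z)
  have h3 := toD_cw (h.1.integrable (by norm_num)) k z
  rw [toD] at h2 h3
  rw [h2, h3] at h1
  have h4 : ((-1 : ℝ) ^ order I) * (-1) ^ order I = 1 := by
    rw [← mul_pow]; simp
  have h5 : (z * ((-1) ^ order I * csymb I k * fc f k)).re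
      = (-1 : ℝ) ^ order I * (csymb I k * z * fc f k).re := by
    rw [← Complex.re_ofReal_mul]
    push_cast
    congr 1
    ring
  rw [h5, h1, ← mul_assoc, h4, one_mul]

/-- `‖∂_I f‖²` computed from the Fourier coefficients. -/
def sobSq (I : MIdx) (f : T3 → ℝ) : ℝ≥0∞ :=
  ∑' k, ENNReal.ofReal (symb I k * ‖fc f k‖ ^ 2)

theorem tsum_norm_fc_sq {f : T3 → ℝ} (hf : MemLp f 2 volume) :
    ∑' k, ENNReal.ofReal (‖fc f k‖ ^ 2) = ∫⁻ x, ENNReal.ofReal (f x ^ 2) := by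
  have h := Complex.hasSum_re (hasSum_fc_mul hf hf)
  have e : ∀ k, (conj (fc f k) * fc f k).re = ‖fc f k‖ ^ 2 := by
    intro k
    rw [mul_comm, Complex.mul_conj, Complex.ofReal_re, Complex.normSq_eq_norm_sq]
  simp only [e, Complex.ofReal_re] at h
  rw [← ENNReal.ofReal_tsum_of_nonneg (fun k => sq_nonneg _) h.summable, h.tsum_eq,
    ← ofReal_integral_eq_lintegral_ofReal hf.integrable_sq
      (Filter.Eventually.of_forall fun x => sq_nonneg _)]
  simp only [sq]

theorem IsWeakDeriv.lintegral_eq {I : MIdx} {f D : T3 → ℝ} (hf : MemLp f 2 volume)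
    (h : IsWeakDeriv I f D) : ∫⁻ x, ENNReal.ofReal (D x ^ 2) = sobSq I f := by
  rw [← tsum_norm_fc_sq h.1, sobSq]
  refine tsum_congr fun k => ?_
  rw [h.fc_eq hf, norm_mul, norm_mul, mul_pow, mul_pow, norm_csymb_sq]
  simp

/-- The expected coefficients are square summable and have the symmetry of a real function, which
produces the candidate. The weak identity against an arbitrary test function then follows by
comparing the two Parseval series term by term. -/
theorem exists_isWeakDeriv {I : MIdx} {f : T3 → ℝ} (hf : MemLp f 2 volume)
    (h : sobSq I f ≠ ⊤) : ∃ D, IsWeakDeriv I f D := by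
  have hs : Summable fun k => ‖(-1) ^ order I * csymb I k * fc f k‖ ^ 2 := by
    have h1 := ENNReal.summable_toReal h
    refine h1.congr fun k => ?_
    rw [ENNReal.toReal_ofReal (mul_nonneg (symb_nonneg _ _) (sq_nonneg _)), norm_mul, norm_mul,
      mul_pow, mul_pow, norm_csymb_sq]
    simp
  obtain ⟨D, hD, hDc⟩ := exists_fc_eq hs fun k => by
    rw [csymb_neg, fc_neg]; simp
  refine ⟨D, hD, fun ψ hψ => ?_⟩
  have h1 := hasSum_fc_mul hf (hψ.pdI I).memLp
  have h2 := (hasSum_fc_mul hD hψ.memLp).mul_left ((-1 : ℂ) ^ order I)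
  have h3 : (fun k => conj (fc f k) * fc (pdI I ψ) k)
      = fun k => (-1 : ℂ) ^ order I * (conj (fc D k) * fc ψ k) := by
    funext k
    have h4 : ((-1 : ℂ) ^ order I) * (-1) ^ order I = 1 := by
      rw [← mul_pow]; simp
    rw [hDc, fc_pdI hψ]
    simp only [map_mul, conj_csymb, map_pow, map_neg, map_one]
    linear_combination (-((-1 : ℂ) ^ order I * conj (fc f k) * csymb I k * fc ψ k)) * h4
  rw [h3] at h1
  have h5 := h1.unique h2
  exact_mod_cast h5

/-- All admissible choices of weak derivatives have the same `L²` norms, read off from Fourier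
coefficients, so the infimum is over one value. If a Fourier sum diverges, both sides are `∞`. -/
theorem weakInt_eq {ι : Type} [Fintype ι] {Q : (ι → ℝ) → ℝ} {w : ι → ℝ} (hw : ∀ c, 0 < w c)
    (hQ : ∀ v, Q v = ∑ c, w c * v c ^ 2) (J : ι → MIdx) {T : ι → T3 → ℝ}
    (hT : ∀ c, MemLp (T c) 2 volume) :
    weakInt Q J T = ∑ c, ENNReal.ofReal (w c) * sobSq (J c) (T c) := by
  have key : ∀ D : ι → T3 → ℝ, (∀ c, IsWeakDeriv (J c) (T c) (D c)) →
      ∫⁻ x, ENNReal.ofReal (Q fun c => D c x)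
        = ∑ c, ENNReal.ofReal (w c) * sobSq (J c) (T c) := by
    intro D hD
    have hm : ∀ c, AEMeasurable (fun x => ENNReal.ofReal (D c x ^ 2)) volume := fun c =>
      (((hD c).1.aestronglyMeasurable.aemeasurable).pow_const 2).ennreal_ofReal
    have e : ∀ x, ENNReal.ofReal (Q fun c => D c x)
        = ∑ c, ENNReal.ofReal (w c) * ENNReal.ofReal (D c x ^ 2) := by
      intro x
      rw [hQ, ENNReal.ofReal_sum_of_nonneg fun c _ => mul_nonneg (hw c).le (sq_nonneg _)]
      exact Finset.sum_congr rfl fun c _ => ENNReal.ofReal_mul (hw c).le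
    simp only [e]
    rw [lintegral_finsetSum' _ fun c _ => (hm c).const_mul _]
    refine Finset.sum_congr rfl fun c _ => ?_
    rw [lintegral_const_mul'' _ (hm c), (hD c).lintegral_eq (hT c)]
  unfold weakInt
  by_cases hex : ∀ c, sobSq (J c) (T c) ≠ ⊤
  · choose D hD using fun c => exists_isWeakDeriv (hT c) (hex c)
    refine le_antisymm ((iInf₂_le D hD).trans (key D hD).le) ?_
    exact le_iInf₂ fun D hD => (key D hD).ge
  · push Not at hex
    obtain ⟨c, hc⟩ := hex
    have : ∑ c, ENNReal.ofReal (w c) * sobSq (J c) (T c) = ⊤ := by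
      rw [ENNReal.sum_eq_top]
      refine ⟨c, Finset.mem_univ c, ?_⟩
      rw [hc]
      -- Strict positivity of the weight matters here, since `0 * ⊤ = 0` would hide a missing
      -- derivative.
      exact ENNReal.mul_top (by simpa using hw c)
    rw [this, eq_top_iff]
    exact le_iInf₂ fun D hD => by rw [key D hD, this]

end

section

/-! ### The equations for a Fourier mode -/

theorem toD_cw_ofReal_mul (f : T3 → ℝ) (k : Fin 3 → ℤ) (a : ℝ) (z : ℂ) :
    toD f (cw k (a * z)) = a * toD f (cw k z) := by
  rw [toD, toD, ← integral_const_mul]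
  refine integral_congr_ae (Filter.Eventually.of_forall fun x => ?_)
  simp only [cw]
  rw [mul_assoc, Complex.re_ofReal_mul]
  ring

theorem dd_toD_cw (i : Fin 3) (f : T3 → ℝ) (k : Fin 3 → ℤ) (z : ℂ) :
    dd i (toD f) (cw k z) = -(freq k i * toD f (cw k (Complex.I * z))) := by
  rw [dd, pd_cw, mul_assoc, toD_cw_ofReal_mul]

theorem toD_cw_I_mul_I (f : T3 → ℝ) (k : Fin 3 → ℤ) (a : ℝ) (z : ℂ) :
    toD f (cw k (Complex.I * (a * Complex.I * z))) = -(a * toD f (cw k z)) := by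
  have : Complex.I * (a * Complex.I * z) = ((-a : ℝ) : ℂ) * z := by
    push_cast
    linear_combination (a * z) * Complex.I_mul_I
  rw [this, toD_cw_ofReal_mul]
  ring

theorem dd_dd_toD_cw (i j : Fin 3) (f : T3 → ℝ) (k : Fin 3 → ℤ) (z : ℂ) :
    dd i (dd j (toD f)) (cw k z) = -(freq k i * freq k j * toD f (cw k z)) := by
  rw [dd, pd_cw, dd_toD_cw, toD_cw_I_mul_I]
  ring

theorem toD_cw_I_neg_I (f : T3 → ℝ) (k : Fin 3 → ℤ) (z : ℂ) :
    toD f (cw k (Complex.I * (-Complex.I * z))) = toD f (cw k z) := by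
  have : Complex.I * (-Complex.I * z) = z := by linear_combination (-z) * Complex.I_mul_I
  rw [this]

section

variable (K : Kasner) (u : LinVars) (k : Fin 3 → ℤ) (z : ℂ) (t : ℝ)

theorem chr_cw (a i b : Fin 3) :
    chr K u t a i b (cw k z) = -(1 / 2 * t ^ (-(2 * K.q i)) *
      (freq k a * toD (u.h t i b) (cw k (Complex.I * z))
        + freq k b * toD (u.h t a i) (cw k (Complex.I * z))
        - freq k i * toD (u.h t a b) (cw k (Complex.I * z)))) := by
  simp only [chr, Kasner.gi, Finset.sum_apply, Pi.smul_apply, Pi.add_apply, Pi.sub_apply,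
    smul_eq_mul, dd_toD_cw, mul_ite, mul_zero, ite_mul, zero_mul, Finset.sum_ite_eq,
    Finset.mem_univ, if_true]
  ring

theorem dd_chr_cw (c a i b : Fin 3) :
    dd c (chr K u t a i b) (cw k z) = -(freq k c * (1 / 2 * t ^ (-(2 * K.q i)) *
      (freq k a * toD (u.h t i b) (cw k z) + freq k b * toD (u.h t a i) (cw k z)
        - freq k i * toD (u.h t a b) (cw k z)))) := by
  rw [dd, pd_cw, chr_cw]
  simp only [toD_cw_I_mul_I]
  ring

theorem lap_cw (f : T3 → ℝ) :
    lap K t f (cw k z) = -(∑ a, t ^ (-(2 * K.q a)) * freq k a ^ 2) * toD f (cw k z) := by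
  simp only [lap, Kasner.gi, Finset.sum_apply, Pi.smul_apply, smul_eq_mul, dd_dd_toD_cw, ite_mul,
    zero_mul, Finset.sum_ite_eq, Finset.mem_univ, if_true, ← Finset.sum_neg_distrib,
    Finset.sum_mul]
  exact Finset.sum_congr rfl fun a _ => by ring

theorem ric_cw (i j : Fin 3) :
    ric K u t i j (cw k z) = 1 / 2 * t ^ (-(2 * K.q i)) *
        (∑ e, t ^ (-(2 * K.q e)) * freq k e ^ 2) * toD (u.h t j i) (cw k z)
      - 1 / 2 * freq k j * t ^ (-(2 * K.q i)) * ∑ e, t ^ (-(2 * K.q e)) *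
        (1 / 2 * (freq k e * toD (u.h t i e) (cw k z) + freq k e * toD (u.h t e i) (cw k z)
          - freq k i * toD (u.h t e e) (cw k z)))
      - 1 / 2 * freq k i * t ^ (-(2 * K.q i)) * t ^ (2 * K.q j) * t ^ (-(2 * K.q j)) *
        ∑ e, t ^ (-(2 * K.q e)) *
        (1 / 2 * (freq k e * toD (u.h t j e) (cw k z) + freq k e * toD (u.h t e j) (cw k z)
          - freq k j * toD (u.h t e e) (cw k z))) := by
  simp only [ric, Kasner.gi, Kasner.g, Finset.sum_apply, Pi.smul_apply, Pi.add_apply, Pi.neg_apply,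
    smul_eq_mul, dd_dd_toD_cw, dd_chr_cw, mul_ite, mul_zero, ite_mul, zero_mul, Finset.sum_ite_eq,
    Finset.mem_univ, if_true]
  simp only [Finset.sum_ite_irrel, Finset.sum_const_zero, Finset.sum_ite_eq, Finset.mem_univ,
    if_true]
  simp only [Fin.sum_univ_three]
  ring

theorem ric_cw_of_symm (hs : ∀ i j, toD (u.h t i j) = toD (u.h t j i)) (i j : Fin 3) :
    ric K u t i j (cw k z) = 1 / 2 * t ^ (-(2 * K.q i)) *
        (∑ e, t ^ (-(2 * K.q e)) * freq k e ^ 2) * toD (u.h t i j) (cw k z)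
      - 1 / 2 * freq k j * t ^ (-(2 * K.q i)) * ∑ e, t ^ (-(2 * K.q e)) *
        (freq k e * toD (u.h t i e) (cw k z) - 1 / 2 * freq k i * toD (u.h t e e) (cw k z))
      - 1 / 2 * freq k i * t ^ (-(2 * K.q i)) * t ^ (2 * K.q j) * t ^ (-(2 * K.q j)) *
        ∑ e, t ^ (-(2 * K.q e)) *
        (freq k e * toD (u.h t j e) (cw k z) - 1 / 2 * freq k j * toD (u.h t e e) (cw k z)) := by
  rw [ric_cw, hs j i]
  congr 2
  · congr 1
    exact Finset.sum_congr rfl fun e _ => by rw [hs e i]; ring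
  · exact Finset.sum_congr rfl fun e _ => by rw [hs e j]; ring

/-- The frame components of a Fourier mode of the linearized variables. -/
def modeVal : FrameVal where
  ξ i := t * (t ^ K.q i)⁻¹ * freq k i
  H i j := (t ^ K.q i)⁻¹ * (t ^ K.q j)⁻¹ * toD (u.h t i j) (cw k z)
  k i j := t ^ K.q i * (t ^ K.q j)⁻¹ * toD (u.κ t i j) (cw k z)
  Φ := toD (u.Φ t) (cw k z)
  ψ := t * toD (u.Φt t) (cw k z)
  n := toD (u.n t) (cw k z)

end

variable {K : Kasner} {u : LinVars}

theorem rpow_neg_two_mul {t : ℝ} (ht : 0 < t) (q : ℝ) : t ^ (-(2 * q)) = (t ^ q)⁻¹ ^ 2 := by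
  rw [Real.rpow_neg ht.le, mul_comm, Real.rpow_mul ht.le, Real.rpow_ofNat, inv_pow]

theorem rpow_two_mul {t : ℝ} (ht : 0 < t) (q : ℝ) : t ^ (2 * q) = (t ^ q) ^ 2 := by
  rw [mul_comm, Real.rpow_mul ht.le, Real.rpow_ofNat]

theorem IsSolution.toD_h_symm (hu : IsSolution K u) {t : ℝ} (ht : t ∈ Ioc (0 : ℝ) 1)
    (i j : Fin 3) : toD (u.h t i j) = toD (u.h t j i) := by
  funext ψ
  refine integral_congr_ae ?_
  filter_upwards [hu.h_symm t ht i j] with x hx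
  rw [hx]

theorem IsSolution.constraints (hu : IsSolution K u) (k : Fin 3 → ℤ) (z : ℂ) {t : ℝ}
    (ht : t ∈ Ioc (0 : ℝ) 1) : (modeVal K u k z t).Constraints K where
  symm i j := by
    simp only [modeVal, hu.toD_h_symm ht i j]
    ring
  cmc := by
    have h := hu.cmc t ht _ (isTest_cw k z)
    simp only [Finset.sum_apply, Pi.zero_apply] at h
    rw [← h]
    refine Finset.sum_congr rfl fun i _ => ?_
    have : t ^ K.q i ≠ 0 := (Real.rpow_pos_of_pos ht.1 _).ne'
    simp only [modeVal]
    field_simp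
  mom j := by
    -- Every term of the momentum constraint carries exactly one derivative, which rotates the phase
    -- by `I`. Testing with the mode rotated back by `-I` brings all terms to the phase `z`; the
    -- other equations have only even numbers of derivatives, so the system closes for each phase.
    have h := hu.momentum t ht j _ (isTest_cw k (-Complex.I * z))
    have hT : ∀ i, t ^ K.q i ≠ 0 := fun i => (Real.rpow_pos_of_pos ht.1 _).ne'
    simp only [Finset.sum_apply, Pi.smul_apply, Pi.add_apply, Pi.sub_apply, Pi.neg_apply,
      smul_eq_mul, dd_toD_cw, chr_cw, toD_cw_I_neg_I, Kasner.bigKhat, Kasner.bigK, add_mul,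
      ite_mul, zero_mul, Finset.sum_add_distrib, Finset.sum_ite_eq, Finset.sum_ite_eq',
      Finset.mem_univ, if_true, rpow_neg_two_mul ht.1] at h
    have e : ∀ a, (modeVal K u k z t).ξ a * (modeVal K u k z t).k a j
        = t * (t ^ K.q j)⁻¹ * (freq k a * toD (u.κ t a j) (cw k z)) := by
      intro a
      have := hT a
      simp only [modeVal]
      field_simp
    rw [Finset.sum_congr rfl fun a _ => e a, ← Finset.mul_sum]
    rw [Finset.sum_neg_distrib] at h
    simp only [modeVal, FrameVal.trH, Fin.sum_univ_three] at h ⊢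
    linear_combination (-(t * (t ^ K.q j)⁻¹)) * h
  mom' i := by
    have h := hu.momentum' t ht i _ (isTest_cw k (-Complex.I * z))
    have hT : ∀ i, t ^ K.q i ≠ 0 := fun i => (Real.rpow_pos_of_pos ht.1 _).ne'
    simp only [Finset.sum_apply, Pi.smul_apply, Pi.add_apply, Pi.sub_apply, Pi.neg_apply,
      smul_eq_mul, dd_toD_cw, chr_cw, toD_cw_I_neg_I, Kasner.bigKhat, Kasner.bigK, Kasner.gi,
      mul_add, add_mul, mul_ite, mul_zero,
      ite_mul, zero_mul, Finset.sum_add_distrib, Finset.sum_ite_eq, Finset.sum_ite_eq',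
      Finset.mem_univ, if_true, rpow_neg_two_mul ht.1] at h
    have hi := hT i
    have e : ∀ b, (t ^ K.q i)⁻¹ * ((modeVal K u k z t).ξ b * (modeVal K u k z t).k i b)
        = t * ((t ^ K.q b)⁻¹ ^ 2 * (freq k b * toD (u.κ t i b) (cw k z))) := by
      intro b
      simp only [modeVal]
      field_simp
    rw [← mul_right_inj' (inv_ne_zero hi), Finset.mul_sum, Finset.sum_congr rfl fun a _ => e a,
      ← Finset.mul_sum]
    simp only [hu.toD_h_symm ht _ i] at h
    simp only [modeVal, FrameVal.trH, FrameVal.Hξ, Fin.sum_univ_three] at h ⊢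
    linear_combination (-t) * h
  lapse := by
    have h := hu.lapse t ht _ (isTest_cw k z)
    have hT : ∀ i, t ^ K.q i ≠ 0 := fun i => (Real.rpow_pos_of_pos ht.1 _).ne'
    simp only [Finset.sum_apply, Pi.smul_apply, Pi.add_apply, smul_eq_mul, lap_cw, Kasner.bigKhat,
      Kasner.bigK, mul_add, add_mul, mul_ite, mul_zero,
      ite_mul, zero_mul, Finset.sum_add_distrib, Finset.sum_ite_eq,
      Finset.mem_univ, if_true, rpow_neg_two_mul ht.1] at h
    simp only [modeVal, FrameVal.X, Fin.sum_univ_three] at h ⊢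
    have h0 := hT 0
    have h1 := hT 1
    have h2 := hT 2
    simp only [mul_inv_cancel₀ h0, mul_inv_cancel₀ h1, mul_inv_cancel₀ h2, one_mul]
    linear_combination h

theorem hasDerivWithinAt_rpow_log {t : ℝ} (ht : 0 < t) (q : ℝ) (S : Set ℝ) :
    HasDerivWithinAt (fun s : ℝ => s ^ q) (t⁻¹ * (q * t ^ q)) S t := by
  refine (Real.hasDerivAt_rpow_const (Or.inl ht.ne')).hasDerivWithinAt.congr_deriv ?_
  rw [Real.rpow_sub_one ht.ne']
  field_simp

theorem hasDerivWithinAt_rpow_inv_log {t : ℝ} (ht : 0 < t) (q : ℝ) (S : Set ℝ) :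
    HasDerivWithinAt (fun s : ℝ => (s ^ q)⁻¹) (t⁻¹ * (-q * (t ^ q)⁻¹)) S t := by
  have h := (Real.rpow_pos_of_pos ht q).ne'
  refine ((hasDerivWithinAt_rpow_log ht q S).fun_inv h).congr_deriv ?_
  field_simp

/-- The frame weights turn every equation into one for `t ∂ₜ` with coefficients free of explicit
powers of `t`. For `H`, the weights contribute `-(q i + q j)` and the background second fundamental
form `2 q j`, leaving `q j - q i`, which drops out of the energy identity by symmetry of `H`. -/
theorem IsSolution.frameMode (hu : IsSolution K u) (k : Fin 3 → ℤ) (z : ℂ) :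
    FrameMode K (modeVal K u k z) where
  constr t ht := hu.constraints k z ht
  dt_ξ t ht i := by
    have h := ((hasDerivWithinAt_id t (Ioc 0 1)).fun_mul
      (hasDerivWithinAt_rpow_inv_log ht.1 (K.q i) (Ioc 0 1))).mul_const (freq k i)
    refine h.congr_deriv ?_
    have := ht.1.ne'
    simp only [modeVal, id]
    field_simp
    ring
  dt_H t ht i j := by
    have h := ((hasDerivWithinAt_rpow_inv_log ht.1 (K.q i) (Ioc 0 1)).fun_mul
      (hasDerivWithinAt_rpow_inv_log ht.1 (K.q j) (Ioc 0 1))).fun_mul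
      (hu.dt_h t ht i j _ (isTest_cw k z))
    refine h.congr_deriv ?_
    have := ht.1.ne'
    have hi : t ^ K.q i ≠ 0 := (Real.rpow_pos_of_pos ht.1 _).ne'
    have hj : t ^ K.q j ≠ 0 := (Real.rpow_pos_of_pos ht.1 _).ne'
    simp only [Finset.sum_apply, Pi.smul_apply, Pi.sub_apply, Pi.neg_apply,
      smul_eq_mul, Kasner.bigK, Kasner.g, mul_ite, mul_zero, ite_mul, zero_mul, Finset.sum_ite_eq,
      Finset.sum_ite_eq', Finset.mem_univ, if_true, rpow_two_mul ht.1]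
    simp only [modeVal, FrameVal.rhsH]
    by_cases hij : i = j
    · subst hij
      simp only [if_true]
      field_simp
      ring
    · simp only [if_neg hij]
      field_simp
      ring
  dt_k t ht i j := by
    have h := ((hasDerivWithinAt_rpow_log ht.1 (K.q i) (Ioc 0 1)).fun_mul
      (hasDerivWithinAt_rpow_inv_log ht.1 (K.q j) (Ioc 0 1))).fun_mul
      (hu.dt_κ t ht i j _ (isTest_cw k z))
    refine h.congr_deriv ?_
    have := ht.1.ne'
    have hi : t ^ K.q i ≠ 0 := (Real.rpow_pos_of_pos ht.1 _).ne'
    have hj : t ^ K.q j ≠ 0 := (Real.rpow_pos_of_pos ht.1 _).ne'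
    have h0 : t ^ K.q 0 ≠ 0 := (Real.rpow_pos_of_pos ht.1 _).ne'
    have h1 : t ^ K.q 1 ≠ 0 := (Real.rpow_pos_of_pos ht.1 _).ne'
    have h2 : t ^ K.q 2 ≠ 0 := (Real.rpow_pos_of_pos ht.1 _).ne'
    simp only [Finset.sum_apply, Pi.smul_apply, Pi.sub_apply, Pi.neg_apply, Pi.add_apply,
      smul_eq_mul, Kasner.bigK, Kasner.gi, mul_ite, mul_zero, ite_mul, zero_mul, Finset.sum_ite_eq,
      Finset.mem_univ, if_true, rpow_two_mul ht.1, rpow_neg_two_mul ht.1, dd_dd_toD_cw,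
      ric_cw_of_symm K u k z t (hu.toD_h_symm ht)]
    simp only [modeVal, FrameVal.rhsk, FrameVal.X, FrameVal.Hξ, FrameVal.trH, Fin.sum_univ_three]
    by_cases hij : i = j
    · subst hij
      simp only [if_true]
      field_simp
      ring
    · simp only [if_neg hij]
      field_simp
      ring
  dt_Φ t ht := by
    refine (hu.dt_Φ t ht _ (isTest_cw k z)).congr_deriv ?_
    have := ht.1.ne'
    simp only [modeVal]
    field_simp
  dt_P t ht := by
    refine (hu.wave t ht _ (isTest_cw k z)).congr_deriv ?_
    have := ht.1.ne'
    simp only [Pi.smul_apply, Pi.sub_apply, smul_eq_mul, lap_cw, modeVal, FrameVal.X,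
      rpow_neg_two_mul ht.1, Fin.sum_univ_three]
    field_simp

end

section

/-! ### Norms and energies in Fourier space -/

theorem weakInt_eq_tsum {ι : Type} [Fintype ι] {Q : (ι → ℝ) → ℝ} {w : ι → ℝ} (hw : ∀ c, 0 < w c)
    (hQ : ∀ v, Q v = ∑ c, w c * v c ^ 2) (J : ι → MIdx) {T : ι → T3 → ℝ}
    (hT : ∀ c, MemLp (T c) 2 volume) :
    weakInt Q J T
      = ∑' k, ENNReal.ofReal (∑ c, w c * (symb (J c) k * ‖fc (T c) k‖ ^ 2)) := by
  have h0 : ∀ c k, 0 ≤ symb (J c) k * ‖fc (T c) k‖ ^ 2 := fun c k =>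
    mul_nonneg (symb_nonneg _ _) (sq_nonneg _)
  rw [weakInt_eq hw hQ J hT]
  simp only [sobSq, ← ENNReal.tsum_mul_left]
  rw [← Summable.tsum_finsetSum fun _ _ => ENNReal.summable]
  refine tsum_congr fun k => ?_
  rw [ENNReal.ofReal_sum_of_nonneg fun c _ => mul_nonneg (hw c).le (h0 c k)]
  exact Finset.sum_congr rfl fun c _ => (ENNReal.ofReal_mul (hw c).le).symm

/-- The phases `1` and `I` yield the real part and minus the imaginary part of the coefficient, so
two real modes per frequency carry the whole `L²` norm. -/
theorem norm_fc_sq {f : T3 → ℝ} (hf : MemLp f 2 volume) (k : Fin 3 → ℤ) :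
    ‖fc f k‖ ^ 2 = toD f (cw k 1) ^ 2 + toD f (cw k Complex.I) ^ 2 := by
  have hi := hf.integrable (by norm_num)
  rw [toD_cw hi, toD_cw hi, ← Complex.normSq_eq_norm_sq, Complex.normSq_apply]
  simp
  ring

theorem symb_add (I J : MIdx) (k : Fin 3 → ℤ) : symb (I + J) k = symb I k * symb J k := by
  simp only [symb, Pi.add_apply, pow_add, Finset.prod_mul_distrib]

theorem symb_gradIdx (I : MIdx) (e : Fin 3) (k : Fin 3 → ℤ) :
    symb (gradIdx I e) k = symb I k * freq k e ^ 2 := by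
  rw [gradIdx, symb_add]
  congr 1
  rw [symb, Finset.prod_eq_single e]
  · simp
  · intro j _ hj
    simp [hj]
  · simp

theorem symb_zero (k : Fin 3 → ℤ) : symb 0 k = 1 := by simp [symb]

/-- The sum of a function of the frame components over the cosine and the sine mode. -/
def pair (K : Kasner) (u : LinVars) (k : Fin 3 → ℤ) (t : ℝ) (G : FrameVal → ℝ) : ℝ :=
  G (modeVal K u k 1 t) + G (modeVal K u k Complex.I t)

variable {K : Kasner} {u : LinVars}

theorem IsSolution.tΦt_memLp (hu : IsSolution K u) {t : ℝ} (ht : t ∈ Ioc (0 : ℝ) 1) :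
    MemLp (fun x => t * u.Φt t x) 2 volume := (hu.Φt_memLp t ht).const_mul t

theorem toD_const_mul (c : ℝ) (f ψ : T3 → ℝ) : toD (fun x => c * f x) ψ = c * toD f ψ := by
  rw [toD, toD, ← integral_const_mul]
  simp only [mul_assoc]

theorem intScalar_eq (I : MIdx) {f : T3 → ℝ} (hf : MemLp f 2 volume) :
    intScalar I f = ∑' k, ENNReal.ofReal (symb I k * ‖fc f k‖ ^ 2) := by
  rw [intScalar, weakInt_eq_tsum (w := fun _ => 1) (by simp) (by simp) _ fun _ => hf]
  simp

theorem IsSolution.intScalar_n (hu : IsSolution K u) (I : MIdx) {t : ℝ} (ht : t ∈ Ioc (0 : ℝ) 1) :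
    intScalar I (u.n t) = ∑' k, ENNReal.ofReal (symb I k * pair K u k t fun v => v.n ^ 2) := by
  rw [intScalar_eq I (hu.n_memLp t ht)]
  simp only [norm_fc_sq (hu.n_memLp t ht), pair, modeVal]

theorem IsSolution.intScalar_ψ (hu : IsSolution K u) (I : MIdx) {t : ℝ} (ht : t ∈ Ioc (0 : ℝ) 1) :
    intScalar I (fun x => t * u.Φt t x)
      = ∑' k, ENNReal.ofReal (symb I k * pair K u k t fun v => v.ψ ^ 2) := by
  rw [intScalar_eq I (hu.tΦt_memLp ht)]
  simp only [norm_fc_sq (hu.tΦt_memLp ht), pair, modeVal, toD_const_mul]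

theorem intGradScalar_eq (I : MIdx) {t : ℝ} (ht : 0 < t) {f : T3 → ℝ} (hf : MemLp f 2 volume) :
    intGradScalar K I t f = ∑' k, ENNReal.ofReal (symb I k *
      ((∑ e, (t * (t ^ K.q e)⁻¹ * freq k e) ^ 2) * ‖fc f k‖ ^ 2)) := by
  have hT : ∀ i, 0 < t ^ K.q i := fun i => Real.rpow_pos_of_pos ht _
  rw [intGradScalar, weakInt_eq_tsum (w := fun e => (t * (t ^ K.q e)⁻¹) ^ 2)
    (fun e => by have := hT e; positivity) ?_ _ fun _ => hf]
  · refine tsum_congr fun k => congrArg _ ?_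
    rw [Finset.sum_mul, Finset.mul_sum]
    refine Finset.sum_congr rfl fun e _ => ?_
    rw [symb_gradIdx]
    ring
  · intro v
    simp only [Kasner.normSq01, Kasner.gi, ite_mul, zero_mul, Finset.sum_ite_eq, Finset.mem_univ,
      if_true, rpow_neg_two_mul ht]
    exact Finset.sum_congr rfl fun e _ => by ring

theorem IsSolution.intGradScalar_n (hu : IsSolution K u) (I : MIdx) {t : ℝ}
    (ht : t ∈ Ioc (0 : ℝ) 1) : intGradScalar K I t (u.n t)
      = ∑' k, ENNReal.ofReal (symb I k * pair K u k t fun v => v.X * v.n ^ 2) := by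
  rw [intGradScalar_eq I ht.1 (hu.n_memLp t ht)]
  simp only [norm_fc_sq (hu.n_memLp t ht), pair, modeVal, FrameVal.X, mul_add]

theorem IsSolution.intGradScalar_Φ (hu : IsSolution K u) (I : MIdx) {t : ℝ}
    (ht : t ∈ Ioc (0 : ℝ) 1) : intGradScalar K I t (u.Φ t)
      = ∑' k, ENNReal.ofReal (symb I k * pair K u k t fun v => v.X * v.Φ ^ 2) := by
  rw [intGradScalar_eq I ht.1 (hu.Φ_memLp t ht)]
  simp only [norm_fc_sq (hu.Φ_memLp t ht), pair, modeVal, FrameVal.X, mul_add]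

theorem IsSolution.intGradH_eq (hu : IsSolution K u) (I : MIdx) {t : ℝ}
    (ht : t ∈ Ioc (0 : ℝ) 1) : intGradH K u I t
      = ∑' k, ENNReal.ofReal (symb I k * pair K u k t fun v => v.X * v.HH) := by
  have hT : ∀ i, 0 < t ^ K.q i := fun i => Real.rpow_pos_of_pos ht.1 _
  have ht0 := ht.1
  rw [intGradH, weakInt_eq_tsum (w := fun c : Fin 3 × Fin 3 × Fin 3 =>
      (t * (t ^ K.q c.1)⁻¹ * ((t ^ K.q c.2.1)⁻¹ * (t ^ K.q c.2.2)⁻¹)) ^ 2)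
    (fun c => by have := hT c.1; have := hT c.2.1; have := hT c.2.2; positivity) ?_ _
    fun c => hu.h_memLp t ht _ _]
  · refine tsum_congr fun k => congrArg _ ?_
    simp only [Fintype.sum_prod_type, norm_fc_sq (hu.h_memLp t ht _ _), pair, modeVal, FrameVal.X,
      FrameVal.HH, ← mul_add, ← Finset.sum_add_distrib]
    rw [Finset.sum_mul, Finset.mul_sum]
    refine Finset.sum_congr rfl fun e _ => ?_
    rw [Finset.mul_sum, Finset.mul_sum]
    refine Finset.sum_congr rfl fun i _ => ?_
    rw [Finset.mul_sum, Finset.mul_sum]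
    refine Finset.sum_congr rfl fun j _ => ?_
    rw [symb_gradIdx]
    ring
  · intro v
    simp only [Kasner.normSq03, Kasner.gi, Fintype.sum_prod_type, rpow_neg_two_mul ht.1]
    refine Finset.sum_congr rfl fun e _ => ?_
    rw [Finset.sum_eq_single e (fun f _ hf => by simp [hf.symm]) (by simp)]
    refine Finset.sum_congr rfl fun a _ => ?_
    rw [Finset.sum_eq_single a (fun f _ hf => by simp [hf.symm]) (by simp)]
    refine Finset.sum_congr rfl fun i _ => ?_
    rw [Finset.sum_eq_single i (fun f _ hf => by simp [hf.symm]) (by simp)]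
    simp only [if_true]
    ring

theorem IsSolution.weakInt_κ (hu : IsSolution K u) (I : MIdx) {t : ℝ}
    (ht : t ∈ Ioc (0 : ℝ) 1) :
    weakInt (K.normSq11 t) (fun _ => I) (fun c : Fin 3 × Fin 3 => u.κ t c.1 c.2)
      = ∑' k, ENNReal.ofReal (symb I k * pair K u k t fun v => v.kk) := by
  have hT : ∀ i, 0 < t ^ K.q i := fun i => Real.rpow_pos_of_pos ht.1 _
  rw [weakInt_eq_tsum (w := fun c : Fin 3 × Fin 3 => (t ^ K.q c.1 * (t ^ K.q c.2)⁻¹) ^ 2)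
    (fun c => by have := hT c.1; have := hT c.2; positivity) ?_ _
    fun c => hu.κ_memLp t ht _ _]
  · refine tsum_congr fun k => congrArg _ ?_
    simp only [Fintype.sum_prod_type, norm_fc_sq (hu.κ_memLp t ht _ _), pair, modeVal, FrameVal.kk,
      ← Finset.sum_add_distrib]
    simp only [Finset.mul_sum]
    exact Finset.sum_congr rfl fun e _ => Finset.sum_congr rfl fun i _ => by ring
  · intro v
    simp only [Kasner.normSq11, Kasner.gi, Kasner.g, Fintype.sum_prod_type,
      rpow_neg_two_mul ht.1, rpow_two_mul ht.1]
    refine Finset.sum_congr rfl fun a _ => ?_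
    rw [Finset.sum_eq_single a (fun f _ hf => by simp [hf.symm]) (by simp)]
    refine Finset.sum_congr rfl fun i _ => ?_
    rw [Finset.sum_eq_single i (fun f _ hf => by simp [hf.symm]) (by simp)]
    simp only [if_true]
    ring

theorem ofReal_mul_tsum {ι : Type*} {c : ℝ} (hc : 0 ≤ c) (f : ι → ℝ) :
    ENNReal.ofReal c * ∑' k, ENNReal.ofReal (f k) = ∑' k, ENNReal.ofReal (c * f k) := by
  rw [← ENNReal.tsum_mul_left]
  simp only [ENNReal.ofReal_mul hc]

theorem tsum_ofReal_add {ι : Type*} {f g : ι → ℝ} (hf : ∀ k, 0 ≤ f k) (hg : ∀ k, 0 ≤ g k) :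
    ∑' k, ENNReal.ofReal (f k) + ∑' k, ENNReal.ofReal (g k)
      = ∑' k, ENNReal.ofReal (f k + g k) := by
  rw [← ENNReal.tsum_add]
  exact tsum_congr fun k => (ENNReal.ofReal_add (hf k) (hg k)).symm

theorem pair_nonneg (k : Fin 3 → ℤ) (t : ℝ) {G : FrameVal → ℝ} (hG : ∀ v, 0 ≤ G v) :
    0 ≤ pair K u k t G := add_nonneg (hG _) (hG _)

theorem symb_mul_pair_nonneg (I : MIdx) (k : Fin 3 → ℤ) (t : ℝ) {G : FrameVal → ℝ}
    (hG : ∀ v, 0 ≤ G v) : 0 ≤ symb I k * pair K u k t G :=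
  mul_nonneg (symb_nonneg I k) (pair_nonneg k t hG)

theorem IsSolution.energySq_eq (hu : IsSolution K u) (I : MIdx) {t : ℝ}
    (ht : t ∈ Ioc (0 : ℝ) 1) : energySq K u I t 1
      = ∑' k, ENNReal.ofReal (symb I k * pair K u k t FrameVal.energy) := by
  have h1 : ∀ k, 0 ≤ symb I k * pair K u k t fun v => v.kk :=
    fun k => symb_mul_pair_nonneg I k t FrameVal.kk_nonneg
  have h2 : ∀ k, 0 ≤ symb I k * pair K u k t fun v => v.X * v.HH :=
    fun k => symb_mul_pair_nonneg I k t fun v => mul_nonneg v.X_nonneg v.HH_nonneg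
  have h3 : ∀ k, 0 ≤ symb I k * pair K u k t fun v => v.ψ ^ 2 :=
    fun k => symb_mul_pair_nonneg I k t fun v => sq_nonneg _
  have h4 : ∀ k, 0 ≤ symb I k * pair K u k t fun v => v.X * v.Φ ^ 2 :=
    fun k => symb_mul_pair_nonneg I k t fun v => mul_nonneg v.X_nonneg (sq_nonneg _)
  have h5 : ∀ k, 0 ≤ symb I k * pair K u k t fun v => v.X * v.n ^ 2 :=
    fun k => symb_mul_pair_nonneg I k t fun v => mul_nonneg v.X_nonneg (sq_nonneg _)
  have h6 : ∀ k, 0 ≤ symb I k * pair K u k t fun v => v.n ^ 2 :=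
    fun k => symb_mul_pair_nonneg I k t fun v => sq_nonneg _
  have h2' := fun k => mul_nonneg (show (0 : ℝ) ≤ 1 / 4 by norm_num) (h2 k)
  have h12 := fun k => add_nonneg (h1 k) (h2' k)
  have h34 := fun k => add_nonneg (h3 k) (h4 k)
  rw [energySq, energyMetricSq, energyScalarSq, hu.weakInt_κ I ht, hu.intGradH_eq I ht,
    hu.intScalar_ψ I ht, hu.intGradScalar_Φ I ht, hu.intGradScalar_n I ht, hu.intScalar_n I ht,
    ENNReal.ofReal_one, one_mul, ofReal_mul_tsum (by norm_num), tsum_ofReal_add h1 h2',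
    tsum_ofReal_add h3 h4, tsum_ofReal_add h12 h34,
    tsum_ofReal_add (fun k => add_nonneg (h12 k) (h34 k)) h5,
    tsum_ofReal_add (fun k => add_nonneg (add_nonneg (h12 k) (h34 k)) (h5 k)) h6]
  refine tsum_congr fun k => congrArg _ ?_
  simp only [pair, FrameVal.energy]
  ring

end

section

/-! ### The approximate monotonicity of the energy -/

theorem intervalIntegrable_inv_mul {f : ℝ → ℝ} (hf : ContinuousOn f (Ioc 0 1)) {t : ℝ}
    (ht : t ∈ Ioc (0 : ℝ) 1) : IntervalIntegrable (fun s => s⁻¹ * f s) volume t 1 := by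
  have hsub : Icc t 1 ⊆ Ioc 0 1 := fun s hs => ⟨ht.1.trans_le hs.1, hs.2⟩
  apply ContinuousOn.intervalIntegrable_of_Icc ht.2
  exact (continuousOn_inv₀.mono fun s hs => (hsub hs).1.ne').mul (hf.mono hsub)

/-- `∫_t^1 s⁻¹ f(s) ds` for a real function `f`. -/
def logIntegral (f : ℝ → ℝ) (t : ℝ) : ℝ := ∫ s in t..1, s⁻¹ * f s

theorem logIntegral_add {f g : ℝ → ℝ} (hf : ContinuousOn f (Ioc 0 1))
    (hg : ContinuousOn g (Ioc 0 1)) {t : ℝ} (ht : t ∈ Ioc (0 : ℝ) 1) :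
    logIntegral (fun s => f s + g s) t = logIntegral f t + logIntegral g t := by
  rw [logIntegral, logIntegral, logIntegral, ← intervalIntegral.integral_add
    (intervalIntegrable_inv_mul hf ht) (intervalIntegrable_inv_mul hg ht)]
  simp only [mul_add]

theorem logIntegral_const_mul (c : ℝ) (f : ℝ → ℝ) (t : ℝ) :
    logIntegral (fun s => c * f s) t = c * logIntegral f t := by
  rw [logIntegral, logIntegral, ← intervalIntegral.integral_const_mul]
  simp only [mul_left_comm]

theorem logIntegral_nonneg {f : ℝ → ℝ} (hf : ∀ s, 0 ≤ f s) {t : ℝ} (ht : t ∈ Ioc (0 : ℝ) 1) :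
    0 ≤ logIntegral f t :=
  intervalIntegral.integral_nonneg ht.2 fun s hs =>
    mul_nonneg (inv_nonneg.2 (ht.1.le.trans hs.1)) (hf s)

/-- Tonelli's theorem: the terms are nonnegative, and continuity in time of each mode gives
measurability. Inequalities for single modes can then be summed without any convergence assumption.
-/
theorem logInt_tsum {ι : Type*} [Countable ι] {F : ℝ → ℝ≥0∞} {f : ι → ℝ → ℝ}
    (hc : ∀ k, ContinuousOn (f k) (Ioc 0 1)) (h0 : ∀ k s, 0 ≤ f k s) {t : ℝ}
    (ht : t ∈ Ioc (0 : ℝ) 1) (hF : ∀ s ∈ Ioc (0 : ℝ) 1, F s = ∑' k, ENNReal.ofReal (f k s)) :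
    logInt F t = ∑' k, ENNReal.ofReal (logIntegral (f k) t) := by
  have hsub : Ioc t 1 ⊆ Ioc 0 1 := Ioc_subset_Ioc_left ht.1.le
  have hint := fun k => (intervalIntegrable_iff_integrableOn_Ioc_of_le ht.2).1
    (intervalIntegrable_inv_mul (hc k) ht)
  have h1 : logInt F t = ∫⁻ s in Ioc t 1, ∑' k, ENNReal.ofReal (s⁻¹ * f k s) := by
    refine setLIntegral_congr_fun measurableSet_Ioc fun s hs => ?_
    rw [hF s (hsub hs), ofReal_mul_tsum (inv_nonneg.2 (hsub hs).1.le)]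
  rw [h1, lintegral_tsum fun k => (hint k).aestronglyMeasurable.aemeasurable.ennreal_ofReal]
  refine tsum_congr fun k => ?_
  rw [logIntegral, intervalIntegral.integral_of_le ht.2, ofReal_integral_eq_lintegral_ofReal (hint k)]
  refine (ae_restrict_iff' measurableSet_Ioc).2 (Filter.Eventually.of_forall fun s hs => ?_)
  exact mul_nonneg (inv_nonneg.2 (hsub hs).1.le) (h0 k s)

variable {K : Kasner} {v : ℝ → FrameVal}

/-- Multiplying the integrated monotonicity by `300` controls the energy at time `t`. The
dissipation then has coefficient `50`, more than needed, and the constants are `300 · 12000` for the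
data and `300 · 40000` for the shear error. -/
theorem FrameMode.energy_add_le (hv : FrameMode K v) (hσ1 : K.sigma ≤ 1) {t : ℝ}
    (ht : t ∈ Ioc (0 : ℝ) 1) :
    (v t).energy + 1 / 6 * logIntegral (fun s => (v s).X * (v s).HH) t
        + 1 / 6 * logIntegral (fun s => (v s).X * (v s).Φ ^ 2) t
        + 1 / 6 * logIntegral (fun s => (v s).X * (v s).n ^ 2) t
        + 1 / 2 * logIntegral (fun s => (v s).n ^ 2) t
      ≤ 3600000 * (v 1).energy + 12000006 * K.sigma * logIntegral (fun s => (v s).energy) t := by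
  obtain ⟨hX, hH, hk, hΦ, hψ⟩ := hv.continuousOn_parts
  have hn := hv.continuousOn_n
  have hE := hv.continuousOn_energy
  have hD := hv.continuousOn_diss
  have c1 : ContinuousOn (fun s => (v s).X * (v s).HH) (Ioc 0 1) := hX.mul hH
  have c2 : ContinuousOn (fun s => (v s).X * (v s).Φ ^ 2) (Ioc 0 1) := hX.mul (hΦ.pow 2)
  have c3 : ContinuousOn (fun s => (v s).X * (v s).n ^ 2) (Ioc 0 1) := hX.mul (hn.pow 2)
  have c4 : ContinuousOn (fun s => (v s).n ^ 2) (Ioc 0 1) := hn.pow 2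
  have c12 : ContinuousOn (fun s => (v s).X * (v s).HH + (v s).X * (v s).Φ ^ 2) (Ioc 0 1) :=
    c1.add c2
  have c123 : ContinuousOn (fun s => (v s).X * (v s).HH + (v s).X * (v s).Φ ^ 2
      + (v s).X * (v s).n ^ 2) (Ioc 0 1) := c12.add c3
  have h := hv.integral_diss_le ht
  have e1 : ∫ s in t..1, s⁻¹ * (1 / 6 * (v s).diss - 40000 * K.sigma * (v s).energy)
      = 1 / 6 * logIntegral (fun s => (v s).diss) t
        + -(40000 * K.sigma) * logIntegral (fun s => (v s).energy) t := by
    rw [← logIntegral_const_mul, ← logIntegral_const_mul,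
      ← logIntegral_add (f := fun s => 1 / 6 * (v s).diss)
        (g := fun s => -(40000 * K.sigma) * (v s).energy)
        (continuousOn_const.mul hD) (continuousOn_const.mul hE) ht, logIntegral]
    simp only [neg_mul, sub_eq_add_neg]
  have e2 : logIntegral (fun s => (v s).diss) t = logIntegral (fun s => (v s).X * (v s).HH) t
      + logIntegral (fun s => (v s).X * (v s).Φ ^ 2) t
      + logIntegral (fun s => (v s).X * (v s).n ^ 2) t + logIntegral (fun s => (v s).n ^ 2) t := by
    rw [← logIntegral_add c1 c2 ht, ← logIntegral_add c12 c3 ht, ← logIntegral_add c123 c4 ht]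
    rfl
  rw [e1, e2] at h
  have p1 := logIntegral_nonneg (fun s => mul_nonneg (v s).X_nonneg (v s).HH_nonneg) ht
  have p2 := logIntegral_nonneg (fun s => mul_nonneg (v s).X_nonneg (sq_nonneg (v s).Φ)) ht
  have p3 := logIntegral_nonneg (fun s => mul_nonneg (v s).X_nonneg (sq_nonneg (v s).n)) ht
  have p4 := logIntegral_nonneg (fun s => sq_nonneg (v s).n) ht
  have p5 := mul_nonneg K.sigma_nonneg (logIntegral_nonneg (fun s => (v s).energy_nonneg) ht)
  have q1 := FrameVal.energy_le (hv.constr t ht) hσ1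
  have q2 := (v 1).modEnergy_le_energy K
  linarith

variable {u : LinVars}

theorem IsSolution.continuousOn_pair (hu : IsSolution K u) (k : Fin 3 → ℤ) {G : FrameVal → ℝ}
    (hG : ∀ v : ℝ → FrameVal, FrameMode K v → ContinuousOn (fun s => G (v s)) (Ioc 0 1)) :
    ContinuousOn (fun s => pair K u k s G) (Ioc 0 1) :=
  (hG _ (hu.frameMode k 1)).add (hG _ (hu.frameMode k Complex.I))

theorem IsSolution.logIntegral_pair (hu : IsSolution K u) (k : Fin 3 → ℤ) {G : FrameVal → ℝ}
    (hG : ∀ v : ℝ → FrameVal, FrameMode K v → ContinuousOn (fun s => G (v s)) (Ioc 0 1)) {t : ℝ}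
    (ht : t ∈ Ioc (0 : ℝ) 1) :
    logIntegral (fun s => pair K u k s G) t = logIntegral (fun s => G (modeVal K u k 1 s)) t
      + logIntegral (fun s => G (modeVal K u k Complex.I s)) t :=
  logIntegral_add (hG _ (hu.frameMode k 1)) (hG _ (hu.frameMode k Complex.I)) ht

theorem IsSolution.energySq_add_le (hu : IsSolution K u) (hσ1 : K.sigma ≤ 1) {t : ℝ}
    (ht : t ∈ Ioc (0 : ℝ) 1) :
    energySq K u 0 t 1
        + ENNReal.ofReal (1 / 6 * 1) * logInt (fun s => intGradH K u 0 s) t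
        + ENNReal.ofReal (1 / 6) * logInt (fun s => intGradScalar K 0 s (u.Φ s)) t
        + ENNReal.ofReal (1 / 6) * logInt (fun s => intGradScalar K 0 s (u.n s)) t
        + ENNReal.ofReal (1 / 2) * logInt (fun s => intScalar 0 (u.n s)) t
      ≤ ENNReal.ofReal 3600000 * energySq K u 0 1 1
        + ENNReal.ofReal (12000006 * K.sigma) * logInt (fun s => energySq K u 0 s 1) t := by
  have h1 : (1 : ℝ) ∈ Ioc (0 : ℝ) 1 := right_mem_Ioc.2 one_pos
  have g1 : ∀ v : ℝ → FrameVal, FrameMode K v →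
      ContinuousOn (fun s => (v s).X * (v s).HH) (Ioc 0 1) := fun v hv =>
    hv.continuousOn_parts.1.mul hv.continuousOn_parts.2.1
  have g2 : ∀ v : ℝ → FrameVal, FrameMode K v →
      ContinuousOn (fun s => (v s).X * (v s).Φ ^ 2) (Ioc 0 1) := fun v hv =>
    hv.continuousOn_parts.1.mul (hv.continuousOn_parts.2.2.2.1.pow 2)
  have g3 : ∀ v : ℝ → FrameVal, FrameMode K v →
      ContinuousOn (fun s => (v s).X * (v s).n ^ 2) (Ioc 0 1) := fun v hv =>
    hv.continuousOn_parts.1.mul (hv.continuousOn_n.pow 2)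
  have g4 : ∀ v : ℝ → FrameVal, FrameMode K v →
      ContinuousOn (fun s => (v s).n ^ 2) (Ioc 0 1) := fun v hv => hv.continuousOn_n.pow 2
  have g5 : ∀ v : ℝ → FrameVal, FrameMode K v →
      ContinuousOn (fun s => (v s).energy) (Ioc 0 1) := fun v hv => hv.continuousOn_energy
  have n1 : ∀ v : FrameVal, 0 ≤ v.X * v.HH := fun v => mul_nonneg v.X_nonneg v.HH_nonneg
  have n2 : ∀ v : FrameVal, 0 ≤ v.X * v.Φ ^ 2 := fun v => mul_nonneg v.X_nonneg (sq_nonneg _)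
  have n3 : ∀ v : FrameVal, 0 ≤ v.X * v.n ^ 2 := fun v => mul_nonneg v.X_nonneg (sq_nonneg _)
  have n4 : ∀ v : FrameVal, 0 ≤ v.n ^ 2 := fun v => sq_nonneg _
  have n5 : ∀ v : FrameVal, 0 ≤ v.energy := fun v => v.energy_nonneg
  have l1 := logInt_tsum (fun k => hu.continuousOn_pair k g1) (fun k s => pair_nonneg k s n1) ht
    (F := fun s => intGradH K u 0 s) fun s hs => by
      rw [hu.intGradH_eq 0 hs]; simp only [symb_zero, one_mul]
  have l2 := logInt_tsum (fun k => hu.continuousOn_pair k g2) (fun k s => pair_nonneg k s n2) ht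
    (F := fun s => intGradScalar K 0 s (u.Φ s)) fun s hs => by
      rw [hu.intGradScalar_Φ 0 hs]; simp only [symb_zero, one_mul]
  have l3 := logInt_tsum (fun k => hu.continuousOn_pair k g3) (fun k s => pair_nonneg k s n3) ht
    (F := fun s => intGradScalar K 0 s (u.n s)) fun s hs => by
      rw [hu.intGradScalar_n 0 hs]; simp only [symb_zero, one_mul]
  have l4 := logInt_tsum (fun k => hu.continuousOn_pair k g4) (fun k s => pair_nonneg k s n4) ht
    (F := fun s => intScalar 0 (u.n s)) fun s hs => by
      rw [hu.intScalar_n 0 hs]; simp only [symb_zero, one_mul]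
  have l5 := logInt_tsum (fun k => hu.continuousOn_pair k g5) (fun k s => pair_nonneg k s n5) ht
    (F := fun s => energySq K u 0 s 1) fun s hs => by
      rw [hu.energySq_eq 0 hs]; simp only [symb_zero, one_mul]
  have p0 : ∀ k, 0 ≤ pair K u k t FrameVal.energy := fun k => pair_nonneg k t n5
  have p1 := fun k => mul_nonneg (show (0 : ℝ) ≤ 1 / 6 by norm_num)
    (logIntegral_nonneg (fun s => pair_nonneg (K := K) (u := u) k s n1) ht)
  have p2 := fun k => mul_nonneg (show (0 : ℝ) ≤ 1 / 6 by norm_num)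
    (logIntegral_nonneg (fun s => pair_nonneg (K := K) (u := u) k s n2) ht)
  have p3 := fun k => mul_nonneg (show (0 : ℝ) ≤ 1 / 6 by norm_num)
    (logIntegral_nonneg (fun s => pair_nonneg (K := K) (u := u) k s n3) ht)
  have p4 := fun k => mul_nonneg (show (0 : ℝ) ≤ 1 / 2 by norm_num)
    (logIntegral_nonneg (fun s => pair_nonneg (K := K) (u := u) k s n4) ht)
  have hσ : 0 ≤ 12000006 * K.sigma := mul_nonneg (by norm_num) K.sigma_nonneg
  have p5 := fun k => mul_nonneg hσ
    (logIntegral_nonneg (fun s => pair_nonneg (K := K) (u := u) k s n5) ht)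
  have p6 : ∀ k, 0 ≤ 3600000 * pair K u k 1 FrameVal.energy :=
    fun k => mul_nonneg (by norm_num) (pair_nonneg k 1 n5)
  rw [l1, l2, l3, l4, l5, hu.energySq_eq 0 ht, hu.energySq_eq 0 h1, mul_one]
  simp only [symb_zero, one_mul]
  rw [ofReal_mul_tsum (by norm_num), ofReal_mul_tsum (by norm_num), ofReal_mul_tsum (by norm_num),
    ofReal_mul_tsum (by norm_num), ofReal_mul_tsum (by norm_num), ofReal_mul_tsum hσ,
    tsum_ofReal_add p0 p1, tsum_ofReal_add (fun k => add_nonneg (p0 k) (p1 k)) p2,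
    tsum_ofReal_add (fun k => add_nonneg (add_nonneg (p0 k) (p1 k)) (p2 k)) p3,
    tsum_ofReal_add (fun k => add_nonneg (add_nonneg (add_nonneg (p0 k) (p1 k)) (p2 k)) (p3 k)) p4,
    tsum_ofReal_add p6 p5]
  refine ENNReal.tsum_le_tsum fun k => ENNReal.ofReal_le_ofReal ?_
  have m1 := (hu.frameMode k 1).energy_add_le hσ1 ht
  have m2 := (hu.frameMode k Complex.I).energy_add_le hσ1 ht
  rw [hu.logIntegral_pair k g1 ht, hu.logIntegral_pair k g2 ht, hu.logIntegral_pair k g3 ht,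
    hu.logIntegral_pair k g4 ht, hu.logIntegral_pair k g5 ht]
  simp only [pair]
  linarith

/-! ### Propagation of the energies of every order -/

/-- The square of the modified energy of the `∂_I`-differentiated variables. -/
def modSq (K : Kasner) (u : LinVars) (I : MIdx) (t : ℝ) : ℝ≥0∞ :=
  ∑' k, ENNReal.ofReal (symb I k * pair K u k t fun v => v.modEnergy K.A)

theorem tsum_pair_le {I : MIdx} {s t : ℝ} {G H : FrameVal → ℝ} {c : ℝ} (hc : 0 ≤ c)
    (h : ∀ k, pair K u k s G ≤ c * pair K u k t H) :
    ∑' k, ENNReal.ofReal (symb I k * pair K u k s G)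
      ≤ ENNReal.ofReal c * ∑' k, ENNReal.ofReal (symb I k * pair K u k t H) := by
  rw [ofReal_mul_tsum hc]
  refine ENNReal.tsum_le_tsum fun k => ENNReal.ofReal_le_ofReal ?_
  have := mul_le_mul_of_nonneg_left (h k) (symb_nonneg I k)
  linarith

theorem IsSolution.modSq_le (hu : IsSolution K u) (hσ1 : K.sigma ≤ 1) (I : MIdx) {t : ℝ}
    (ht : t ∈ Ioc (0 : ℝ) 1) :
    modSq K u I t ≤ ENNReal.ofReal (t ^ (-(12000000 * K.sigma))) * modSq K u I 1 := by
  refine tsum_pair_le (Real.rpow_nonneg ht.1.le _) fun k => ?_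
  have h1 := (hu.frameMode k 1).modEnergy_le_rpow hσ1 ht
  have h2 := (hu.frameMode k Complex.I).modEnergy_le_rpow hσ1 ht
  simp only [pair]
  linarith

theorem IsSolution.energySq_le_modSq (hu : IsSolution K u) (hσ1 : K.sigma ≤ 1) (I : MIdx) {t : ℝ}
    (ht : t ∈ Ioc (0 : ℝ) 1) : energySq K u I t 1 ≤ ENNReal.ofReal 300 * modSq K u I t := by
  rw [hu.energySq_eq I ht]
  refine tsum_pair_le (by norm_num) fun k => ?_
  have h1 := FrameVal.energy_le (hu.constraints k 1 ht) hσ1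
  have h2 := FrameVal.energy_le (hu.constraints k Complex.I ht) hσ1
  simp only [pair]
  linarith

theorem IsSolution.modSq_le_energySq (hu : IsSolution K u) (I : MIdx) {t : ℝ}
    (ht : t ∈ Ioc (0 : ℝ) 1) : modSq K u I t ≤ ENNReal.ofReal 12000 * energySq K u I t 1 := by
  rw [hu.energySq_eq I ht]
  refine tsum_pair_le (by norm_num) fun k => ?_
  have h1 := (modeVal K u k 1 t).modEnergy_le_energy K
  have h2 := (modeVal K u k Complex.I t).modEnergy_le_energy K
  simp only [pair]
  linarith

theorem IsSolution.energySq_le (hu : IsSolution K u) (hσ1 : K.sigma ≤ 1) (I : MIdx) {t : ℝ}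
    (ht : t ∈ Ioc (0 : ℝ) 1) : energySq K u I t 1
      ≤ ENNReal.ofReal (3600000 * t ^ (-(12000000 * K.sigma))) * energySq K u I 1 1 := by
  have h1 : (1 : ℝ) ∈ Ioc (0 : ℝ) 1 := right_mem_Ioc.2 one_pos
  calc energySq K u I t 1 ≤ ENNReal.ofReal 300 * (ENNReal.ofReal (t ^ (-(12000000 * K.sigma))) *
        (ENNReal.ofReal 12000 * energySq K u I 1 1)) := by
        refine (hu.energySq_le_modSq hσ1 I ht).trans ?_
        gcongr
        refine (hu.modSq_le hσ1 I ht).trans ?_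
        gcongr
        exact hu.modSq_le_energySq I h1
    _ = _ := by
        have h0 := Real.rpow_nonneg ht.1.le (-(12000000 * K.sigma))
        rw [← mul_assoc, ← mul_assoc, ← ENNReal.ofReal_mul (by norm_num),
          ← ENNReal.ofReal_mul (by positivity)]
        congr 2
        ring

theorem IsSolution.energyUpTo_le (hu : IsSolution K u) (hσ1 : K.sigma ≤ 1) (N : ℕ) {t : ℝ}
    (ht : t ∈ Ioc (0 : ℝ) 1) : energyUpTo K u 1 N t
      ≤ ENNReal.ofReal 3600000 * energyUpTo K u 1 N 1
        * ENNReal.ofReal (t ^ (-(12000006 * K.sigma))) := by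
  have hsum : ∑ I ∈ multiIdx N, energySq K u I t 1
      ≤ ENNReal.ofReal (3600000 * t ^ (-(12000000 * K.sigma))) *
        ∑ I ∈ multiIdx N, energySq K u I 1 1 := by
    rw [Finset.mul_sum]
    exact Finset.sum_le_sum fun I _ => hu.energySq_le hσ1 I ht
  have hσ := K.sigma_nonneg
  have hge : 1 ≤ t ^ (-(12000006 * K.sigma)) :=
    Real.one_le_rpow_of_pos_of_le_one_of_nonpos ht.1 ht.2 (by linarith)
  -- The square root is taken crudely: both factors on the right are at least one, so squaring the
  -- right-hand constant dominates the constant of the squared energies.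
  have hc : ENNReal.ofReal (3600000 * t ^ (-(12000000 * K.sigma)))
      ≤ ENNReal.ofReal (3600000 * t ^ (-(12000006 * K.sigma))) ^ (2 : ℝ) := by
    rw [ENNReal.rpow_two, ← ENNReal.ofReal_pow (by positivity)]
    apply ENNReal.ofReal_le_ofReal
    have h2 : t ^ (-(12000000 * K.sigma)) ≤ t ^ (-(12000006 * K.sigma)) :=
      Real.rpow_le_rpow_of_exponent_ge ht.1 ht.2 (by linarith)
    nlinarith
  calc energyUpTo K u 1 N t
      ≤ (ENNReal.ofReal (3600000 * t ^ (-(12000006 * K.sigma))) ^ (2 : ℝ) *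
        ∑ I ∈ multiIdx N, energySq K u I 1 1) ^ (1 / 2 : ℝ) := by
        refine ENNReal.rpow_le_rpow (hsum.trans ?_) (by norm_num)
        gcongr
    _ = _ := by
        rw [ENNReal.mul_rpow_of_nonneg _ _ (by norm_num), ← ENNReal.rpow_mul,
          ENNReal.ofReal_mul (by norm_num)]
        norm_num [energyUpTo]
        ring

end

section

/-! ### Sobolev norms -/

/-- The coordinate components of a Fourier mode of the linearized variables. -/
def rawVal (u : LinVars) (k : Fin 3 → ℤ) (z : ℂ) (t : ℝ) : FrameVal where
  ξ i := freq k i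
  H i j := toD (u.h t i j) (cw k z)
  k i j := toD (u.κ t i j) (cw k z)
  Φ := toD (u.Φ t) (cw k z)
  ψ := t * toD (u.Φt t) (cw k z)
  n := toD (u.n t) (cw k z)

/-- The sum of a function of the coordinate components over the cosine and the sine mode. -/
def rawPair (u : LinVars) (k : Fin 3 → ℤ) (t : ℝ) (G : FrameVal → ℝ) : ℝ :=
  G (rawVal u k 1 t) + G (rawVal u k Complex.I t)

theorem modeVal_one (K : Kasner) (u : LinVars) (k : Fin 3 → ℤ) (z : ℂ) :
    modeVal K u k z 1 = rawVal u k z 1 := by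
  simp [modeVal, rawVal]

variable {K : Kasner} {u : LinVars}

theorem weakInt_frameSq {ι : Type} [Fintype ι] (J : ι → MIdx) {T : ι → T3 → ℝ}
    (hT : ∀ c, MemLp (T c) 2 volume) :
    weakInt frameSq J T = ∑' k, ENNReal.ofReal (∑ c, symb (J c) k * ‖fc (T c) k‖ ^ 2) := by
  rw [weakInt_eq_tsum (w := fun _ => 1) (by simp) (by simp [frameSq]) J hT]
  simp only [one_mul]

theorem IsSolution.sob_κ (hu : IsSolution K u) (I : MIdx) {t : ℝ} (ht : t ∈ Ioc (0 : ℝ) 1) :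
    weakInt frameSq (fun _ => I) (fun c : Fin 3 × Fin 3 => u.κ t c.1 c.2)
      = ∑' k, ENNReal.ofReal (symb I k * rawPair u k t fun v => v.kk) := by
  rw [weakInt_frameSq _ fun c => hu.κ_memLp t ht _ _]
  refine tsum_congr fun k => congrArg _ ?_
  rw [← Finset.mul_sum]
  congr 1
  simp only [Fintype.sum_prod_type, norm_fc_sq (hu.κ_memLp t ht _ _), rawPair, rawVal, FrameVal.kk,
    Finset.sum_add_distrib]

theorem IsSolution.sob_h (hu : IsSolution K u) (I : MIdx) {t : ℝ} (ht : t ∈ Ioc (0 : ℝ) 1) :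
    weakInt frameSq (fun c : Fin 3 × Fin 3 × Fin 3 => gradIdx I c.1)
        (fun c => (fun c : Fin 3 × Fin 3 => u.h t c.1 c.2) c.2)
      = ∑' k, ENNReal.ofReal (symb I k * rawPair u k t fun v => v.X * v.HH) := by
  rw [weakInt_frameSq _ fun c => hu.h_memLp t ht _ _]
  refine tsum_congr fun k => congrArg _ ?_
  simp only [Fintype.sum_prod_type, norm_fc_sq (hu.h_memLp t ht _ _), rawPair, rawVal, FrameVal.X,
    FrameVal.HH, ← mul_add, ← Finset.sum_add_distrib, symb_gradIdx, ← Finset.mul_sum, mul_assoc,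
    ← Finset.sum_mul]

theorem IsSolution.sob_Φ (hu : IsSolution K u) (I : MIdx) {t : ℝ} (ht : t ∈ Ioc (0 : ℝ) 1) :
    weakInt frameSq (fun c : Fin 3 × Unit => gradIdx I c.1) (fun c => (fun _ : Unit => u.Φ t) c.2)
      = ∑' k, ENNReal.ofReal (symb I k * rawPair u k t fun v => v.X * v.Φ ^ 2) := by
  rw [weakInt_frameSq _ fun c => hu.Φ_memLp t ht]
  refine tsum_congr fun k => congrArg _ ?_
  simp only [Fintype.sum_prod_type, norm_fc_sq (hu.Φ_memLp t ht), rawPair, rawVal, FrameVal.X,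
    ← mul_add, symb_gradIdx, mul_assoc, ← Finset.sum_mul, ← Finset.mul_sum,
    Finset.univ_unique, Finset.sum_singleton]

theorem IsSolution.sob_ψ (hu : IsSolution K u) (I : MIdx) {t : ℝ} (ht : t ∈ Ioc (0 : ℝ) 1) :
    weakInt frameSq (fun _ => I) (fun _ : Unit => fun x => t * u.Φt t x)
      = ∑' k, ENNReal.ofReal (symb I k * rawPair u k t fun v => v.ψ ^ 2) := by
  rw [weakInt_frameSq _ fun c => hu.tΦt_memLp ht]
  simp only [norm_fc_sq (hu.tΦt_memLp ht), rawPair, rawVal, toD_const_mul,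
    Finset.univ_unique, Finset.sum_singleton]

theorem IsSolution.sob_n (hu : IsSolution K u) (I : MIdx) {t : ℝ} (ht : t ∈ Ioc (0 : ℝ) 1) :
    weakInt frameSq (fun _ => I) (fun _ : Unit => u.n t)
      = ∑' k, ENNReal.ofReal (symb I k * rawPair u k t fun v => v.n ^ 2) := by
  rw [weakInt_frameSq _ fun c => hu.n_memLp t ht]
  simp only [norm_fc_sq (hu.n_memLp t ht), rawPair, rawVal,
    Finset.univ_unique, Finset.sum_singleton]

/-! ### Comparison of frame and coordinate components -/

theorem rpow_le_of_neg_le {t : ℝ} (ht : t ∈ Ioc (0 : ℝ) 1) {x y : ℝ} (h : -y ≤ x) :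
    t ^ x ≤ t ^ (-y) := Real.rpow_le_rpow_of_exponent_ge ht.1 ht.2 h

/-- The weight `t ^ (4/3)` is the square of `t · t ^ (-1/3)`, the isotropic frame factor. The ratio
to the true frame factor is a power of `t` with exponent `2 (q e - 1/3)`, at least `-2σ`. -/
theorem rawVal_ξ_sq_le (k : Fin 3 → ℤ) (z : ℂ) {t : ℝ} (ht : t ∈ Ioc (0 : ℝ) 1) (e : Fin 3) :
    t ^ (4 / 3 : ℝ) * (rawVal u k z t).ξ e ^ 2
      ≤ t ^ (-(2 * K.sigma)) * (modeVal K u k z t).ξ e ^ 2 := by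
  have hs := neg_le_of_abs_le (K.abs_shear_le e)
  have h : t ^ (4 / 3 : ℝ) * freq k e ^ 2
      = t ^ (2 * (K.q e - 1 / 3)) * (t * (t ^ K.q e)⁻¹ * freq k e) ^ 2 := by
    have e1 : t ^ (2 * (K.q e - 1 / 3)) * (t ^ (2 : ℝ) * t ^ (-(2 * K.q e))) = t ^ (4 / 3 : ℝ) := by
      rw [← Real.rpow_add ht.1, ← Real.rpow_add ht.1]
      congr 1
      ring
    rw [rpow_neg_two_mul ht.1, Real.rpow_two] at e1
    rw [← e1]
    ring
  simp only [rawVal, modeVal]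
  rw [h]
  exact mul_le_mul_of_nonneg_right (rpow_le_of_neg_le ht (by linarith)) (sq_nonneg _)

theorem rawVal_X_le (k : Fin 3 → ℤ) (z : ℂ) {t : ℝ} (ht : t ∈ Ioc (0 : ℝ) 1) :
    t ^ (4 / 3 : ℝ) * (rawVal u k z t).X ≤ t ^ (-(2 * K.sigma)) * (modeVal K u k z t).X := by
  rw [FrameVal.X, FrameVal.X, Finset.mul_sum, Finset.mul_sum]
  exact Finset.sum_le_sum fun e _ => rawVal_ξ_sq_le k z ht e

theorem rawVal_kk_le (k : Fin 3 → ℤ) (z : ℂ) {t : ℝ} (ht : t ∈ Ioc (0 : ℝ) 1) :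
    (rawVal u k z t).kk ≤ t ^ (-(6 * K.sigma)) * (modeVal K u k z t).kk := by
  simp only [FrameVal.kk, Finset.mul_sum]
  refine Finset.sum_le_sum fun i _ => Finset.sum_le_sum fun j _ => ?_
  have hi := le_of_abs_le (K.abs_shear_le i)
  have hj := neg_le_of_abs_le (K.abs_shear_le j)
  have hσ := K.sigma_nonneg
  have h : (rawVal u k z t).k i j ^ 2
      = t ^ (2 * (K.q j - K.q i)) * (modeVal K u k z t).k i j ^ 2 := by
    have e1 : t ^ (2 * (K.q j - K.q i)) * (t ^ (2 * K.q i) * t ^ (-(2 * K.q j))) = 1 := by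
      rw [← Real.rpow_add ht.1, ← Real.rpow_add ht.1, ← Real.rpow_zero t]
      congr 1
      ring
    rw [rpow_neg_two_mul ht.1, rpow_two_mul ht.1 (K.q i)] at e1
    simp only [rawVal, modeVal]
    linear_combination (-(toD (u.κ t i j) (cw k z)) ^ 2) * e1
  rw [h]
  exact mul_le_mul_of_nonneg_right (rpow_le_of_neg_le ht (by linarith)) (sq_nonneg _)

/-- The exponent `2 q e + 2 q i + 2 q j - 2` is twice a sum of three shear components, since `2 = 3
· 2/3`. This is why `∂h` needs no power of `t` in the norm. -/
theorem rawVal_XHH_le (k : Fin 3 → ℤ) (z : ℂ) {t : ℝ} (ht : t ∈ Ioc (0 : ℝ) 1) :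
    (rawVal u k z t).X * (rawVal u k z t).HH
      ≤ t ^ (-(6 * K.sigma)) * ((modeVal K u k z t).X * (modeVal K u k z t).HH) := by
  simp only [FrameVal.X, FrameVal.HH, Finset.sum_mul, Finset.mul_sum]
  refine Finset.sum_le_sum fun i _ => Finset.sum_le_sum fun j _ => Finset.sum_le_sum fun e _ => ?_
  have he := neg_le_of_abs_le (K.abs_shear_le e)
  have hi := neg_le_of_abs_le (K.abs_shear_le i)
  have hj := neg_le_of_abs_le (K.abs_shear_le j)
  have h : (rawVal u k z t).ξ e ^ 2 * (rawVal u k z t).H i j ^ 2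
      = t ^ (2 * K.q e + 2 * K.q i + 2 * K.q j - 2) *
        ((modeVal K u k z t).ξ e ^ 2 * (modeVal K u k z t).H i j ^ 2) := by
    have e1 : t ^ (2 * K.q e + 2 * K.q i + 2 * K.q j - 2) *
        (t ^ (2 : ℝ) * t ^ (-(2 * K.q e)) * t ^ (-(2 * K.q i)) * t ^ (-(2 * K.q j))) = 1 := by
      rw [← Real.rpow_add ht.1, ← Real.rpow_add ht.1, ← Real.rpow_add ht.1, ← Real.rpow_add ht.1,
        ← Real.rpow_zero t]
      congr 1
      ring
    rw [rpow_neg_two_mul ht.1, rpow_neg_two_mul ht.1, rpow_neg_two_mul ht.1, Real.rpow_two] at e1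
    simp only [rawVal, modeVal]
    linear_combination (-(freq k e ^ 2 * toD (u.h t i j) (cw k z) ^ 2)) * e1
  rw [h]
  exact mul_le_mul_of_nonneg_right (rpow_le_of_neg_le ht (by linarith))
    (mul_nonneg (sq_nonneg _) (sq_nonneg _))

theorem symb_le (J : MIdx) (k : Fin 3 → ℤ) (z : ℂ) (t : ℝ) {p : ℕ} (hJ : order J ≤ p) :
    symb J k ≤ (1 + (rawVal u k z t).X) ^ p := by
  have hX := (rawVal u k z t).X_nonneg
  have h1 : symb J k ≤ ∏ i, (1 + (rawVal u k z t).X) ^ J i := by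
    refine Finset.prod_le_prod (fun i _ => pow_nonneg (sq_nonneg _) _) fun i _ => ?_
    refine pow_le_pow_left₀ (sq_nonneg _) ?_ _
    have : freq k i ^ 2 ≤ (rawVal u k z t).X :=
      Finset.single_le_sum (f := fun i => freq k i ^ 2) (fun _ _ => sq_nonneg _)
        (Finset.mem_univ i)
    linarith
  refine h1.trans ?_
  rw [Finset.prod_pow_eq_pow_sum]
  exact pow_le_pow_right₀ (by linarith) hJ

/-- This transfers elliptic regularity to coordinates: `p` extra derivatives, each weighted by `t ^
(2/3)`, cost at most `(X + 1) ^ p` in the square, and `p ≤ 2` lets the lapse bound on `(X + 1) n`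
absorb it. -/
theorem symb_mul_n_sq_le (J : MIdx) (k : Fin 3 → ℤ) (z : ℂ) {t : ℝ} (ht : t ∈ Ioc (0 : ℝ) 1)
    {p : ℕ} (hJ : order J ≤ p) (hp : p ≤ 2) :
    (t ^ (2 / 3 * p : ℝ)) ^ 2 * (symb J k * (rawVal u k z t).n ^ 2)
      ≤ t ^ (-(6 * K.sigma)) * (((modeVal K u k z t).X + 1) * (modeVal K u k z t).n) ^ 2 := by
  have hX := (rawVal u k z t).X_nonneg
  have hX' := (modeVal K u k z t).X_nonneg
  have hσ := K.sigma_nonneg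
  have hr := rawVal_X_le (K := K) (u := u) k z ht
  have ht43 : t ^ (4 / 3 : ℝ) ≤ 1 := Real.rpow_le_one ht.1.le ht.2 (by norm_num)
  have ht43' : 0 ≤ t ^ (4 / 3 : ℝ) := Real.rpow_nonneg ht.1.le _
  have hge : 1 ≤ t ^ (-(2 * K.sigma)) :=
    Real.one_le_rpow_of_pos_of_le_one_of_nonpos ht.1 ht.2 (by linarith)
  have e1 : (t ^ (2 / 3 * p : ℝ)) ^ 2 = (t ^ (4 / 3 : ℝ)) ^ p := by
    rw [← Real.rpow_natCast, ← Real.rpow_natCast, ← Real.rpow_mul ht.1.le, ← Real.rpow_mul ht.1.le]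
    congr 1
    push_cast
    ring
  have h1 : (t ^ (2 / 3 * p : ℝ)) ^ 2 * symb J k
      ≤ t ^ (-(6 * K.sigma)) * ((modeVal K u k z t).X + 1) ^ 2 := by
    calc (t ^ (2 / 3 * p : ℝ)) ^ 2 * symb J k
        ≤ (t ^ (4 / 3 : ℝ)) ^ p * (1 + (rawVal u k z t).X) ^ p := by
          rw [e1]
          exact mul_le_mul_of_nonneg_left (symb_le J k z t hJ) (pow_nonneg ht43' _)
      _ = (t ^ (4 / 3 : ℝ) * (1 + (rawVal u k z t).X)) ^ p := (mul_pow _ _ _).symm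
      _ ≤ (t ^ (-(2 * K.sigma)) * ((modeVal K u k z t).X + 1)) ^ p :=
          pow_le_pow_left₀ (mul_nonneg ht43' (by linarith)) (by linarith) _
      _ ≤ (t ^ (-(2 * K.sigma)) * ((modeVal K u k z t).X + 1)) ^ 2 :=
          pow_le_pow_right₀ (by nlinarith) hp
      _ = t ^ (-(4 * K.sigma)) * ((modeVal K u k z t).X + 1) ^ 2 := by
          rw [mul_pow, ← Real.rpow_natCast (t ^ _), ← Real.rpow_mul ht.1.le]
          congr 2
          push_cast
          ring
      _ ≤ _ := mul_le_mul_of_nonneg_right (rpow_le_of_neg_le ht (by linarith)) (sq_nonneg _)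
  calc (t ^ (2 / 3 * p : ℝ)) ^ 2 * (symb J k * (rawVal u k z t).n ^ 2)
      = (t ^ (2 / 3 * p : ℝ)) ^ 2 * symb J k * (rawVal u k z t).n ^ 2 := by ring
    _ ≤ t ^ (-(6 * K.sigma)) * ((modeVal K u k z t).X + 1) ^ 2 * (rawVal u k z t).n ^ 2 :=
        mul_le_mul_of_nonneg_right h1 (sq_nonneg _)
    _ = _ := by
        simp only [rawVal, modeVal]
        ring

end

section

variable {K : Kasner} {u : LinVars}

/-! ### The norm estimates -/

theorem sqrt_le_of_sq_le {τ c : ℝ} (hτ : 0 ≤ τ) (hc : 0 ≤ c) {W M : ℝ≥0∞}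
    (h : ENNReal.ofReal (τ ^ 2) * W ≤ ENNReal.ofReal (c ^ 2) * M) :
    ENNReal.ofReal τ * W ^ (1 / 2 : ℝ) ≤ ENNReal.ofReal c * M ^ (1 / 2 : ℝ) := by
  have e : ∀ {a : ℝ} (_ : 0 ≤ a), ENNReal.ofReal (a ^ 2) ^ (1 / 2 : ℝ) = ENNReal.ofReal a := by
    intro a ha
    rw [ENNReal.ofReal_pow ha, ← ENNReal.rpow_two, ← ENNReal.rpow_mul]
    norm_num
  have h2 := ENNReal.rpow_le_rpow h (show (0 : ℝ) ≤ 1 / 2 by norm_num)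
  rwa [ENNReal.mul_rpow_of_nonneg _ _ (by norm_num), ENNReal.mul_rpow_of_nonneg _ _ (by norm_num),
    e hτ, e hc] at h2

/-- The growth factor in the norm estimates. -/
def growth (K : Kasner) (t : ℝ) : ℝ := 18 * t ^ (-(6000003 * K.sigma))

theorem growth_nonneg (K : Kasner) {t : ℝ} (ht : t ∈ Ioc (0 : ℝ) 1) : 0 ≤ growth K t :=
  mul_nonneg (by norm_num) (Real.rpow_nonneg ht.1.le _)

/-- A mode-wise bound by the modified energy gives a bound of norms by the modified energy of the
data. -/
theorem IsSolution.weighted_norm_le (hu : IsSolution K u) (hσ1 : K.sigma ≤ 1) (I J : MIdx) {t τ : ℝ}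
    (ht : t ∈ Ioc (0 : ℝ) 1) (hτ : 0 ≤ τ) {G : FrameVal → ℝ}
    (hG : ∀ k z, τ ^ 2 * (symb J k * G (rawVal u k z t))
      ≤ 300 * t ^ (-(6 * K.sigma)) * (modeVal K u k z t).modEnergy K.A) :
    ENNReal.ofReal τ * (∑' k, ENNReal.ofReal (symb (I + J) k * rawPair u k t G)) ^ (1 / 2 : ℝ)
      ≤ ENNReal.ofReal (growth K t) * modSq K u I 1 ^ (1 / 2 : ℝ) := by
  have ht0 := Real.rpow_nonneg ht.1.le
  refine sqrt_le_of_sq_le hτ (growth_nonneg K ht) ?_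
  calc ENNReal.ofReal (τ ^ 2) * ∑' k, ENNReal.ofReal (symb (I + J) k * rawPair u k t G)
      ≤ ENNReal.ofReal (300 * t ^ (-(6 * K.sigma))) * modSq K u I t := by
        rw [modSq, ofReal_mul_tsum (sq_nonneg _), ofReal_mul_tsum (mul_nonneg (by norm_num) (ht0 _))]
        refine ENNReal.tsum_le_tsum fun k => ENNReal.ofReal_le_ofReal ?_
        have h := mul_le_mul_of_nonneg_left (add_le_add (hG k 1) (hG k Complex.I))
          (symb_nonneg I k)
        rw [symb_add, rawPair, pair]
        linarith
    _ ≤ ENNReal.ofReal (300 * t ^ (-(6 * K.sigma))) *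
          (ENNReal.ofReal (t ^ (-(12000000 * K.sigma))) * modSq K u I 1) := by
        gcongr
        exact hu.modSq_le hσ1 I ht
    _ ≤ ENNReal.ofReal (growth K t ^ 2) * modSq K u I 1 := by
        rw [← mul_assoc, ← ENNReal.ofReal_mul (mul_nonneg (by norm_num) (ht0 _))]
        gcongr
        -- The growth exponent is half of `6 + 12000000`, from the change of components and from
        -- Grönwall; the factor `18` works because `18 ^ 2 ≥ 300`.
        have e : t ^ (-(6 * K.sigma)) * t ^ (-(12000000 * K.sigma))
            = (t ^ (-(6000003 * K.sigma))) ^ 2 := by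
          rw [← Real.rpow_add ht.1, ← Real.rpow_natCast, ← Real.rpow_mul ht.1.le]
          congr 1
          push_cast
          ring
        rw [growth, mul_pow, mul_assoc, e]
        have := sq_nonneg (t ^ (-(6000003 * K.sigma)))
        linarith

theorem IsSolution.norm_le (hu : IsSolution K u) (hσ1 : K.sigma ≤ 1) (I : MIdx) {t τ : ℝ}
    (ht : t ∈ Ioc (0 : ℝ) 1) (hτ : 0 ≤ τ) {G : FrameVal → ℝ}
    (hG : ∀ k z, τ ^ 2 * G (rawVal u k z t)
      ≤ 300 * t ^ (-(6 * K.sigma)) * (modeVal K u k z t).modEnergy K.A) :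
    ENNReal.ofReal τ * (∑' k, ENNReal.ofReal (symb I k * rawPair u k t G)) ^ (1 / 2 : ℝ)
      ≤ ENNReal.ofReal (growth K t) * modSq K u I 1 ^ (1 / 2 : ℝ) := by
  have h := hu.weighted_norm_le hσ1 I 0 ht hτ (G := G) fun k z => by
    rw [symb_zero, one_mul]; exact hG k z
  rwa [add_zero] at h

theorem IsSolution.sqrt_sob_κ_le (hu : IsSolution K u) (hσ1 : K.sigma ≤ 1) {t : ℝ}
    (ht : t ∈ Ioc (0 : ℝ) 1) (I : MIdx) :
    weakInt frameSq (fun _ => I) (fun c : Fin 3 × Fin 3 => u.κ t c.1 c.2) ^ (1 / 2 : ℝ)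
      ≤ ENNReal.ofReal (growth K t) * modSq K u I 1 ^ (1 / 2 : ℝ) := by
  have ht0 := Real.rpow_nonneg ht.1.le (-(6 * K.sigma))
  have h := hu.norm_le hσ1 I ht zero_le_one (G := fun v => v.kk) fun k z => by
    have h1 := rawVal_kk_le (K := K) (u := u) k z ht
    have h2 : (modeVal K u k z t).kk ≤ 300 * (modeVal K u k z t).modEnergy K.A := by
      have := (modeVal K u k z t).X_nonneg
      have := (modeVal K u k z t).HH_nonneg
      have := (modeVal K u k z t).kk_nonneg
      have : 0 ≤ (modeVal K u k z t).X * (modeVal K u k z t).Φ ^ 2 := by positivity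
      have : 0 ≤ (modeVal K u k z t).X * (modeVal K u k z t).HH := by positivity
      have := sq_nonneg ((modeVal K u k z t).ψ - K.A * (modeVal K u k z t).n)
      rw [FrameVal.modEnergy]
      linarith
    have h3 := mul_le_mul_of_nonneg_left h2 ht0
    linarith
  rwa [ENNReal.ofReal_one, one_mul, ← hu.sob_κ I ht] at h

theorem IsSolution.sqrt_sob_h_le (hu : IsSolution K u) (hσ1 : K.sigma ≤ 1) {t : ℝ}
    (ht : t ∈ Ioc (0 : ℝ) 1) (I : MIdx) :
    weakInt frameSq (fun c : Fin 3 × Fin 3 × Fin 3 => gradIdx I c.1)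
        (fun c => (fun c : Fin 3 × Fin 3 => u.h t c.1 c.2) c.2) ^ (1 / 2 : ℝ)
      ≤ ENNReal.ofReal (growth K t) * modSq K u I 1 ^ (1 / 2 : ℝ) := by
  have ht0 := Real.rpow_nonneg ht.1.le (-(6 * K.sigma))
  have h := hu.norm_le hσ1 I ht zero_le_one (G := fun v => v.X * v.HH) fun k z => by
    have h1 := rawVal_XHH_le (K := K) (u := u) k z ht
    have h2 : (modeVal K u k z t).X * (modeVal K u k z t).HH
        ≤ 300 * (modeVal K u k z t).modEnergy K.A := by
      have := (modeVal K u k z t).X_nonneg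
      have := (modeVal K u k z t).HH_nonneg
      have := (modeVal K u k z t).kk_nonneg
      have : 0 ≤ (modeVal K u k z t).X * (modeVal K u k z t).Φ ^ 2 := by positivity
      have : 0 ≤ (modeVal K u k z t).X * (modeVal K u k z t).HH := by positivity
      have := sq_nonneg ((modeVal K u k z t).ψ - K.A * (modeVal K u k z t).n)
      rw [FrameVal.modEnergy]
      linarith
    have h3 := mul_le_mul_of_nonneg_left h2 ht0
    linarith
  rwa [ENNReal.ofReal_one, one_mul, ← hu.sob_h I ht] at h

theorem IsSolution.sqrt_sob_ψ_le (hu : IsSolution K u) (hσ1 : K.sigma ≤ 1) {t : ℝ}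
    (ht : t ∈ Ioc (0 : ℝ) 1) (I : MIdx) :
    weakInt frameSq (fun _ => I) (fun _ : Unit => fun x => t * u.Φt t x) ^ (1 / 2 : ℝ)
      ≤ ENNReal.ofReal (growth K t) * modSq K u I 1 ^ (1 / 2 : ℝ) := by
  have hσ := K.sigma_nonneg
  have hge : 1 ≤ t ^ (-(6 * K.sigma)) :=
    Real.one_le_rpow_of_pos_of_le_one_of_nonpos ht.1 ht.2 (by linarith)
  have h := hu.norm_le hσ1 I ht zero_le_one (G := fun v => v.ψ ^ 2) fun k z => by
    have h1 := FrameVal.energy_le (hu.constraints k z ht) hσ1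
    have h2 : (rawVal u k z t).ψ ^ 2 ≤ (modeVal K u k z t).energy := by
      change (modeVal K u k z t).ψ ^ 2 ≤ _
      have := (modeVal K u k z t).X_nonneg
      have := (modeVal K u k z t).HH_nonneg
      have := (modeVal K u k z t).kk_nonneg
      have : 0 ≤ (modeVal K u k z t).X * (modeVal K u k z t).Φ ^ 2 := by positivity
      have : 0 ≤ (modeVal K u k z t).X * (modeVal K u k z t).n ^ 2 := by positivity
      have : 0 ≤ (modeVal K u k z t).X * (modeVal K u k z t).HH := by positivity
      have := sq_nonneg (modeVal K u k z t).n
      rw [FrameVal.energy]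
      linarith
    have h3 := mul_le_mul_of_nonneg_right hge ((modeVal K u k z t).modEnergy_nonneg K.A)
    linarith
  rwa [ENNReal.ofReal_one, one_mul, ← hu.sob_ψ I ht] at h

theorem IsSolution.sqrt_sob_Φ_le (hu : IsSolution K u) (hσ1 : K.sigma ≤ 1) {t : ℝ}
    (ht : t ∈ Ioc (0 : ℝ) 1) (I : MIdx) :
    ENNReal.ofReal (t ^ (2 / 3 : ℝ)) * weakInt frameSq (fun c : Fin 3 × Unit => gradIdx I c.1)
        (fun c => (fun _ : Unit => u.Φ t) c.2) ^ (1 / 2 : ℝ)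
      ≤ ENNReal.ofReal (growth K t) * modSq K u I 1 ^ (1 / 2 : ℝ) := by
  have hσ := K.sigma_nonneg
  have ht0 := Real.rpow_nonneg ht.1.le (-(6 * K.sigma))
  rw [hu.sob_Φ I ht]
  refine hu.norm_le hσ1 I ht (Real.rpow_nonneg ht.1.le _) fun k z => ?_
  have h1 := rawVal_X_le (K := K) (u := u) k z ht
  have hX := (modeVal K u k z t).X_nonneg
  have e : (t ^ (2 / 3 : ℝ)) ^ 2 = t ^ (4 / 3 : ℝ) := by
    rw [← Real.rpow_natCast, ← Real.rpow_mul ht.1.le]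
    norm_num
  have h2 : t ^ (-(2 * K.sigma)) ≤ t ^ (-(6 * K.sigma)) := rpow_le_of_neg_le ht (by linarith)
  have h3 := (h1.trans (mul_le_mul_of_nonneg_right h2 hX))
  have h4 := mul_le_mul_of_nonneg_right h3 (sq_nonneg (rawVal u k z t).Φ)
  have h5 : (modeVal K u k z t).X * (rawVal u k z t).Φ ^ 2
      ≤ 300 * (modeVal K u k z t).modEnergy K.A := by
    change (modeVal K u k z t).X * (modeVal K u k z t).Φ ^ 2 ≤ _
    have := (modeVal K u k z t).HH_nonneg
    have := (modeVal K u k z t).kk_nonneg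
    have : 0 ≤ (modeVal K u k z t).X * (modeVal K u k z t).Φ ^ 2 := by positivity
    have : 0 ≤ (modeVal K u k z t).X * (modeVal K u k z t).HH := by positivity
    have := sq_nonneg ((modeVal K u k z t).ψ - K.A * (modeVal K u k z t).n)
    rw [FrameVal.modEnergy]
    linarith
  have h6 := mul_le_mul_of_nonneg_left h5 ht0
  rw [e]
  linarith

theorem IsSolution.sqrt_sob_n_le (hu : IsSolution K u) (hσ1 : K.sigma ≤ 1) {t : ℝ}
    (ht : t ∈ Ioc (0 : ℝ) 1) (I : MIdx) {J : MIdx} {p : ℕ} (hJ : order J ≤ p) (hp : p ≤ 2) :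
    ENNReal.ofReal (t ^ (2 / 3 * p : ℝ)) *
        weakInt frameSq (fun _ => I + J) (fun _ : Unit => u.n t) ^ (1 / 2 : ℝ)
      ≤ ENNReal.ofReal (growth K t) * modSq K u I 1 ^ (1 / 2 : ℝ) := by
  have ht0 := Real.rpow_nonneg ht.1.le (-(6 * K.sigma))
  rw [hu.sob_n (I + J) ht]
  refine hu.weighted_norm_le hσ1 I J ht (Real.rpow_nonneg ht.1.le _) fun k z => ?_
  have h1 := symb_mul_n_sq_le (K := K) (u := u) J k z ht hJ hp
  have h2 := mul_le_mul_of_nonneg_left (FrameVal.lapse_sq_le (hu.constraints k z ht) hσ1) ht0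
  have h3 := mul_nonneg ht0 ((modeVal K u k z t).modEnergy_nonneg K.A)
  linarith

theorem mem_multiIdx {M : ℕ} {I : MIdx} : I ∈ multiIdx M ↔ order I ≤ M := by
  rw [multiIdx, Finset.mem_filter, Fintype.mem_piFinset]
  refine ⟨fun h => h.2, fun h => ⟨fun i => ?_, h⟩⟩
  have : I i ≤ order I := Finset.single_le_sum (f := I) (fun _ _ => Nat.zero_le _)
    (Finset.mem_univ i)
  rw [Finset.mem_range]
  omega

theorem card_multiIdx_le {p : ℕ} (hp : p ≤ 2) : (multiIdx p).card ≤ 27 := by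
  refine (Finset.card_filter_le _ _).trans ?_
  rw [Fintype.card_piFinset_const]
  calc _ ≤ 3 ^ 3 := by simpa using Nat.pow_le_pow_left (by omega : p + 1 ≤ 3) 3
    _ = 27 := by norm_num

/-- Derivatives are peeled off one at a time, by induction on `p`. The splitting separates the `N`
derivatives charged to the data from the up to two that the lapse equation supplies. -/
theorem exists_le_order {N p : ℕ} : ∀ {L : MIdx}, order L ≤ N + p →
    ∃ I ∈ multiIdx N, ∃ J ∈ multiIdx p, I + J = L := by
  induction p with
  | zero =>
    intro L hL
    exact ⟨L, mem_multiIdx.2 hL, 0, mem_multiIdx.2 (by simp [order]), add_zero L⟩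
  | succ p ih =>
    intro L hL
    by_cases h : order L ≤ N + p
    · obtain ⟨I, hI, J, hJ, e⟩ := ih h
      exact ⟨I, hI, J, mem_multiIdx.2 ((mem_multiIdx.1 hJ).trans (Nat.le_succ p)), e⟩
    · have hpos : ∃ i, L i ≠ 0 := by
        by_contra hcon
        push Not at hcon
        apply h
        simp [order, hcon]
      obtain ⟨i, hi⟩ := hpos
      have e1 : (L - Pi.single i 1) + Pi.single i 1 = L := by
        funext j
        by_cases hj : j = i
        · subst hj
          simp only [Pi.add_apply, Pi.sub_apply, Pi.single_eq_same]
          omega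
        · simp [hj]
      have hadd : ∀ A B : MIdx, order (A + B) = order A + order B := fun A B => by
        simp [order, Finset.sum_add_distrib]
      have hsingle : order (Pi.single i 1) = 1 := by simp [order]
      have e2 := hadd (L - Pi.single i 1) (Pi.single i 1)
      rw [e1, hsingle] at e2
      obtain ⟨I, hI, J, hJ, e⟩ := ih (L := L - Pi.single i 1) (by omega)
      refine ⟨I, hI, J + Pi.single i 1, mem_multiIdx.2 ?_, ?_⟩
      · rw [hadd, hsingle]
        have := mem_multiIdx.1 hJ
        omega
      · rw [← add_assoc, e, e1]

/-- A multi-index may split in several ways; the resulting overcounting is harmless because all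
terms are nonnegative. -/
theorem sum_multiIdx_add_le (N p : ℕ) (f : MIdx → ℝ≥0∞) :
    ∑ L ∈ multiIdx (N + p), f L ≤ ∑ I ∈ multiIdx N, ∑ J ∈ multiIdx p, f (I + J) := by
  classical
  rw [← Finset.sum_product']
  have hsub : multiIdx (N + p) ⊆ (multiIdx N ×ˢ multiIdx p).image fun x => x.1 + x.2 := by
    intro L hL
    obtain ⟨I, hI, J, hJ, e⟩ := exists_le_order (mem_multiIdx.1 hL)
    exact Finset.mem_image.2 ⟨(I, J), Finset.mem_product.2 ⟨hI, hJ⟩, e⟩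
  refine (Finset.sum_le_sum_of_subset hsub).trans ?_
  exact Finset.sum_image_le_of_nonneg fun _ _ => zero_le

/-- The sum of the modified energies of the data. -/
def dataSum (K : Kasner) (u : LinVars) (N : ℕ) : ℝ≥0∞ :=
  ∑ I ∈ multiIdx N, modSq K u I 1 ^ (1 / 2 : ℝ)

/-- The constant is `85 = 4 + 3 · 27`: four norms without extra derivatives, and three lapse norms
with at most `27` extra multi-indices each. Keeping the sum over `I` on both sides makes it
independent of `N`. -/
theorem IsSolution.highNorm_le_dataSum (hu : IsSolution K u) (hσ1 : K.sigma ≤ 1) (N : ℕ) {t : ℝ}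
    (ht : t ∈ Ioc (0 : ℝ) 1) :
    highNorm u N t ≤ ENNReal.ofReal 85 * (ENNReal.ofReal (growth K t) * dataSum K u N) := by
  set S := ENNReal.ofReal (growth K t) * dataSum K u N with hS
  have hSe : S = ∑ I ∈ multiIdx N, ENNReal.ofReal (growth K t) * modSq K u I 1 ^ (1 / 2 : ℝ) := by
    rw [hS, dataSum, Finset.mul_sum]
  have h1 : sobNorm N (fun c : Fin 3 × Fin 3 => u.κ t c.1 c.2) ≤ S := by
    rw [hSe]; exact Finset.sum_le_sum fun I _ => hu.sqrt_sob_κ_le hσ1 ht I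
  have h2 : sobNormGrad N (fun c : Fin 3 × Fin 3 => u.h t c.1 c.2) ≤ S := by
    rw [hSe]; exact Finset.sum_le_sum fun I _ => hu.sqrt_sob_h_le hσ1 ht I
  have h3 : sobNorm N (fun _ : Unit => fun x => t * u.Φt t x) ≤ S := by
    rw [hSe]; exact Finset.sum_le_sum fun I _ => hu.sqrt_sob_ψ_le hσ1 ht I
  have h4 : ENNReal.ofReal (t ^ (2 / 3 : ℝ)) * sobNormGrad N (fun _ : Unit => u.Φ t) ≤ S := by
    rw [hSe, sobNormGrad, Finset.mul_sum]
    exact Finset.sum_le_sum fun I _ => hu.sqrt_sob_Φ_le hσ1 ht I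
  have h5 : ∀ p ∈ Finset.range 3, ENNReal.ofReal (t ^ (2 / 3 * p : ℝ)) *
      sobNorm (N + p) (fun _ : Unit => u.n t) ≤ 27 * S := by
    intro p hp
    have hp2 : p ≤ 2 := by rw [Finset.mem_range] at hp; omega
    calc ENNReal.ofReal (t ^ (2 / 3 * p : ℝ)) * sobNorm (N + p) (fun _ : Unit => u.n t)
        ≤ ENNReal.ofReal (t ^ (2 / 3 * p : ℝ)) * ∑ I ∈ multiIdx N, ∑ J ∈ multiIdx p,
          weakInt frameSq (fun _ => I + J) (fun _ : Unit => u.n t) ^ (1 / 2 : ℝ) := by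
          gcongr
          exact sum_multiIdx_add_le N p _
      _ = ∑ I ∈ multiIdx N, ∑ J ∈ multiIdx p, ENNReal.ofReal (t ^ (2 / 3 * p : ℝ)) *
          weakInt frameSq (fun _ => I + J) (fun _ : Unit => u.n t) ^ (1 / 2 : ℝ) := by
          simp only [Finset.mul_sum]
      _ ≤ ∑ I ∈ multiIdx N, ∑ _J ∈ multiIdx p,
          ENNReal.ofReal (growth K t) * modSq K u I 1 ^ (1 / 2 : ℝ) :=
          Finset.sum_le_sum fun I _ => Finset.sum_le_sum fun J hJ =>
            hu.sqrt_sob_n_le hσ1 ht I (mem_multiIdx.1 hJ) hp2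
      _ = (multiIdx p).card * S := by
          rw [hSe, Finset.mul_sum]
          simp only [Finset.sum_const, nsmul_eq_mul]
      _ ≤ 27 * S := by
          gcongr
          exact_mod_cast card_multiIdx_le hp2
  calc highNorm u N t ≤ S + S + S + S + ∑ _p ∈ Finset.range 3, 27 * S := by
        rw [highNorm]
        exact add_le_add (add_le_add (add_le_add (add_le_add h1 h2) h3) h4) (Finset.sum_le_sum h5)
    _ = ENNReal.ofReal 85 * S := by
        simp only [Finset.sum_const, Finset.card_range, nsmul_eq_mul]
        rw [ENNReal.ofReal_ofNat]
        push_cast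
        ring

theorem sqrt_add_le (a b : ℝ≥0∞) :
    (a + b) ^ (1 / 2 : ℝ) ≤ a ^ (1 / 2 : ℝ) + b ^ (1 / 2 : ℝ) :=
  ENNReal.rpow_add_le_add_rpow a b (by norm_num) (by norm_num)

/-- At `t = 1` all frame weights equal one, so frame and coordinate components coincide and
`modEnergy_le` applies directly. The constant satisfies `110 ^ 2 ≥ 12000`. -/
theorem IsSolution.dataSum_le (hu : IsSolution K u) (N : ℕ) :
    dataSum K u N ≤ ENNReal.ofReal 110 * highNorm u N 1 := by
  have h1 : (1 : ℝ) ∈ Ioc (0 : ℝ) 1 := right_mem_Ioc.2 one_pos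
  set a : MIdx → ℝ≥0∞ := fun I =>
    weakInt frameSq (fun _ => I) (fun c : Fin 3 × Fin 3 => u.κ 1 c.1 c.2) with ha
  set b : MIdx → ℝ≥0∞ := fun I =>
    weakInt frameSq (fun c : Fin 3 × Fin 3 × Fin 3 => gradIdx I c.1)
        (fun c => (fun c : Fin 3 × Fin 3 => u.h 1 c.1 c.2) c.2) with hb
  set c : MIdx → ℝ≥0∞ := fun I =>
    weakInt frameSq (fun _ => I) (fun _ : Unit => fun x => 1 * u.Φt 1 x) with hc
  set d : MIdx → ℝ≥0∞ := fun I =>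
    weakInt frameSq (fun c : Fin 3 × Unit => gradIdx I c.1) (fun c => (fun _ : Unit => u.Φ 1) c.2)
    with hd
  set e : MIdx → ℝ≥0∞ := fun I => weakInt frameSq (fun _ => I) (fun _ : Unit => u.n 1) with he
  have hI : ∀ I, modSq K u I 1 ^ (1 / 2 : ℝ) ≤ ENNReal.ofReal 110 *
      (a I ^ (1 / 2 : ℝ) + b I ^ (1 / 2 : ℝ) + c I ^ (1 / 2 : ℝ) + d I ^ (1 / 2 : ℝ)
        + e I ^ (1 / 2 : ℝ)) := by
    intro I
    have hmod : modSq K u I 1 ≤ ENNReal.ofReal 12000 * (a I + b I + c I + d I + e I) := by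
      have hs := symb_nonneg I
      have nn : ∀ {G : FrameVal → ℝ} (_ : ∀ v, 0 ≤ G v) (k : Fin 3 → ℤ),
          0 ≤ symb I k * rawPair u k 1 G := fun hG k =>
        mul_nonneg (hs k) (add_nonneg (hG _) (hG _))
      have n1 := nn FrameVal.kk_nonneg
      have n2 := nn fun v => mul_nonneg v.X_nonneg v.HH_nonneg
      have n3 := nn fun v => sq_nonneg v.ψ
      have n4 := nn fun v => mul_nonneg v.X_nonneg (sq_nonneg v.Φ)
      have n5 := nn fun v => sq_nonneg v.n
      simp only [ha, hb, hc, hd, he]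
      rw [hu.sob_κ I h1, hu.sob_h I h1, hu.sob_ψ I h1, hu.sob_Φ I h1, hu.sob_n I h1,
        tsum_ofReal_add n1 n2, tsum_ofReal_add (fun k => add_nonneg (n1 k) (n2 k)) n3,
        tsum_ofReal_add (fun k => add_nonneg (add_nonneg (n1 k) (n2 k)) (n3 k)) n4,
        tsum_ofReal_add (fun k => add_nonneg (add_nonneg (add_nonneg (n1 k) (n2 k)) (n3 k)) (n4 k))
          n5, ofReal_mul_tsum (by norm_num)]
      refine ENNReal.tsum_le_tsum fun k => ENNReal.ofReal_le_ofReal ?_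
      have m1 := (rawVal u k 1 1).modEnergy_le K
      have m2 := (rawVal u k Complex.I 1).modEnergy_le K
      have p2 := n2 k
      have m := mul_le_mul_of_nonneg_left (add_le_add m1 m2) (hs k)
      simp only [pair, modeVal_one, rawPair] at p2 ⊢
      linarith
    have hsq : ENNReal.ofReal ((1 : ℝ) ^ 2) * modSq K u I 1
        ≤ ENNReal.ofReal (110 ^ 2) * (a I + b I + c I + d I + e I) := by
      rw [one_pow, ENNReal.ofReal_one, one_mul]
      refine hmod.trans ?_
      gcongr
      norm_num
    have h := sqrt_le_of_sq_le zero_le_one (by norm_num) hsq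
    rw [ENNReal.ofReal_one, one_mul] at h
    refine h.trans ?_
    gcongr
    refine (sqrt_add_le _ _).trans (add_le_add ?_ le_rfl)
    refine (sqrt_add_le _ _).trans (add_le_add ?_ le_rfl)
    refine (sqrt_add_le _ _).trans (add_le_add ?_ le_rfl)
    exact sqrt_add_le _ _
  calc dataSum K u N ≤ ∑ I ∈ multiIdx N, ENNReal.ofReal 110 *
      (a I ^ (1 / 2 : ℝ) + b I ^ (1 / 2 : ℝ) + c I ^ (1 / 2 : ℝ) + d I ^ (1 / 2 : ℝ)
        + e I ^ (1 / 2 : ℝ)) := Finset.sum_le_sum fun I _ => hI I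
    _ = ENNReal.ofReal 110 * (sobNorm N (fun c : Fin 3 × Fin 3 => u.κ 1 c.1 c.2)
        + sobNormGrad N (fun c : Fin 3 × Fin 3 => u.h 1 c.1 c.2)
        + sobNorm N (fun _ : Unit => fun x => 1 * u.Φt 1 x)
        + sobNormGrad N (fun _ : Unit => u.Φ 1) + sobNorm N (fun _ : Unit => u.n 1)) := by
        rw [← Finset.mul_sum]
        simp only [Finset.sum_add_distrib]
        rfl
    _ ≤ ENNReal.ofReal 110 * highNorm u N 1 := by
        rw [highNorm]
        gcongr
        · rw [Real.one_rpow, ENNReal.ofReal_one, one_mul]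
        -- Of the three lapse norms only the one with `p = 0` is needed for the data.
        · rw [Finset.sum_range_succ']
          simp

theorem IsSolution.highNorm_le (hu : IsSolution K u) (hσ1 : K.sigma ≤ 1) (N : ℕ) {t : ℝ}
    (ht : t ∈ Ioc (0 : ℝ) 1) : highNorm u N t ≤ ENNReal.ofReal 3600000 * highNorm u N 1
      * ENNReal.ofReal (t ^ (-(12000006 * K.sigma))) := by
  have hσ := K.sigma_nonneg
  have hg := growth_nonneg K ht
  calc highNorm u N t ≤ ENNReal.ofReal 85 * (ENNReal.ofReal (growth K t) *
        (ENNReal.ofReal 110 * highNorm u N 1)) := by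
        refine (hu.highNorm_le_dataSum hσ1 N ht).trans ?_
        gcongr
        exact hu.dataSum_le N
    _ = ENNReal.ofReal (85 * growth K t * 110) * highNorm u N 1 := by
        rw [← mul_assoc, ← mul_assoc, ← ENNReal.ofReal_mul (by norm_num),
          ← ENNReal.ofReal_mul (by positivity)]
    _ ≤ ENNReal.ofReal (3600000 * t ^ (-(12000006 * K.sigma))) * highNorm u N 1 := by
        refine mul_le_mul' (ENNReal.ofReal_le_ofReal ?_) le_rfl
        have h2 : t ^ (-(6000003 * K.sigma)) ≤ t ^ (-(12000006 * K.sigma)) :=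
          rpow_le_of_neg_le ht (by linarith)
        have h3 := Real.rpow_nonneg ht.1.le (-(6000003 * K.sigma))
        rw [growth]
        linarith
    _ = _ := by
        rw [ENNReal.ofReal_mul (by norm_num)]
        ring

theorem IsSolution.energySq_one_lt_top (hu : IsSolution K u) (hσ1 : K.sigma ≤ 1)
    (h : highNorm u 0 1 < ⊤) : energySq K u 0 1 1 < ⊤ := by
  have h1 : (1 : ℝ) ∈ Ioc (0 : ℝ) 1 := right_mem_Ioc.2 one_pos
  refine (hu.energySq_le_modSq hσ1 0 h1).trans_lt (ENNReal.mul_lt_top ENNReal.ofReal_lt_top ?_)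
  have h2 : modSq K u 0 1 ^ (1 / 2 : ℝ) ≤ dataSum K u 0 :=
    Finset.single_le_sum (f := fun I => modSq K u I 1 ^ (1 / 2 : ℝ)) (fun _ _ => zero_le)
      (mem_multiIdx.2 (by simp [order]))
  have h3 := (h2.trans (hu.dataSum_le 0)).trans_lt (ENNReal.mul_lt_top ENNReal.ofReal_lt_top h)
  exact (ENNReal.rpow_lt_top_iff_of_pos (by norm_num)).1 h3

/-- On `(t, 1]` both `s⁻¹` and the growth factor are bounded by their values at `t`, so the
integrand lies below a finite constant. -/
theorem IsSolution.logInt_energySq_lt_top (hu : IsSolution K u) (hσ1 : K.sigma ≤ 1)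
    (h : highNorm u 0 1 < ⊤) {t : ℝ} (ht : t ∈ Ioc (0 : ℝ) 1) :
    logInt (fun s => energySq K u 0 s 1) t < ⊤ := by
  have hσ := K.sigma_nonneg
  set M := ENNReal.ofReal t⁻¹ * (ENNReal.ofReal (3600000 * t ^ (-(12000000 * K.sigma))) *
    energySq K u 0 1 1) with hM
  have hb : logInt (fun s => energySq K u 0 s 1) t ≤ ∫⁻ _ in Ioc t 1, M := by
    refine setLIntegral_mono' measurableSet_Ioc fun s hs => ?_
    have hs' : s ∈ Ioc (0 : ℝ) 1 := ⟨ht.1.trans hs.1, hs.2⟩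
    refine mul_le_mul' (ENNReal.ofReal_le_ofReal (inv_anti₀ ht.1 hs.1.le)) ?_
    refine (hu.energySq_le hσ1 0 hs').trans ?_
    gcongr ENNReal.ofReal (3600000 * ?_) * _
    exact Real.rpow_le_rpow_of_nonpos ht.1 hs.1.le (by linarith)
  refine hb.trans_lt ?_
  rw [setLIntegral_const]
  refine ENNReal.mul_lt_top ?_ measure_Ioc_lt_top
  exact ENNReal.mul_lt_top ENNReal.ofReal_lt_top
    (ENNReal.mul_lt_top ENNReal.ofReal_lt_top (hu.energySq_one_lt_top hσ1 h))

end

end LinKasner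

end

/-! ### The main theorem -/

open LinKasner in
theorem theorem5p1 :
    ∃ η C c σ₀ : ℝ, 0 < η ∧ 0 < C ∧ 0 < c ∧ 0 < σ₀ ∧
      ∀ K : Kasner, K.sigma ≤ σ₀ → ∀ u : LinVars, IsSolution K u →
        -- Approximate monotonicity of the total energy. The integrals that have a negative sign
        -- on the right are written on the left; all terms are finite.
        (highNorm u 0 1 < ⊤ → ∀ t ∈ Set.Ioc (0 : ℝ) 1,
          energySq K u 0 1 η < ⊤ ∧
          logInt (fun s => energySq K u 0 s η) t < ⊤ ∧
          energySq K u 0 t η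
              + ENNReal.ofReal (1 / 6 * η) * logInt (fun s => intGradH K u 0 s) t
              + ENNReal.ofReal (1 / 6) * logInt (fun s => intGradScalar K 0 s (u.Φ s)) t
              + ENNReal.ofReal (1 / 6) * logInt (fun s => intGradScalar K 0 s (u.n s)) t
              + ENNReal.ofReal (1 / 2) * logInt (fun s => intScalar 0 (u.n s)) t
            ≤ ENNReal.ofReal C * energySq K u 0 1 η
              + ENNReal.ofReal (c * K.sigma) * logInt (fun s => energySq K u 0 s η) t) ∧
        -- Energy bound and norm bound at every order.
        (∀ N : ℕ, highNorm u N 1 < ⊤ → ∀ t ∈ Set.Ioc (0 : ℝ) 1,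
          energyUpTo K u η N t
              ≤ ENNReal.ofReal C * energyUpTo K u η N 1 * ENNReal.ofReal (t ^ (-(c * K.sigma))) ∧
          highNorm u N t
              ≤ ENNReal.ofReal C * highNorm u N 1 * ENNReal.ofReal (t ^ (-(c * K.sigma)))) := by
  -- Taking `η = 1` is possible because the large relative weight sits in the auxiliary `modEnergy`
  -- and is paid for by `C = 300 · 12000`. The rate is `c = 300 · 40000 + 6`, where `6` accounts for
  -- the change to coordinate components, and `σ ≤ 1` enters through the lapse bound.
  refine ⟨1, 3600000, 12000006, 1, one_pos, by norm_num, by norm_num, one_pos,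
    fun K hσ u hu => ⟨fun h t ht => ⟨hu.energySq_one_lt_top hσ h,
      hu.logInt_energySq_lt_top hσ h ht, hu.energySq_add_le hσ ht⟩, fun N _ t ht =>
      ⟨hu.energyUpTo_le hσ N ht, hu.highNorm_le hσ N ht⟩⟩⟩
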